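/- Let $\psi,\varphi\in\mathbb C$ with $\psi\neq0$, $\varphi\ne 0$ and $\varphi^2=\frac{32}{\psi^5}-\frac34$, let $\omega$ be a primitive cube root of unity, and put $$G=3\sigma^2\tau^2-\tfrac12\sigma\tau(1+\sigma)(1+\tau)(1+\sigma\tau)+(1-\sigma+\sigma^2)(1-\tau+\tau^2)(1-\sigma\tau+\sigma^2\tau^2),$$ $$H=\sigma\tau(1-\sigma)(1-\tau)(1-\sigma\tau).$$ For $\mu=\pm\varphi$ let $C^0_\mu\subset\mathbb P^1\times\mathbb P^1$ be the curve of bidegree $(4,4)$ with affine equation $G+\mu H=0$. Let $\mathrm{dP}_5\subset\mathbb P^5$ be the Zariski closure of the image of $$\Psi(\sigma,\tau)=(\sigma^2\tau^2-1:\sigma\tau^2-1:\sigma^2\tau-1:\sigma\tau-1:\tau-1:\sigma-1),$$ with blow-down $\Phi:\mathrm{dP}_5\to\mathbb P^1\times\mathbb P^1$ inverse to $\Psi$. Let $G_z,H_z$ be the quadratic forms $$G_z=\tfrac12\big(2z_0^2-2z_0z_1-2z_0z_2-2z_0z_3+z_0z_4+z_0z_5+2z_1^2+z_1z_2-2z_1z_3-2z_1z_4+2z_2^2-2z_2z_3-2z_2z_5+6z_3^2-2z_3z_4-2z_3z_5+2z_4^2+z_4z_5+2z_5^2\big),$$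 $$H_z=\tfrac13\big(-2z_0z_3+z_0z_4+z_0z_5-z_1z_2+2z_1z_3+2z_2z_3-2z_3z_4-2z_3z_5+z_4z_5\big),$$ whose pullbacks under $\Psi$ are $G,H$; let $C_\mu=\{G_z+\mu H_z=0\}\subset\mathrm{dP}_5$. The Wiman pencil consists of the curves $aG_z+bH_z=0$ in $\mathrm{dP}_5$. The ten exceptional lines are $$\begin{aligned}&E_{12}:(2a+2b:a+2b:2a+b:a+b:b:a),\quad E_{13}:(a:b:0:0:0:0),\quad E_{14}:(0:0:a:0:0:b),\\ &E_{15}:(a:a:a:a:b:a),\quad E_{23}:(a:a:a:a:a:b),\quad E_{24}:(0:a:0:0:b:0),\quad E_{25}:(a:0:b:0:0:0),\\ &E_{34}:(a:b:a:b:0:b),\quad E_{35}:(0:b:a:0:b:a),\quad E_{45}:(a:a:b:b:b:0).\end{aligned}$$ Let $M_\psi\subset\mathbb P^4$ be the quintic $\sum x_j^5=5\psi x_1x_2x_3x_4x_5$ and $\mathcal G$ the group of maps $x_j\mapsto\zeta_jx_j$ with $\zeta_j^5=1$, $\prod\zeta_j=1$. The van Geemen lines of $M_\psi$ are the lines $$\big(u,\,v,\,\zeta^{-k-l}bu,\,\zeta^k(cu+\omega'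 v),\,-\zeta^l\omega'^2(cu-v)\big)$$ and those obtained from them by permuting the coordinates, where $\zeta$ is a primitive fifth and $\omega'$ a primitive cube root of unity, $k,l\in\mathbb Z$, $b=\frac32\psi\gamma^2$, $c=\frac12(1-\omega')\psi\gamma$ and $$\gamma^{10}-\tfrac19\gamma^5+\big(\tfrac2{3\psi}\big)^5=0.\qquad(*)$$ The family of lines with parameters $(\sigma,\tau)$, $(G+\mu H)(\sigma,\tau)=0$, consists of the lines $$\big(\alpha(\sigma,\tau)u,\ \alpha(\tau,\sigma)v,\ -\tau^{4/5}\beta(\sigma)(\sigma u+v),\ \beta(\sigma\tau)(\sigma u+\tau v),\ -\sigma^{4/5}\beta(\tau)(u+\tau v)\big)\qquad(\mathrm{fam})$$ in $M_\psi$, for all choices of the fifth roots for which this is a line lying in $M_\psi$, where $$\alpha(\sigma,\tau)^5=\sigma^4(1-\sigma)(1-\tau)(1-\sigma\tau)\big(1-\tau(1+\sigma)+\tau^2(1-\sigma+\sigma^2)\big),\qquad \beta(\sigma)^5=(1-\sigma)(1-\sigma+\sigma^2).$$ A limit of the family at $P\in C_\mu$ is a limit line of lines of the family whose parameters $(\sigma_n,\tau_n)$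 lie on $C^0_\mu$ with $\Psi(\sigma_n,\tau_n)\to P$. Then the following hold. 1. $C^0_\varphi\cap C^0_{-\varphi}$ consists of exactly the 17 points $(0,\infty)$, $(\infty,0)$, $(1,1)$, $(0,-\omega^j)$, $(-\omega^j,0)$, $(1,-\omega^j)$, $(-\omega^j,1)$, $(\infty,-\omega^j)$, $(-\omega^j,\infty)$ $(j=1,2)$, $(-\omega,-\omega^2)$, $(-\omega^2,-\omega)$. The first three are nodes of both curves; the other 14 are nonsingular points of both. 2. $\Phi$ is a well-defined map, bijective outside these three nodes, whose fibres over $(0,\infty)$, $(\infty,0)$, $(1,1)$ are $E_{24},E_{14},E_{12}$; all the $E_{ij}$ lie on $\mathrm{dP}_5$ and $\Phi(C_{\pm\varphi})=C^0_{\pm\varphi}$. The set $C_\varphi\cap C_{-\varphi}$ is the set of base points of the Wiman pencil and has 20 elements; $\Phi$ maps it onto the 17 points, with two base points over each of the three nodes and one over each of the other 14 points. Every base point lies on exactly one $E_{ij}$, each $E_{ij}$ contains exactly two of them, and these form $C_\varphi\cap E_{ij}=C_{-\varphi}\cap E_{ij}$. 3. The solutions of $(*)$ are the $\gamma$ with $\gamma^5=\frac19\big(\frac12-\frac{(\omega-\omega^2)\mu}{3}\big)$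 for $\mu=\varphi$ or $\mu=-\varphi$ (for $\omega=e^{2\pi i/3}$ this is $\frac19(\frac12-\frac{i\mu}{\sqrt3})$). For such $\mu$ and $\gamma$, with $b=\frac32\psi\gamma^2$, $c=\frac12(1-\omega)\psi\gamma$ and $\delta^5=\omega^2/(9\gamma^5)$, in each row of the following table there is an analytic branch of $C^0_\mu$ at $(\sigma_*,\tau_*)$ with $\sigma=\sigma_*+\varepsilon$ and the given expansion of $\tau$ (up to $O(\varepsilon^2)$ in the first three rows, $O(\varepsilon^3)$ in the last two) such that, for suitable choices of the fifth roots in $(\mathrm{fam})$ giving lines in $M_\psi$, the point of $(\mathrm{fam})$ with the given $(u,v)$ tends to the given point as $\varepsilon\to0$, for all $\tilde u,\tilde v$. * $(0,-\omega)$: $\tau=-\omega+9\gamma^5\varepsilon$, $(u,v)=\big(\frac{c\tilde u}{\varepsilon},-\tilde v\big)$, line $\big(\tilde u,\tilde v,-\omega^2(c\tilde u-\tilde v),c\tilde u+\omega\tilde v,b\tilde u\big)$. * $(1,-\omega)$: $\tau=-\omega+9\omega\gamma^5\varepsilon$, $(u,v)=\big(-\frac{\omega^2\tilde v}{\varepsilon^{1/5}},-\frac{c\tilde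 u+\omega\tilde v}{\varepsilon^{1/5}}\big)$, line $\big(\tilde v,c\tilde u+\omega\tilde v,-\omega^2(c\tilde u-\tilde v),\tilde u,b\tilde u\big)$. * $(-\omega,-\omega^2)$: $\tau=-\omega^2+\omega\big(\frac2{3\psi}\big)^5\frac{\varepsilon}{\gamma^{10}}$, $(u,v)=\big(\frac{c\tilde u+\omega\tilde v}{\delta\varepsilon^{1/5}},-\frac{\omega^2(c\tilde u-\tilde v)}{\delta\varepsilon^{1/5}}\big)$, line $\big(c\tilde u+\omega\tilde v,-\omega^2(c\tilde u-\tilde v),b\tilde u,\tilde v,\tilde u\big)$. * $(1,1)$: $\tau=1+\omega^2\varepsilon+(\omega+9\gamma^5)\varepsilon^2$, $(u,v)=\big(\frac{\omega c\tilde u}{\varepsilon^{6/5}}-\frac{\omega c\tilde u-\tilde v}{2\varepsilon^{1/5}},-\frac{\omega c\tilde u}{\varepsilon^{6/5}}-\frac{\omega c\tilde u-\tilde v}{2\varepsilon^{1/5}}\big)$, line $\big(b\tilde u,\tilde u,\tilde v,-\omega^2(c\tilde u-\tilde v),c\tilde u+\omega\tilde v\big)$. * $(1,1)$: $\tau=1+\omega\varepsilon-(\omega+9\gamma^5)\varepsilon^2$,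 $(u,v)=\big(-\frac{\omega c\tilde u}{\varepsilon^{6/5}}+\frac{\omega c\tilde u+\tilde v}{2\varepsilon^{1/5}},\frac{\omega c\tilde u}{\varepsilon^{6/5}}+\frac{\omega c\tilde u+\tilde v}{2\varepsilon^{1/5}}\big)$, line $\big(\tilde u,b\tilde u,\tilde v,c\tilde u+\omega\tilde v,-\omega^2(c\tilde u-\tilde v)\big)$. In each row the limits of the family at the corresponding base point ($\Psi(\sigma_*,\tau_*)$ in the first three rows, the points $(a:b)=(1:\omega^2)$, $(1:\omega)$ of $E_{12}$ in the last two) along $C_\mu$ are precisely the lines in the $\mathcal G$-orbit of the given line. 4. For each of the 20 base points $P$ and each $\mu=\pm\varphi$ the limits of the family at $P$ along $C_\mu$ form one $\mathcal G$-orbit, of 125 van Geemen lines. The 40 orbits so obtained, for the 40 pairs $(P,\mu)$, are pairwise disjoint, and their union is the set of all van Geemen lines of $M_\psi$, of which there are exactly $40\times125=5000$. -/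

import Mathlib

open Filter Topology Asymptotics
open scoped LinearAlgebra.Projectivization

noncomputable section

namespace DworkLines

/-! ### The pencil of curves in the product of two projective lines -/

/-- The affine polynomial `G(σ, τ)`. -/
def G (σ τ : ℂ) : ℂ :=
  3 * σ ^ 2 * τ ^ 2 - 1 / 2 * σ * τ * (1 + σ) * (1 + τ) * (1 + σ * τ)
    + (1 - σ + σ ^ 2) * (1 - τ + τ ^ 2) * (1 - σ * τ + σ ^ 2 * τ ^ 2)

/-- The affine polynomial `H(σ, τ)`. -/
def H (σ τ : ℂ) : ℂ := σ * τ * (1 - σ) * (1 - τ) * (1 - σ * τ)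

/-- The affine equation `G + μ H` of the curve `C⁰_μ`. -/
def affF (μ σ τ : ℂ) : ℂ := G σ τ + μ * H σ τ

/-- Bihomogenization of `G`, of bidegree `(4,4)`; `∞ = (1 : 0)`. -/
def bihomG (s t : Fin 2 → ℂ) : ℂ :=
  3 * s 0 ^ 2 * s 1 ^ 2 * t 0 ^ 2 * t 1 ^ 2
    - 1 / 2 * s 0 * s 1 * t 0 * t 1 * (s 1 + s 0) * (t 1 + t 0) * (s 1 * t 1 + s 0 * t 0)
    + (s 1 ^ 2 - s 0 * s 1 + s 0 ^ 2) * (t 1 ^ 2 - t 0 * t 1 + t 0 ^ 2)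
      * (s 1 ^ 2 * t 1 ^ 2 - s 0 * s 1 * t 0 * t 1 + s 0 ^ 2 * t 0 ^ 2)

/-- Bihomogenization of `H`, of bidegree `(4,4)`. -/
def bihomH (s t : Fin 2 → ℂ) : ℂ :=
  s 0 * s 1 * t 0 * t 1 * (s 1 - s 0) * (t 1 - t 0) * (s 1 * t 1 - s 0 * t 0)

/-- `s₂⁴ t₂⁴ (G + μ H)(s₁/s₂, t₁/t₂)`. -/
def bihomF (μ : ℂ) (s t : Fin 2 → ℂ) : ℂ := bihomG s t + μ * bihomH s t

/-- The complex projective line. -/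
abbrev P1 : Type := ℙ ℂ (Fin 2 → ℂ)

/-- The complex projective space of dimension five. -/
abbrev P5 : Type := ℙ ℂ (Fin 6 → ℂ)

/-- The vector `v` is a vector of homogeneous coordinates of the point `P`. -/
def Represents {n : ℕ} (P : ℙ ℂ (Fin n → ℂ)) (v : Fin n → ℂ) : Prop :=
  ∃ hv : v ≠ 0, Projectivization.mk ℂ v hv = P

/-- The point `(a : 1)`. -/
def aff (a : ℂ) : P1 :=
  Projectivization.mk ℂ ![a, 1] (fun h => one_ne_zero (congrFun h 1))

/-- The point `∞ = (1 : 0)`. -/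
def infty : P1 :=
  Projectivization.mk ℂ ![1, 0] (fun h => one_ne_zero (congrFun h 0))

/-- The projective curve `C⁰_μ` in `P¹ × P¹`. -/
def curve0 (μ : ℂ) : Set (P1 × P1) := {p | bihomF μ p.1.rep p.2.rep = 0}

/-- The points `(0,∞)`, `(∞,0)`, `(1,1)`. -/
def nodes : Set (P1 × P1) := {(aff 0, infty), (infty, aff 0), (aff 1, aff 1)}

/-- The list of seventeen points of `P¹ × P¹` (`ω` is a primitive cube root of unity). -/
def meetingPoints (ω : ℂ) : Set (P1 × P1) :=
  {(aff 0, infty), (infty, aff 0), (aff 1, aff 1),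
   (aff 0, aff (-ω)), (aff 0, aff (-ω ^ 2)), (aff 1, aff (-ω)), (aff 1, aff (-ω ^ 2)),
   (aff (-ω), aff (-ω ^ 2)), (aff (-ω), infty), (aff (-ω ^ 2), infty),
   (aff (-ω), aff 0), (aff (-ω ^ 2), aff 0), (aff (-ω), aff 1), (aff (-ω ^ 2), aff 1),
   (aff (-ω ^ 2), aff (-ω)), (infty, aff (-ω)), (infty, aff (-ω ^ 2))}

/-- In a local affine chart of `P¹ × P¹` centred at `p`, the equation of `C⁰_μ` is
`Q + o(‖x‖ⁿ)`. -/
def HasLocalForm (μ : ℂ) (p : P1 × P1) (Q : ℂ × ℂ → ℂ) (n : ℕ) : Prop :=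
  ∃ s s' t t' : Fin 2 → ℂ, Represents p.1 s ∧ Represents p.2 t ∧
    s 0 * s' 1 - s 1 * s' 0 ≠ 0 ∧ t 0 * t' 1 - t 1 * t' 0 ≠ 0 ∧
    (fun x : ℂ × ℂ => bihomF μ (s + x.1 • s') (t + x.2 • t') - Q x)
      =o[𝓝 0] fun x : ℂ × ℂ => ‖x‖ ^ n

/-- `p` is a node (ordinary double point) of `C⁰_μ`. -/
def IsNodeAt (μ : ℂ) (p : P1 × P1) : Prop :=
  ∃ A B C : ℂ, B ^ 2 - 4 * A * C ≠ 0 ∧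
    HasLocalForm μ p (fun x => A * x.1 ^ 2 + B * x.1 * x.2 + C * x.2 ^ 2) 2

/-- `p` is a nonsingular point of `C⁰_μ`. -/
def IsSmoothAt (μ : ℂ) (p : P1 × P1) : Prop :=
  ∃ A B : ℂ, (A ≠ 0 ∨ B ≠ 0) ∧ HasLocalForm μ p (fun x => A * x.1 + B * x.2) 1

/-! ### The quintic del Pezzo surface and the Wiman pencil -/

/-- The six polynomials of bidegree at most `(2,2)` that give the anticanonical map `Ψ`. -/
def psiVec (σ τ : ℂ) : Fin 6 → ℂ :=
  ![σ ^ 2 * τ ^ 2 - 1, σ * τ ^ 2 - 1, σ ^ 2 * τ - 1, σ * τ - 1, τ - 1, σ - 1]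

/-- The quintic del Pezzo surface in `P⁵`: the Zariski closure of the image of `Ψ`. -/
def dP5 : Set P5 :=
  {P | ∀ (f : MvPolynomial (Fin 6) ℂ) (n : ℕ), f.IsHomogeneous n →
    (∀ σ τ : ℂ, MvPolynomial.eval (psiVec σ τ) f = 0) → MvPolynomial.eval P.rep f = 0}

/-- The blow-down `Φ : dP₅ → P¹ × P¹`, as a relation. It says that `p = (s, t)` with
`s = (z₃ - z₅ : z₄) = (z₂ - z₅ : z₃) = (z₀ - z₅ : z₁)` and
`t = (z₃ - z₄ : z₅) = (z₁ - z₄ : z₃) = (z₀ - z₄ : z₂)`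
for those of the pairs that are not `(0, 0)`. -/
def BlowDown (P : P5) (p : P1 × P1) : Prop :=
  let z := P.rep
  let s := p.1.rep
  let t := p.2.rep
  s 0 * z 4 = s 1 * (z 3 - z 5) ∧ s 0 * z 3 = s 1 * (z 2 - z 5) ∧
  s 0 * z 1 = s 1 * (z 0 - z 5) ∧ t 0 * z 5 = t 1 * (z 3 - z 4) ∧
  t 0 * z 3 = t 1 * (z 1 - z 4) ∧ t 0 * z 2 = t 1 * (z 0 - z 4)

/-- The `S₅`-invariant quadratic form, normalized so that its pullback under `Ψ` is `G`. -/
def Gz (z : Fin 6 → ℂ) : ℂ :=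
  1 / 2 * (2 * z 0 ^ 2 - 2 * z 0 * z 1 - 2 * z 0 * z 2 - 2 * z 0 * z 3 + z 0 * z 4 + z 0 * z 5
    + 2 * z 1 ^ 2 + z 1 * z 2 - 2 * z 1 * z 3 - 2 * z 1 * z 4 + 2 * z 2 ^ 2 - 2 * z 2 * z 3
    - 2 * z 2 * z 5 + 6 * z 3 ^ 2 - 2 * z 3 * z 4 - 2 * z 3 * z 5 + 2 * z 4 ^ 2 + z 4 * z 5
    + 2 * z 5 ^ 2)

/-- The quadratic form that is `S₅`-invariant up to sign; its pullback under `Ψ` is `H`. -/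
def Hz (z : Fin 6 → ℂ) : ℂ :=
  1 / 3 * (-2 * z 0 * z 3 + z 0 * z 4 + z 0 * z 5 - z 1 * z 2 + 2 * z 1 * z 3 + 2 * z 2 * z 3
    - 2 * z 3 * z 4 - 2 * z 3 * z 5 + z 4 * z 5)

theorem Gz_psiVec (σ τ : ℂ) : Gz (psiVec σ τ) = G σ τ := by
  simp [Gz, psiVec, G]; ring

theorem Hz_psiVec (σ τ : ℂ) : Hz (psiVec σ τ) = H σ τ := by
  simp [Hz, psiVec, H]; ring

/-- The member `a G + b H = 0` of the Wiman pencil on `dP₅`. -/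
def wimanCurve (a b : ℂ) : Set P5 := {P | P ∈ dP5 ∧ a * Gz P.rep + b * Hz P.rep = 0}

/-- The resolved curve `C_μ` in `dP₅`. -/
def curve (μ : ℂ) : Set P5 := wimanCurve 1 μ

/-- The base points of the Wiman pencil: the points common to all of its members. -/
def basePoints : Set P5 := {P | ∀ a b : ℂ, (a ≠ 0 ∨ b ≠ 0) → P ∈ wimanCurve a b}

/-- Linear parametrizations of the ten exceptional lines of `dP₅`, in the order
`E₁₂, E₁₃, E₁₄, E₁₅, E₂₃, E₂₄, E₂₅, E₃₄, E₃₅, E₄₅`. -/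
def excVec (k : Fin 10) (a b : ℂ) : Fin 6 → ℂ :=
  match k with
  | 0 => ![2 * a + 2 * b, a + 2 * b, 2 * a + b, a + b, b, a]
  | 1 => ![a, b, 0, 0, 0, 0]
  | 2 => ![0, 0, a, 0, 0, b]
  | 3 => ![a, a, a, a, b, a]
  | 4 => ![a, a, a, a, a, b]
  | 5 => ![0, a, 0, 0, b, 0]
  | 6 => ![a, 0, b, 0, 0, 0]
  | 7 => ![a, b, a, b, 0, b]
  | 8 => ![0, b, a, 0, b, a]
  | 9 => ![a, a, b, b, b, 0]

/-- The ten exceptional lines `E_ij`, ordered as above. -/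
def excLine (k : Fin 10) : Set P5 := {P | ∃ a b : ℂ, Represents P (excVec k a b)}

/-! ### Lines on the Dwork quintic -/

/-- The equation of the quintic `M_ψ`. -/
def dworkQuintic (ψ : ℂ) (x : Fin 5 → ℂ) : ℂ :=
  (∑ i, x i ^ 5) - 5 * ψ * ∏ i, x i

/-- `L` is (the two-dimensional vector space of) a line of `P⁴` that lies in `M_ψ`. -/
def IsDworkLine (ψ : ℂ) (L : Submodule ℂ (Fin 5 → ℂ)) : Prop :=
  Module.finrank ℂ L = 2 ∧ ∀ x ∈ L, dworkQuintic ψ x = 0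

/-- The image of a line under the permutation `π` of the coordinates. -/
def permLine (π : Equiv.Perm (Fin 5)) (L : Submodule ℂ (Fin 5 → ℂ)) :
    Submodule ℂ (Fin 5 → ℂ) :=
  L.map (LinearMap.funLeft ℂ ℂ π)

/-- The orbit of a line under the group of diagonal maps
`x ↦ (ζ^{n₁} x₁, …, ζ^{n₅} x₅)`, `ζ⁵ = 1`, `∑ nⱼ = 0 mod 5`. -/
def gOrbit (L : Submodule ℂ (Fin 5 → ℂ)) : Set (Submodule ℂ (Fin 5 → ℂ)) :=
  {L' | ∃ g : Fin 5 → ℂ, (∀ i, g i ^ 5 = 1) ∧ ∏ i, g i = 1 ∧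
    L' = L.map (Matrix.toLin' (Matrix.diagonal g))}

/-- The coefficient `b` of a van Geemen line. -/
def coefB (ψ γ : ℂ) : ℂ := 3 / 2 * ψ * γ ^ 2

/-- The coefficient `c` of a van Geemen line. -/
def coefC (ω ψ γ : ℂ) : ℂ := 1 / 2 * (1 - ω) * ψ * γ

/-- The tenth order equation for `γ`. -/
def GammaEq (ψ γ : ℂ) : Prop := γ ^ 10 - 1 / 9 * γ ^ 5 + (2 / (3 * ψ)) ^ 5 = 0

/-- The point `(u, v, ζ^{-k-l} b u, ζ^k (c u + ω v), -ζ^l ω² (c u - v))`. -/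
def vgPoint (ω ζ b c : ℂ) (k l : ℤ) (u v : ℂ) : Fin 5 → ℂ :=
  ![u, v, ζ ^ (-k - l) * b * u, ζ ^ k * (c * u + ω * v), -(ζ ^ l * ω ^ 2 * (c * u - v))]

/-- The van Geemen lines of `M_ψ`. -/
def vanGeemenLines (ψ : ℂ) : Set (Submodule ℂ (Fin 5 → ℂ)) :=
  {L | ∃ (ω ζ γ : ℂ) (k l : ℤ) (π : Equiv.Perm (Fin 5)),
    IsPrimitiveRoot ω 3 ∧ IsPrimitiveRoot ζ 5 ∧ GammaEq ψ γ ∧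
    L = permLine π (Submodule.span ℂ
      {vgPoint ω ζ (coefB ψ γ) (coefC ω ψ γ) k l 1 0,
       vgPoint ω ζ (coefB ψ γ) (coefC ω ψ γ) k l 0 1})}

/-! ### The explicit family of lines -/

/-- The polynomial `α(σ, τ)⁵`. -/
def alpha5 (σ τ : ℂ) : ℂ :=
  σ ^ 4 * (1 - σ) * (1 - τ) * (1 - σ * τ) * (1 - τ * (1 + σ) + τ ^ 2 * (1 - σ + σ ^ 2))

/-- The polynomial `β(σ)⁵`. -/
def beta5 (σ : ℂ) : ℂ := (1 - σ) * (1 - σ + σ ^ 2)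

/-- A choice of fifth roots: `s = σ^{1/5}`, `t = τ^{1/5}`, `a₁ = α(σ, τ)`, `a₂ = α(τ, σ)`,
`b₁ = β(σ)`, `b₂ = β(τ)`, `b₃ = β(σ τ)`. -/
structure FifthRoots where
  s : ℂ
  t : ℂ
  a₁ : ℂ
  a₂ : ℂ
  b₁ : ℂ
  b₂ : ℂ
  b₃ : ℂ

/-- `r` is a choice of fifth roots at `(σ, τ)`. -/
def FifthRoots.IsAt (r : FifthRoots) (σ τ : ℂ) : Prop :=
  r.s ^ 5 = σ ∧ r.t ^ 5 = τ ∧ r.a₁ ^ 5 = alpha5 σ τ ∧ r.a₂ ^ 5 = alpha5 τ σ ∧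
  r.b₁ ^ 5 = beta5 σ ∧ r.b₂ ^ 5 = beta5 τ ∧ r.b₃ ^ 5 = beta5 (σ * τ)

/-- The point with coordinates `(u, v)` on the line with parameters `(σ, τ)`. -/
def famPoint (r : FifthRoots) (σ τ u v : ℂ) : Fin 5 → ℂ :=
  ![r.a₁ * u, r.a₂ * v, -(r.t ^ 4 * r.b₁ * (σ * u + v)), r.b₃ * (σ * u + τ * v),
    -(r.s ^ 4 * r.b₂ * (u + τ * v))]

/-- The span of the points of the family with parameters `(σ, τ)`. -/
def famLine (r : FifthRoots) (σ τ : ℂ) : Submodule ℂ (Fin 5 → ℂ) :=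
  Submodule.span ℂ {famPoint r σ τ 1 0, famPoint r σ τ 0 1}

/-- `L` is a line of the family in `M_ψ` with parameters `(σ, τ)`, for some choice of the
fifth roots. -/
def IsFamilyLine (ψ σ τ : ℂ) (L : Submodule ℂ (Fin 5 → ℂ)) : Prop :=
  IsDworkLine ψ L ∧ ∃ r : FifthRoots, r.IsAt σ τ ∧ L = famLine r σ τ

/-- The lines that are limits of lines of the family in `M_ψ` whose parameters `(σₙ, τₙ)` move
on the curve `C⁰_μ` in such a way that `Ψ(σₙ, τₙ)` tends to the point `P` of `P⁵`.
Convergence in a projective space or a Grassmannian is convergence of suitable homogeneous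
coordinates or bases. -/
def limitLines (ψ μ : ℂ) (P : P5) : Set (Submodule ℂ (Fin 5 → ℂ)) :=
  {L | ∃ (σ τ lam : ℕ → ℂ) (x y : ℕ → Fin 5 → ℂ) (z : Fin 6 → ℂ) (x₀ y₀ : Fin 5 → ℂ),
    (∀ n, affF μ (σ n) (τ n) = 0 ∧
      IsFamilyLine ψ (σ n) (τ n) (Submodule.span ℂ {x n, y n})) ∧
    Represents P z ∧ Tendsto (fun n => lam n • psiVec (σ n) (τ n)) atTop (𝓝 z) ∧
    Tendsto x atTop (𝓝 x₀) ∧ Tendsto y atTop (𝓝 y₀) ∧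
    LinearIndependent ℂ ![x₀, y₀] ∧ L = Submodule.span ℂ {x₀, y₀}}

/-- The value of `γ⁵` that belongs to the curve `C_μ`; for `ω = exp(2πi/3)` it is
`(1/2 - i μ / √3) / 9`. -/
def gamma5 (ω μ : ℂ) : ℂ := 1 / 9 * (1 / 2 - (ω - ω ^ 2) * μ / 3)

/-- The limiting process at the point `(s₀, t₀)` of `C⁰_μ` that leads to the point `P` of `dP₅`.
A branch of the curve is `σ = s₀ + ε`, `τ = t₀ + t₁ ε + t₂ ε² + O(εⁿ)`, and with `ε = e⁵`, the
substitution `(u, v) = uv e ũ ṽ` and suitable fifth roots, the point of the line tends to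
`row ũ ṽ`. Moreover the limits at `P` along `C_μ` are the translates of the line
`row` under the diagonal group. -/
def LimitingProcess (ψ μ : ℂ) (P : Fin 6 → ℂ) (s₀ t₀ t₁ t₂ : ℂ) (n : ℕ)
    (uv : ℂ → ℂ → ℂ → ℂ × ℂ) (row : ℂ → ℂ → Fin 5 → ℂ) : Prop :=
  (∃ τ : ℂ → ℂ, AnalyticAt ℂ τ 0 ∧
    (∀ᶠ ε in 𝓝 (0 : ℂ), affF μ (s₀ + ε) (τ ε) = 0) ∧
    ((fun ε => τ ε - (t₀ + t₁ * ε + t₂ * ε ^ 2)) =O[𝓝 (0 : ℂ)] fun ε => ε ^ n) ∧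
    ∃ r : ℂ → FifthRoots,
      (∀ᶠ e in 𝓝[≠] (0 : ℂ), (r e).IsAt (s₀ + e ^ 5) (τ (e ^ 5)) ∧
        IsDworkLine ψ (famLine (r e) (s₀ + e ^ 5) (τ (e ^ 5)))) ∧
      ∀ u v : ℂ, Tendsto
        (fun e => famPoint (r e) (s₀ + e ^ 5) (τ (e ^ 5)) (uv e u v).1 (uv e u v).2)
        (𝓝[≠] 0) (𝓝 (row u v))) ∧
  ∃ Q ∈ basePoints, Represents Q P ∧
    limitLines ψ μ Q = gOrbit (Submodule.span ℂ {row 1 0, row 0 1})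

end DworkLines

end

open DworkLines

namespace DworkLines

/-! ### Cube roots of unity -/

/-! Two curves of the pencil with opposite nonzero parameters meet exactly where `G = H = 0`. `H`
splits into five factors, and on each of them `G` reduces, up to units and squares of `1 - a`, to `1
- a + a²`; this yields the seventeen points. The blow-down equations are linear in the coordinates
of `P⁵`: off the nodes their only solution is the point `psiBi s t`, at a node they cut out an
exceptional line. On each of the ten exceptional lines `H` vanishes and `G` is `X² - XY + Y²` in a
suitable coordinate, so the base points come in pairs, indexed by the line and a primitive cube root
of unity.

A line of the family has coordinates `Dᵢ ℓᵢ(u, v)`, with five fixed linear forms and prescribed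
fifth powers `Dᵢ⁵ = coef5`. Two identities carry everything. By `sum_coef5_mul_ell` the quintic
restricted to the line is a scalar times `∏ ℓᵢ`, so the line lies in `M_ψ` iff `∏ Dᵢ = 2στH/ψ`. By
`prod_coef5` the fifth power of this condition holds automatically on the curves `C⁰_{±φ}`. Hence
the lines over one parameter are the translates of any one of them under `𝒢`.

Therefore a single convergent choice of roots along a branch determines all limits
(`limitLines_eq_gOrbit`): another sequence on the branch differs from it by elements of a finite
group. The branch is a graph by the implicit function theorem, after blowing up when the point is a
node. Roots whose limit is a line in `M_ψ` satisfy the product condition by themselves, because the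
discrepancy is a fifth root of unity tending to one (`eventually_prod_eq`). The rows of the table
then reduce to polynomial identities, gathered in `limitingProcess_of`.

The table gives the limits on four exceptional lines; three birational involutions of the family,
which permute the coordinates and send `μ` to `±μ`, give the other six (`limitLines_bp`). Replacing
`ω` by `ω²` exchanges the last two coordinates of a van Geemen line, and passing to the other root
of the equation for `γ⁵` exchanges the coordinates `0` and `2`. So all limits are coordinate
permutations of one line, up to `𝒢`. Modulo `𝒢`, that line is stabilized exactly by a three-cycle
(`perm_eq_pow`, where `φ ≠ 0` enters as `b¹⁰ ≠ 1`). The `120 / 3 = 40` cosets correspond to the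
pairs `(P, μ)`, and each orbit has `5³` lines. -/

theorem cube_root_sum {ω : ℂ} (hω : IsPrimitiveRoot ω 3) : ω ^ 2 + ω + 1 = 0 := by
  have h1 : ω ≠ 1 := hω.ne_one (by norm_num)
  have h3 : ω ^ 3 = 1 := hω.pow_eq_one
  have : (ω - 1) * (ω ^ 2 + ω + 1) = 0 := by linear_combination h3
  exact (mul_eq_zero.1 this).resolve_left (sub_ne_zero.2 h1)

/-- The quadratic `1 - a + a²` is what remains of `G` on the components of `H = 0`; its roots, the
primitive sixth roots of unity, supply all coordinates other than `0`, `1`, `∞`. -/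
theorem cube_root_cases {ω a : ℂ} (hω : IsPrimitiveRoot ω 3) :
    1 - a + a ^ 2 = 0 ↔ a = -ω ∨ a = -ω ^ 2 := by
  have h := cube_root_sum hω
  have : 1 - a + a ^ 2 = (a - -ω) * (a - -ω ^ 2) := by
    linear_combination (1 - ω - a) * h
  rw [this, mul_eq_zero, sub_eq_zero, sub_eq_zero]

theorem primitive_sq {ω : ℂ} (hω : IsPrimitiveRoot ω 3) : IsPrimitiveRoot (ω ^ 2) 3 :=
  hω.pow_of_coprime 2 (by norm_num)

theorem primitive_cube_root_cases {ω w : ℂ} (hω : IsPrimitiveRoot ω 3)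
    (hw : IsPrimitiveRoot w 3) : w = ω ∨ w = ω ^ 2 := by
  have h := cube_root_sum hw
  have := (cube_root_cases (a := -w) hω).1 (by linear_combination h)
  simpa using this

theorem ne_facts {ω : ℂ} (hω : IsPrimitiveRoot ω 3) :
    ω ≠ 0 ∧ ω ≠ 1 ∧ ω ≠ -1 ∧ ω ≠ ω ^ 2 ∧ ω ^ 2 ≠ 1 ∧ ω ^ 2 ≠ -1 ∧ ω - ω ^ 2 ≠ 0 ∧ 1 + 2 * ω ≠ 0 := by
  have h := cube_root_sum hω
  have h3 : ω ^ 3 = 1 := hω.pow_eq_one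
  have h0 : ω ≠ 0 := hω.ne_zero (by norm_num)
  have h1 : ω ≠ 1 := hω.ne_one (by norm_num)
  have hs : ω - ω ^ 2 ≠ 0 := by
    intro h'
    have : ω * (1 - ω) = 0 := by linear_combination h'
    rcases mul_eq_zero.1 this with h'' | h''
    · exact h0 h''
    · exact h1 (by linear_combination -h'')
  refine ⟨h0, h1, ?_, sub_ne_zero.1 hs, ?_, ?_, hs, ?_⟩
  · rintro rfl; norm_num at h
  · intro h'
    exact h1 (by linear_combination h3 - ω * h')
  · intro h'
    exact h0 (by linear_combination h - h')
  · intro h'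
    exact hs (by linear_combination -h + h')

/-! ### Points of the projective line -/

theorem Represents.rep {n : ℕ} {P : ℙ ℂ (Fin n → ℂ)} {v : Fin n → ℂ} (h : Represents P v) :
    ∃ a : ℂ, a ≠ 0 ∧ P.rep = a • v := by
  obtain ⟨hv, rfl⟩ := h
  obtain ⟨a, ha⟩ := Projectivization.exists_smul_eq_mk_rep ℂ v hv
  exact ⟨a, a.ne_zero, ha.symm⟩

theorem represents_rep {n : ℕ} (P : ℙ ℂ (Fin n → ℂ)) : Represents P P.rep :=
  ⟨P.rep_nonzero, P.mk_rep⟩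

theorem Represents.smul_eq {n : ℕ} {P : ℙ ℂ (Fin n → ℂ)} {v w : Fin n → ℂ} (h : Represents P v)
    (h' : Represents P w) : ∃ a : ℂ, a ≠ 0 ∧ w = a • v := by
  obtain ⟨hv, rfl⟩ := h
  obtain ⟨hw, h'⟩ := h'
  obtain ⟨a, ha⟩ := (Projectivization.mk_eq_mk_iff' ℂ w v hw hv).1 h'
  refine ⟨a, ?_, ha.symm⟩
  rintro rfl
  exact hw (by simpa using ha.symm)

theorem Represents.of_smul {n : ℕ} {P : ℙ ℂ (Fin n → ℂ)} {v : Fin n → ℂ} (h : Represents P v)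
    {a : ℂ} (ha : a ≠ 0) : Represents P (a • v) := by
  obtain ⟨hv, rfl⟩ := h
  refine ⟨smul_ne_zero ha hv, ?_⟩
  rw [Projectivization.mk_eq_mk_iff']
  exact ⟨a, rfl⟩

theorem Represents.unique {n : ℕ} {P Q : ℙ ℂ (Fin n → ℂ)} {v : Fin n → ℂ} (h : Represents P v)
    (h' : Represents Q v) : P = Q := by
  obtain ⟨hv, rfl⟩ := h
  obtain ⟨hw, rfl⟩ := h'
  rfl

theorem represents_aff (a : ℂ) : Represents (aff a) ![a, 1] := ⟨_, rfl⟩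

theorem represents_infty : Represents infty ![1, 0] := ⟨_, rfl⟩

theorem aff_inj {a b : ℂ} : aff a = aff b ↔ a = b := by
  constructor
  · intro h
    obtain ⟨c, -, hc⟩ := (represents_aff a).smul_eq (h ▸ represents_aff b)
    have h0 := congrFun hc 0
    have h1 := congrFun hc 1
    simp at h0 h1
    rw [← h1] at h0
    simpa using h0.symm
  · rintro rfl; rfl

theorem aff_ne_infty (a : ℂ) : aff a ≠ infty := by
  intro h
  obtain ⟨c, hc0, hc⟩ := (represents_aff a).smul_eq (h ▸ represents_infty)
  have h1 := congrFun hc 1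
  simp at h1
  exact hc0 h1.symm

theorem infty_ne_aff (a : ℂ) : infty ≠ aff a := (aff_ne_infty a).symm

theorem represents_P1 {p : P1} {s : Fin 2 → ℂ} (h : Represents p s) :
    (s 1 = 0 ∧ p = infty) ∨ (s 1 ≠ 0 ∧ p = aff (s 0 / s 1)) := by
  by_cases h1 : s 1 = 0
  · left
    refine ⟨h1, ?_⟩
    have h0 : s 0 ≠ 0 := by
      intro h0
      obtain ⟨hs, -⟩ := h
      exact hs (by ext i; fin_cases i <;> simp [h0, h1])
    refine (h.of_smul (inv_ne_zero h0)).unique ?_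
    convert! represents_infty using 1
    ext i; fin_cases i <;> simp [h0, h1]
  · right
    refine ⟨h1, (h.of_smul (inv_ne_zero h1)).unique ?_⟩
    convert! represents_aff _ using 1
    ext i; fin_cases i <;> simp [h1]; field_simp

theorem P1_cases (p : P1) : p = infty ∨ ∃ a, p = aff a := by
  rcases represents_P1 (represents_rep p) with h | h
  · exact Or.inl h.2
  · exact Or.inr ⟨_, h.2⟩

/-! ### The curves in the product of two projective lines -/

theorem bihomG_smul (a b : ℂ) (s t : Fin 2 → ℂ) :
    bihomG (a • s) (b • t) = a ^ 4 * b ^ 4 * bihomG s t := by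
  simp only [bihomG, Pi.smul_apply, smul_eq_mul]; ring

theorem bihomH_smul (a b : ℂ) (s t : Fin 2 → ℂ) :
    bihomH (a • s) (b • t) = a ^ 4 * b ^ 4 * bihomH s t := by
  simp only [bihomH, Pi.smul_apply, smul_eq_mul]; ring

theorem bihomF_smul (μ a b : ℂ) (s t : Fin 2 → ℂ) :
    bihomF μ (a • s) (b • t) = a ^ 4 * b ^ 4 * bihomF μ s t := by
  simp only [bihomF, bihomG_smul, bihomH_smul]; ring

theorem mem_curve0_iff {μ : ℂ} {p : P1 × P1} {s t : Fin 2 → ℂ} (hs : Represents p.1 s)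
    (ht : Represents p.2 t) : p ∈ curve0 μ ↔ bihomF μ s t = 0 := by
  obtain ⟨a, ha, hs⟩ := hs.rep
  obtain ⟨b, hb, ht⟩ := ht.rep
  simp [curve0, hs, ht, bihomF_smul, ha, hb]

theorem bihomF_inter {φ : ℂ} (hφ : φ ≠ 0) (s t : Fin 2 → ℂ) :
    (bihomF φ s t = 0 ∧ bihomF (-φ) s t = 0) ↔ bihomG s t = 0 ∧ bihomH s t = 0 := by
  unfold bihomF
  constructor
  · rintro ⟨h1, h2⟩
    refine ⟨by linear_combination (h1 + h2) / 2, ?_⟩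
    have : φ * bihomH s t = 0 := by linear_combination (h1 - h2) / 2
    exact (mul_eq_zero.1 this).resolve_left hφ
  · rintro ⟨h1, h2⟩
    simp [h1, h2]

/-- Each factor of `H` is treated separately. On `σ = 0` or `τ = 0` the polynomial `G` is `1 - a +
a²` in the other variable, on `σ = 1` or `τ = 1` it is `(1 - a)² (1 - a + a²)`, and on `στ = 1` this
last polynomial in `σ` equals `σ² G`. -/
theorem G_H_zero_cases {ω : ℂ} (hω : IsPrimitiveRoot ω 3) {σ τ : ℂ} (hG : G σ τ = 0)
    (hH : H σ τ = 0) : (σ = 1 ∧ τ = 1) ∨ (σ = 0 ∧ (τ = -ω ∨ τ = -ω ^ 2)) ∨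
      (τ = 0 ∧ (σ = -ω ∨ σ = -ω ^ 2)) ∨ (σ = 1 ∧ (τ = -ω ∨ τ = -ω ^ 2)) ∨
      (τ = 1 ∧ (σ = -ω ∨ σ = -ω ^ 2)) ∨ (σ = -ω ∧ τ = -ω ^ 2) ∨ (σ = -ω ^ 2 ∧ τ = -ω) := by
  have hsum := cube_root_sum hω
  have h3 : ω ^ 3 = 1 := hω.pow_eq_one
  have key : ∀ a : ℂ, (1 - a) ^ 2 * (1 - a + a ^ 2) = 0 → a = 1 ∨ a = -ω ∨ a = -ω ^ 2 := by
    intro a ha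
    rcases mul_eq_zero.1 ha with h | h
    · left
      have := pow_eq_zero_iff (two_ne_zero) |>.1 h
      linear_combination -this
    · exact Or.inr ((cube_root_cases hω).1 h)
  simp only [H, mul_eq_zero] at hH
  rcases hH with (((rfl | rfl) | h) | h) | h
  · simp only [G] at hG
    right; left
    exact ⟨rfl, (cube_root_cases hω).1 (by linear_combination hG)⟩
  · simp only [G] at hG
    right; right; left
    exact ⟨rfl, (cube_root_cases hω).1 (by linear_combination hG)⟩
  · obtain rfl : σ = 1 := by linear_combination -h
    simp only [G] at hG
    rcases key τ (by linear_combination hG) with h | h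
    · exact Or.inl ⟨rfl, h⟩
    · exact Or.inr (Or.inr (Or.inr (Or.inl ⟨rfl, h⟩)))
  · obtain rfl : τ = 1 := by linear_combination -h
    simp only [G] at hG
    rcases key σ (by linear_combination hG) with h | h
    · exact Or.inl ⟨h, rfl⟩
    · exact Or.inr (Or.inr (Or.inr (Or.inr (Or.inl ⟨rfl, h⟩))))
  · have hστ : σ * τ = 1 := by linear_combination -h
    have hσ : (1 - σ) ^ 2 * (1 - σ + σ ^ 2) = 0 := by
      simp only [G] at hG
      have e : σ * τ = 1 := hστ
      have : (1 - σ) ^ 2 * (1 - σ + σ ^ 2) = σ ^ 2 * (3 * σ ^ 2 * τ ^ 2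
          - 1 / 2 * σ * τ * (1 + σ) * (1 + τ) * (1 + σ * τ)
          + (1 - σ + σ ^ 2) * (1 - τ + τ ^ 2) * (1 - σ * τ + σ ^ 2 * τ ^ 2)) := by
        have e' : 3 * σ ^ 2 * τ ^ 2
          - 1 / 2 * σ * τ * (1 + σ) * (1 + τ) * (1 + σ * τ)
          + (1 - σ + σ ^ 2) * (1 - τ + τ ^ 2) * (1 - σ * τ + σ ^ 2 * τ ^ 2) =
          3 * (σ * τ) ^ 2 - 1 / 2 * (σ * τ) * (1 + σ) * (1 + τ) * (1 + σ * τ)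
          + (1 - σ + σ ^ 2) * (1 - τ + τ ^ 2) * (1 - σ * τ + (σ * τ) ^ 2) := by ring
        rw [e', e]
        linear_combination (-(σ * τ + 1) * (1 - σ + σ ^ 2) + σ * (1 - σ + σ ^ 2)
          + σ * (1 + σ)) * e
      rw [this, hG, mul_zero]
    have h0 : σ ≠ 0 := by rintro rfl; simp at hστ
    rcases key σ hσ with rfl | rfl | rfl
    · left; exact ⟨rfl, by simpa using hστ⟩
    · refine Or.inr (Or.inr (Or.inr (Or.inr (Or.inr (Or.inl ⟨rfl, ?_⟩)))))
      apply mul_left_cancel₀ h0; linear_combination hστ - h3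
    · refine Or.inr (Or.inr (Or.inr (Or.inr (Or.inr (Or.inr ⟨rfl, ?_⟩)))))
      apply mul_left_cancel₀ h0; linear_combination hστ - h3

theorem G_H_zero {ω : ℂ} (hω : IsPrimitiveRoot ω 3) {σ τ : ℂ} :
    (G σ τ = 0 ∧ H σ τ = 0) ↔ (σ = 1 ∧ τ = 1) ∨ (σ = 0 ∧ (τ = -ω ∨ τ = -ω ^ 2)) ∨
      (τ = 0 ∧ (σ = -ω ∨ σ = -ω ^ 2)) ∨ (σ = 1 ∧ (τ = -ω ∨ τ = -ω ^ 2)) ∨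
      (τ = 1 ∧ (σ = -ω ∨ σ = -ω ^ 2)) ∨ (σ = -ω ∧ τ = -ω ^ 2) ∨ (σ = -ω ^ 2 ∧ τ = -ω) := by
  refine ⟨fun h => G_H_zero_cases hω h.1 h.2, fun h => ?_⟩
  have q : ∀ a, a = -ω ∨ a = -ω ^ 2 → 1 - a + a ^ 2 = 0 := fun a => (cube_root_cases hω).2
  have hsum := cube_root_sum hω
  have h3 : ω ^ 3 = 1 := hω.pow_eq_one
  have h31 : (-ω) * (-ω ^ 2) = 1 := by linear_combination h3
  have h32 : (-ω ^ 2) * (-ω) = 1 := by linear_combination h3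
  -- When `ab = 1` and `a` is a primitive sixth root of unity, `a + b = 1`; then the last summand of
  -- `G` vanishes and the first two cancel.
  have hr : ∀ a b, (a = -ω ∨ a = -ω ^ 2) → a * b = 1 → G a b = 0 ∧ H a b = 0 := by
    intro a b ha hab
    have h1 := q a ha
    have hb0 : a ≠ 0 := by rintro rfl; simp at hab
    have e : G a b = 3 * (a * b) ^ 2 - 1 / 2 * (a * b) * (1 + (a + b) + a * b) * (1 + a * b)
          + (1 - a + a ^ 2) * (1 - b + b ^ 2) * (1 - a * b + (a * b) ^ 2) := by
      simp only [G]; ring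
    have hs : a + b = 1 := by
      apply mul_left_cancel₀ hb0; linear_combination hab + h1
    refine ⟨?_, ?_⟩
    · rw [e, hab, hs, h1]; ring
    · have : H a b = a * b * (1 - a) * (1 - b) * (1 - a * b) := rfl
      rw [this, hab]; ring
  rcases h with ⟨rfl, rfl⟩ | ⟨rfl, h⟩ | ⟨rfl, h⟩ | ⟨rfl, h⟩ | ⟨rfl, h⟩ | ⟨rfl, rfl⟩ | ⟨rfl, rfl⟩
  · norm_num [G, H]
  · have := q _ h
    exact ⟨by simp only [G]; linear_combination this, by simp [H]⟩
  · have := q _ h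
    exact ⟨by simp only [G]; linear_combination this, by simp [H]⟩
  · have := q _ h
    exact ⟨by simp only [G]; linear_combination (1 - τ) ^ 2 * this, by simp [H]⟩
  · have := q _ h
    exact ⟨by simp only [G]; linear_combination (1 - σ) ^ 2 * this, by simp [H]⟩
  · exact hr _ _ (Or.inl rfl) h31
  · exact hr _ _ (Or.inr rfl) h32

theorem bihomG_aff (a b : ℂ) : bihomG ![a, 1] ![b, 1] = G a b := by
  simp [bihomG, G]

theorem bihomH_aff (a b : ℂ) : bihomH ![a, 1] ![b, 1] = H a b := by
  simp [bihomH, H]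

theorem mem_curve0_inter {φ : ℂ} (hφ : φ ≠ 0) {p : P1 × P1} {s t : Fin 2 → ℂ}
    (hs : Represents p.1 s) (ht : Represents p.2 t) :
    p ∈ curve0 φ ∩ curve0 (-φ) ↔ bihomG s t = 0 ∧ bihomH s t = 0 := by
  rw [Set.mem_inter_iff, mem_curve0_iff hs ht, mem_curve0_iff hs ht, bihomF_inter hφ]

theorem curve0_inter {φ ω : ℂ} (hφ : φ ≠ 0) (hω : IsPrimitiveRoot ω 3) :
    curve0 φ ∩ curve0 (-φ) = meetingPoints ω := by
  ext ⟨p, q⟩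
  rcases P1_cases p with rfl | ⟨a, rfl⟩ <;> rcases P1_cases q with rfl | ⟨b, rfl⟩
  · rw [mem_curve0_inter hφ (represents_infty) (represents_infty)]
    simp [bihomG, meetingPoints, infty_ne_aff]
  · rw [mem_curve0_inter hφ (represents_infty) (represents_aff b)]
    have e : bihomG ![1, 0] ![b, 1] = b ^ 2 * (1 - b + b ^ 2) := by simp [bihomG]; ring
    simp [e, meetingPoints, infty_ne_aff, aff_inj, bihomH, cube_root_cases hω, aff_ne_infty]
  · rw [mem_curve0_inter hφ (represents_aff a) (represents_infty)]
    have e : bihomG ![a, 1] ![1, 0] = a ^ 2 * (1 - a + a ^ 2) := by simp [bihomG]; ring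
    simp [e, meetingPoints, infty_ne_aff, aff_inj, bihomH, cube_root_cases hω, aff_ne_infty]
  · rw [mem_curve0_inter hφ (represents_aff a) (represents_aff b), bihomG_aff, bihomH_aff,
      G_H_zero hω]
    simp only [meetingPoints, Set.mem_insert_iff, Set.mem_singleton_iff, Prod.mk.injEq, aff_inj,
      aff_ne_infty, and_false, false_and, false_or, or_false]
    clear hφ hω
    grind

/-- The five points `0, 1, ∞, -ω, -ω²` of the projective line. -/
noncomputable def fivePoints (ω : ℂ) : Fin 5 → P1 := ![aff 0, aff 1, infty, aff (-ω), aff (-ω ^ 2)]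

theorem fivePoints_injective {ω : ℂ} (hω : IsPrimitiveRoot ω 3) :
    Function.Injective (fivePoints ω) := by
  obtain ⟨h0, h1, h2, h3, h4, h5, -, -⟩ := ne_facts hω
  have e1 : ∀ x : ℂ, (1 : ℂ) = -x ↔ x = -1 := fun x =>
    ⟨fun h => by rw [h, neg_neg], fun h => by rw [h, neg_neg]⟩
  intro i j h
  fin_cases i <;> fin_cases j <;>
    simp [fivePoints, aff_inj, aff_ne_infty, infty_ne_aff, neg_eq_iff_eq_neg, h0, h2, h3,
      h5, h3.symm, e1] at h ⊢

/-- The codes of the seventeen points. -/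
def meetingCodes : Finset (Fin 5 × Fin 5) :=
  {(0, 2), (2, 0), (1, 1), (0, 3), (0, 4), (1, 3), (1, 4), (3, 4), (3, 2), (4, 2), (3, 0), (4, 0),
    (3, 1), (4, 1), (4, 3), (2, 3), (2, 4)}

/-- Coding the points by pairs of indices turns the counts and inclusions below into finite
computations. -/
theorem meetingPoints_eq_image (ω : ℂ) :
    meetingPoints ω = Prod.map (fivePoints ω) (fivePoints ω) '' meetingCodes := by
  simp [meetingPoints, meetingCodes, Set.image_insert_eq, fivePoints]

theorem nodes_eq_image (ω : ℂ) :
    nodes = Prod.map (fivePoints ω) (fivePoints ω) ''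
      (({(0, 2), (2, 0), (1, 1)} : Finset (Fin 5 × Fin 5)) : Set (Fin 5 × Fin 5)) := by
  simp [nodes, Set.image_insert_eq, fivePoints]

theorem ncard_meetingPoints {ω : ℂ} (hω : IsPrimitiveRoot ω 3) : (meetingPoints ω).ncard = 17 := by
  rw [meetingPoints_eq_image, Set.ncard_image_of_injective _
    ((fivePoints_injective hω).prodMap (fivePoints_injective hω)), Set.ncard_coe_finset]
  rfl

theorem ncard_nodes {ω : ℂ} (hω : IsPrimitiveRoot ω 3) : nodes.ncard = 3 := by
  rw [nodes_eq_image ω, Set.ncard_image_of_injective _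
    ((fivePoints_injective hω).prodMap (fivePoints_injective hω)), Set.ncard_coe_finset]
  rfl

theorem nodes_subset (ω : ℂ) : nodes ⊆ meetingPoints ω := by
  rw [nodes_eq_image ω, meetingPoints_eq_image ω]
  apply Set.image_mono
  simp only [Finset.coe_subset]
  decide

/-! ### Nonsingular points and nodes of the curves -/

/-- A nonzero derivative along one direction of the chart already makes the differential nonzero, so
restriction to a single line suffices. -/
theorem isSmoothAt_of_hasDerivAt {μ : ℂ} {p : P1 × P1} {s s' t t' : Fin 2 → ℂ}
    (hs : Represents p.1 s) (ht : Represents p.2 t)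
    (hs' : s 0 * s' 1 - s 1 * s' 0 ≠ 0) (ht' : t 0 * t' 1 - t 1 * t' 0 ≠ 0)
    (h0 : bihomF μ s t = 0) (v₁ v₂ : ℂ) {d : ℂ} (hd : d ≠ 0)
    (h : HasDerivAt (fun x : ℂ => bihomF μ (s + (x * v₁) • s') (t + (x * v₂) • t')) d 0) :
    IsSmoothAt μ p := by
  set f : ℂ × ℂ → ℂ := fun x => bihomF μ (s + x.1 • s') (t + x.2 • t') with hf
  have hdiff : DifferentiableAt ℂ f 0 := by
    simp only [hf, bihomF, bihomG, bihomH, Pi.add_apply, Pi.smul_apply, smul_eq_mul]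
    fun_prop
  set f' := fderiv ℂ f 0 with hf'
  have hF : HasFDerivAt f f' 0 := hdiff.hasFDerivAt
  have hlin : ∀ x : ℂ × ℂ, f' x = f' (1, 0) * x.1 + f' (0, 1) * x.2 := by
    intro x
    have : x = x.1 • ((1 : ℂ), (0 : ℂ)) + x.2 • ((0 : ℂ), (1 : ℂ)) := by ext <;> simp
    conv_lhs => rw [this, map_add, map_smul, map_smul]
    simp [mul_comm]
  have hline : HasDerivAt (fun x : ℂ => (x * v₁, x * v₂)) (v₁, v₂) (0 : ℂ) := by
    have h1 : HasDerivAt (fun x : ℂ => x * v₁) v₁ 0 := by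
      simpa using (hasDerivAt_id (0 : ℂ)).mul_const v₁
    have h2 : HasDerivAt (fun x : ℂ => x * v₂) v₂ 0 := by
      simpa using (hasDerivAt_id (0 : ℂ)).mul_const v₂
    exact h1.prodMk h2
  have hF' : HasFDerivAt f f' ((fun x : ℂ => (x * v₁, x * v₂)) 0) := by
    simp only [zero_mul]; exact hF
  have hd' : f' (v₁, v₂) = d := by
    have h1 := hF'.comp_hasDerivAt (0 : ℂ) hline
    exact h1.unique h
  refine ⟨f' (1, 0), f' (0, 1), ?_, s, s', t, t', hs, ht, hs', ht', ?_⟩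
  · by_contra! hcon
    rw [hlin, hcon.1, hcon.2] at hd'
    exact hd (by simpa using hd'.symm)
  · have h1 := hasFDerivAt_iff_isLittleO_nhds_zero.1 hF
    have h00 : f 0 = 0 := by simpa [hf] using h0
    simp only [zero_add, h00, sub_zero] at h1
    refine (h1.congr_left fun x => ?_).trans_isBigO (isBigO_of_le _ fun x => by simp)
    rw [hlin]

/-- The test lines are chosen inside `H = 0`, so `μ` drops out and `G` becomes `p(x) (1 - (a + x) +
(a + x)²) = p(x) x (2a - 1 + x)` for a root `a` of the quadratic. -/
theorem hasDerivAt_mul_quadratic {f p : ℂ → ℂ} {d : ℂ} (hp : ContinuousAt p 0)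
    (hf : ∀ x, f x = p x * (x * (d + x))) : HasDerivAt f (p 0 * d) 0 := by
  have h1 : HasDerivAt (fun x : ℂ => x * (p x * (d + x))) (p 0 * d) 0 := by
    rw [hasDerivAt_iff_tendsto_slope]
    have : Tendsto (fun x => p x * (d + x)) (𝓝[≠] 0) (𝓝 (p 0 * d)) := by
      have h : ContinuousAt (fun x => p x * (d + x)) 0 := hp.mul (by fun_prop)
      have h' := h.tendsto
      simp only [add_zero] at h'
      exact h'.mono_left nhdsWithin_le_nhds
    refine this.congr' ?_
    filter_upwards [self_mem_nhdsWithin] with x hx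
    have hx : x ≠ 0 := hx
    simp [slope_def_field, hx]
  refine h1.congr_of_eventuallyEq (Eventually.of_forall fun x => ?_)
  rw [hf]; ring

theorem two_mul_sub_one_ne {a : ℂ} (ha : 1 - a + a ^ 2 = 0) : 2 * a - 1 ≠ 0 := by
  intro h
  have h2 : a = 1 / 2 := by linear_combination h / 2
  rw [h2] at ha; norm_num at ha

theorem sixth_root_ne {a : ℂ} (ha : 1 - a + a ^ 2 = 0) : a ≠ 0 ∧ 1 - a ≠ 0 := by
  constructor
  · rintro rfl; norm_num at ha
  · intro h
    have : a = 1 := by linear_combination -h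
    rw [this] at ha; norm_num at ha

theorem isSmoothAt_swap {μ : ℂ} {p : P1 × P1} (h : IsSmoothAt μ p) : IsSmoothAt μ p.swap := by
  obtain ⟨A, B, hAB, s, s', t, t', hs, ht, hs', ht', h⟩ := h
  refine ⟨B, A, hAB.symm, t, t', s, s', ht, hs, ht', hs', ?_⟩
  have hc : Tendsto (Prod.swap : ℂ × ℂ → ℂ × ℂ) (𝓝 0) (𝓝 0) :=
    (continuous_swap (X := ℂ) (Y := ℂ)).tendsto' _ _ rfl
  refine (h.comp_tendsto hc).congr (fun x => ?_) (fun x => ?_)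
  · simp only [Function.comp_apply, Prod.fst_swap, Prod.snd_swap, bihomF, bihomG, bihomH]
    ring
  · simp [Prod.norm_def, max_comm]

theorem isSmoothAt_zero {μ a : ℂ} (ha : 1 - a + a ^ 2 = 0) : IsSmoothAt μ (aff 0, aff a) := by
  refine isSmoothAt_of_hasDerivAt (s' := ![1, 0]) (t' := ![1, 0]) (represents_aff 0)
    (represents_aff a) (by simp) (by simp) ?_ 0 1 (mul_ne_zero one_ne_zero (two_mul_sub_one_ne ha))
    (hasDerivAt_mul_quadratic (p := fun _ => 1) continuousAt_const fun x => ?_)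
  · simp [bihomF, bihomG, bihomH]; linear_combination ha
  · simp [bihomF, bihomG, bihomH]; linear_combination ha

theorem isSmoothAt_one {μ a : ℂ} (ha : 1 - a + a ^ 2 = 0) : IsSmoothAt μ (aff 1, aff a) := by
  have h := sixth_root_ne ha
  refine isSmoothAt_of_hasDerivAt (s' := ![1, 0]) (t' := ![1, 0]) (represents_aff 1)
    (represents_aff a) (by simp) (by simp) ?_ 0 1
    (mul_ne_zero (a := (1 - (a + 0)) ^ 2) (by simp [h.2]) (two_mul_sub_one_ne ha))
    (hasDerivAt_mul_quadratic (p := fun x => (1 - (a + x)) ^ 2) (by fun_prop) fun x => ?_)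
  · simp [bihomF, bihomG, bihomH]; linear_combination (1 - a) ^ 2 * ha
  · simp [bihomF, bihomG, bihomH]; linear_combination (1 - (a + x)) ^ 2 * ha

theorem isSmoothAt_infty {μ a : ℂ} (ha : 1 - a + a ^ 2 = 0) : IsSmoothAt μ (infty, aff a) := by
  have h := sixth_root_ne ha
  refine isSmoothAt_of_hasDerivAt (s' := ![0, 1]) (t' := ![1, 0]) (represents_infty)
    (represents_aff a) (by simp) (by simp) ?_ 0 1
    (mul_ne_zero (a := (a + 0) ^ 2) (by simp [h.1]) (two_mul_sub_one_ne ha))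
    (hasDerivAt_mul_quadratic (p := fun x => (a + x) ^ 2) (by fun_prop) fun x => ?_)
  · simp [bihomF, bihomG, bihomH]; left; linear_combination ha
  · simp [bihomF, bihomG, bihomH]; linear_combination (a + x) ^ 2 * ha

theorem isSmoothAt_inv {μ a b : ℂ} (ha : 1 - a + a ^ 2 = 0) (hab : a * b = 1) :
    IsSmoothAt μ (aff a, aff b) := by
  have h := sixth_root_ne ha
  have hb : Represents (aff b) ![1, a] := by
    convert! (represents_aff b).of_smul h.1 using 1
    ext i; fin_cases i <;> simp [hab]
  -- With second coordinate `(1 : a + x)` the component `στ = 1` of `H = 0` is the diagonal of the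
  -- chart, hence the direction `(1, 1)`.
  refine isSmoothAt_of_hasDerivAt (s' := ![1, 0]) (t' := ![0, 1]) (represents_aff a)
    hb (by simp) (by simp) ?_ 1 1
    (mul_ne_zero (a := (a + 0) ^ 2 * (1 - (a + 0)) ^ 2) (by simp [h.1, h.2])
      (two_mul_sub_one_ne ha))
    (hasDerivAt_mul_quadratic (p := fun x => (a + x) ^ 2 * (1 - (a + x)) ^ 2) (by fun_prop)
      fun x => ?_)
  · simp [bihomF, bihomG, bihomH]; linear_combination a ^ 2 * (1 - a) ^ 2 * ha
  · simp [bihomF, bihomG, bihomH]; linear_combination (a + x) ^ 2 * (1 - (a + x)) ^ 2 * ha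

theorem isSmoothAt_meetingPoints {ω : ℂ} (hω : IsPrimitiveRoot ω 3) (μ : ℂ) {p : P1 × P1}
    (hp : p ∈ meetingPoints ω \ nodes) : IsSmoothAt μ p := by
  have h1 : 1 - (-ω) + (-ω) ^ 2 = 0 := (cube_root_cases hω).2 (Or.inl rfl)
  have h2 : 1 - (-ω ^ 2) + (-ω ^ 2) ^ 2 = 0 := (cube_root_cases hω).2 (Or.inr rfl)
  have h3 : ω ^ 3 = 1 := hω.pow_eq_one
  obtain ⟨hp, hn⟩ := hp
  simp only [meetingPoints, nodes, Set.mem_insert_iff, Set.mem_singleton_iff, not_or] at hp hn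
  rcases hp with h | h | h | rfl | rfl | rfl | rfl | rfl | rfl | rfl | rfl | rfl | rfl | rfl |
    rfl | rfl | rfl
  · exact absurd h hn.1
  · exact absurd h hn.2.1
  · exact absurd h hn.2.2
  · exact isSmoothAt_zero h1
  · exact isSmoothAt_zero h2
  · exact isSmoothAt_one h1
  · exact isSmoothAt_one h2
  · exact isSmoothAt_inv h1 (by linear_combination h3)
  · exact isSmoothAt_swap (isSmoothAt_infty h1)
  · exact isSmoothAt_swap (isSmoothAt_infty h2)
  · exact isSmoothAt_swap (isSmoothAt_zero h1)
  · exact isSmoothAt_swap (isSmoothAt_zero h2)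
  · exact isSmoothAt_swap (isSmoothAt_one h1)
  · exact isSmoothAt_swap (isSmoothAt_one h2)
  · exact isSmoothAt_inv h2 (by linear_combination h3)
  · exact isSmoothAt_infty h1
  · exact isSmoothAt_infty h2

/-- The remainder after the quadratic part lies in the ideal of the four cubic monomials; exhibiting
continuous cofactors gives the estimate. -/
theorem isLittleO_cubic {R A B C D : ℂ × ℂ → ℂ} (hA : Continuous A) (hB : Continuous B)
    (hC : Continuous C) (hD : Continuous D)
    (hR : ∀ x, R x = x.1 ^ 3 * A x + x.1 ^ 2 * x.2 * B x + x.1 * x.2 ^ 2 * C x + x.2 ^ 3 * D x) :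
    R =o[𝓝 0] fun x : ℂ × ℂ => ‖x‖ ^ 2 := by
  have h1 : (fun x : ℂ × ℂ => x.1) =O[𝓝 0] fun x => ‖x‖ :=
    isBigO_of_le _ fun x => by simpa using norm_fst_le x
  have h2 : (fun x : ℂ × ℂ => x.2) =O[𝓝 0] fun x => ‖x‖ :=
    isBigO_of_le _ fun x => by simpa using norm_snd_le x
  have h1' : (fun x : ℂ × ℂ => ‖x‖ ^ 3) =o[𝓝 0] fun x => ‖x‖ ^ 2 :=
    (isLittleO_pow_pow (show 2 < 3 by norm_num)).comp_tendsto (tendsto_norm_zero)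
  have hb : ∀ {E : ℂ × ℂ → ℂ}, Continuous E → E =O[𝓝 0] fun _ => (1 : ℝ) := fun hE =>
    hE.continuousAt.norm.isBoundedUnder_le.isBigO_one ℝ
  have h3 : ∀ {X E : ℂ × ℂ → ℂ}, X =O[𝓝 0] (fun x => ‖x‖ ^ 3) → Continuous E →
      (fun x => X x * E x) =o[𝓝 0] fun x => ‖x‖ ^ 2 := by
    intro X E hX hE
    simpa using (hX.mul (hb hE)).trans_isLittleO (by simpa using h1')
  have e1 : (fun x : ℂ × ℂ => x.1 ^ 3) =O[𝓝 0] fun x => ‖x‖ ^ 3 := h1.pow 3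
  have e2 : (fun x : ℂ × ℂ => x.1 ^ 2 * x.2) =O[𝓝 0] fun x => ‖x‖ ^ 3 :=
    ((h1.pow 2).mul h2).congr_right fun x => by ring
  have e3 : (fun x : ℂ × ℂ => x.1 * x.2 ^ 2) =O[𝓝 0] fun x => ‖x‖ ^ 3 :=
    (h1.mul (h2.pow 2)).congr_right fun x => by ring
  have e4 : (fun x : ℂ × ℂ => x.2 ^ 3) =O[𝓝 0] fun x => ‖x‖ ^ 3 := h2.pow 3
  exact ((((h3 e1 hA).add (h3 e2 hB)).add (h3 e3 hC)).add (h3 e4 hD)).congr_left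
    fun x => (hR x).symm

/-- The quadratic part is `x² - xy + y²` here and `x² + xy + y²` at `(1, 1)`. Both have discriminant
`-3` and do not involve `μ`: all curves share their two tangents at a node, which become two base
points after blowing up. -/
theorem isNodeAt_zero_infty (μ : ℂ) : IsNodeAt μ (aff 0, infty) := by
  refine ⟨1, -1, 1, by norm_num, ![0, 1], ![1, 0], ![1, 0], ![0, 1], represents_aff 0,
    represents_infty, by simp, by simp, isLittleO_cubic
      (A := fun x => (-1 + x.1) * (1 - x.2 + x.2 ^ 2))
      (B := fun x => 3 * x.2 - 1 / 2 * (1 + x.1) * (1 + x.2) - (-1 + x.1) * (1 - x.2 + x.2 ^ 2)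
        + (-1 + x.2) + μ * (1 - x.1) * (1 - x.2))
      (C := fun x => - 1 / 2 * (1 + x.1) * (1 + x.2) + (-1 + x.1) * (1 - x.2 + x.2 ^ 2)
        - (-1 + x.2) - μ * (1 - x.1) * (1 - x.2))
      (D := fun x => -1 + x.2) (by fun_prop) (by fun_prop) (by fun_prop) (by fun_prop)
      fun x => ?_⟩
  simp [bihomF, bihomG, bihomH]
  ring

theorem isNodeAt_one_one (μ : ℂ) : IsNodeAt μ (aff 1, aff 1) := by
  refine ⟨1, 1, 1, by norm_num, ![1, 1], ![1, 0], ![1, 1], ![1, 0], represents_aff 1,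
    represents_aff 1, by simp, by simp, isLittleO_cubic
      (A := fun x => 1 + x.1)
      (B := fun x => 7 / 2 + 9 / 2 * x.1 + 15 / 2 * x.2 + 3 * x.1 ^ 2 + 8 * x.1 * x.2
        + 8 * x.2 ^ 2 + 4 * x.1 ^ 2 * x.2 + 15 / 2 * x.1 * x.2 ^ 2 + 4 * x.2 ^ 3
        + 3 * x.1 ^ 2 * x.2 ^ 2 + 3 * x.1 * x.2 ^ 3 + x.1 ^ 2 * x.2 ^ 3
        - μ * (1 + 3 * x.2 + 2 * x.2 ^ 2 + x.1 + 2 * x.1 * x.2 + x.1 * x.2 ^ 2))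
      (C := fun x => 7 / 2 + 9 / 2 * x.2 + 3 * x.2 ^ 2 - μ * (1 + x.2))
      (D := fun x => 1 + x.2) (by fun_prop) (by fun_prop) (by fun_prop) (by fun_prop)
      fun x => ?_⟩
  simp [bihomF, bihomG, bihomH]
  ring

theorem isNodeAt_swap {μ : ℂ} {p : P1 × P1} (h : IsNodeAt μ p) : IsNodeAt μ p.swap := by
  obtain ⟨A, B, C, hAB, s, s', t, t', hs, ht, hs', ht', h⟩ := h
  refine ⟨C, B, A, fun h' => hAB (by linear_combination h'), t, t', s, s', ht, hs, ht', hs', ?_⟩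
  have hc : Tendsto (Prod.swap : ℂ × ℂ → ℂ × ℂ) (𝓝 0) (𝓝 0) :=
    (continuous_swap (X := ℂ) (Y := ℂ)).tendsto' _ _ rfl
  refine (h.comp_tendsto hc).congr (fun x => ?_) (fun x => ?_)
  · simp only [Function.comp_apply, Prod.fst_swap, Prod.snd_swap, bihomF, bihomG, bihomH]
    ring
  · simp [Prod.norm_def, max_comm]

theorem isNodeAt_nodes (μ : ℂ) {p : P1 × P1} (hp : p ∈ nodes) : IsNodeAt μ p := by
  rcases hp with rfl | rfl | rfl
  · exact isNodeAt_zero_infty μ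
  · exact isNodeAt_swap (isNodeAt_zero_infty μ)
  · exact isNodeAt_one_one μ

/-! ### The cone over the del Pezzo surface -/

/-- The bihomogeneous form of the anticanonical map. -/
noncomputable def psiBi (s t : Fin 2 → ℂ) : Fin 6 → ℂ :=
  ![s 0 ^ 2 * t 0 ^ 2 - s 1 ^ 2 * t 1 ^ 2, s 0 * s 1 * t 0 ^ 2 - s 1 ^ 2 * t 1 ^ 2,
    s 0 ^ 2 * t 0 * t 1 - s 1 ^ 2 * t 1 ^ 2, s 0 * s 1 * t 0 * t 1 - s 1 ^ 2 * t 1 ^ 2,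
    s 1 ^ 2 * t 0 * t 1 - s 1 ^ 2 * t 1 ^ 2, s 0 * s 1 * t 1 ^ 2 - s 1 ^ 2 * t 1 ^ 2]

/-- The affine cone over `dP₅`. -/
def cone : Set (Fin 6 → ℂ) :=
  {z | ∀ (f : MvPolynomial (Fin 6) ℂ) (n : ℕ), f.IsHomogeneous n →
    (∀ σ τ : ℂ, MvPolynomial.eval (psiVec σ τ) f = 0) → MvPolynomial.eval z f = 0}

theorem eval_smul_of_isHomogeneous {f : MvPolynomial (Fin 6) ℂ} {n : ℕ} (hf : f.IsHomogeneous n)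
    (a : ℂ) (z : Fin 6 → ℂ) :
    MvPolynomial.eval (a • z) f = a ^ n * MvPolynomial.eval z f := by
  rw [MvPolynomial.eval_eq, MvPolynomial.eval_eq, Finset.mul_sum]
  refine Finset.sum_congr rfl fun d hd => ?_
  have hdn : ∑ i, d i = n := by
    have := hf (MvPolynomial.mem_support_iff.1 hd)
    rw [Finsupp.weight_apply, Finsupp.sum_fintype] at this <;> simp_all
  simp only [Pi.smul_apply, smul_eq_mul, mul_pow, Finset.prod_mul_distrib]
  rw [Finset.prod_pow_eq_pow_sum, ← hdn]
  have : ∑ i ∈ d.support, d i = ∑ i, d i :=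
    Finset.sum_subset (Finset.subset_univ _) fun i _ hi => by simpa using hi
  rw [this]; ring

theorem smul_mem_cone {z : Fin 6 → ℂ} (hz : z ∈ cone) (a : ℂ) : a • z ∈ cone := by
  intro f n hf h
  rw [eval_smul_of_isHomogeneous hf, hz f n hf h, mul_zero]

theorem mem_dP5_iff {P : P5} {v : Fin 6 → ℂ} (h : Represents P v) : P ∈ dP5 ↔ v ∈ cone := by
  obtain ⟨a, ha, hP⟩ := h.rep
  constructor
  · intro hP'
    have : v = a⁻¹ • P.rep := by rw [hP, smul_smul, inv_mul_cancel₀ ha, one_smul]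
    rw [this]
    exact smul_mem_cone (show P.rep ∈ cone from hP') _
  · intro hv
    show P.rep ∈ cone
    rw [hP]; exact smul_mem_cone hv a

theorem isClosed_cone : IsClosed cone := by
  have : cone = ⋂ (f : MvPolynomial (Fin 6) ℂ) (n : ℕ) (_ : f.IsHomogeneous n)
      (_ : ∀ σ τ : ℂ, MvPolynomial.eval (psiVec σ τ) f = 0), {z | MvPolynomial.eval z f = 0} := by
    ext z; simp [cone]
  rw [this]
  refine isClosed_iInter fun f => isClosed_iInter fun n => isClosed_iInter fun _ =>
    isClosed_iInter fun _ => isClosed_eq (MvPolynomial.continuous_eval f) continuous_const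

/-- The cone is closed in the usual topology, so points at which the affine parametrization
degenerates are reached as limits. -/
theorem mem_cone_of_punctured {g : ℂ → Fin 6 → ℂ} (hg : Continuous g)
    (h : ∀ᶠ x in 𝓝[≠] (0 : ℂ), g x ∈ cone) : g 0 ∈ cone :=
  isClosed_cone.mem_of_tendsto (hg.continuousAt.tendsto.mono_left nhdsWithin_le_nhds) h

theorem psiVec_mem_cone (σ τ : ℂ) : psiVec σ τ ∈ cone := fun _ _ _ h => h σ τ

theorem psiBi_mem_cone (s t : Fin 2 → ℂ) : psiBi s t ∈ cone := by
  have key : ∀ s t : Fin 2 → ℂ, s 1 ≠ 0 → t 1 ≠ 0 → psiBi s t ∈ cone := by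
    intro s t hs ht
    have : psiBi s t = (s 1 ^ 2 * t 1 ^ 2) • psiVec (s 0 / s 1) (t 0 / t 1) := by
      ext i; fin_cases i <;> simp [psiBi, psiVec] <;> field_simp
    rw [this]; exact smul_mem_cone (psiVec_mem_cone _ _) _
  have hne : ∀ c : ℂ, ∀ᶠ x in 𝓝[≠] (0 : ℂ), c + x ≠ 0 := by
    intro c
    by_cases hc : c = 0
    · filter_upwards [self_mem_nhdsWithin] with x hx
      simpa [hc] using hx
    · have : ContinuousAt (fun x : ℂ => c + x) 0 := by fun_prop
      exact (this.eventually_ne (by simpa using hc)).filter_mono nhdsWithin_le_nhds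
  -- Shifting the second homogeneous coordinates by a small `x ≠ 0` makes both of them nonzero,
  -- which is the case already settled.
  have := mem_cone_of_punctured (g := fun x => psiBi ![s 0, s 1 + x] ![t 0, t 1 + x])
    (by
      refine continuous_pi fun i => ?_
      fin_cases i <;> simp [psiBi] <;> fun_prop) (by
      filter_upwards [hne (s 1), hne (t 1)] with x h1 h2
      exact key _ _ (by simpa using h1) (by simpa using h2))
  simpa [psiBi] using this

theorem cone_of_scaled {z : Fin 6 → ℂ} {a : ℂ} (ha : a ≠ 0) (h : a • z ∈ cone) : z ∈ cone := by
  have := smul_mem_cone h a⁻¹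
  rwa [smul_smul, inv_mul_cancel₀ ha, one_smul] at this

/-- Every point is the end of an explicit arc `g` that is proportional to values of `psiBi`. For the
three lines over the nodes (`k = 0, 2, 5`) the arc runs into the node in a prescribed direction and
a factor `x` is divided out; for the others the shift by `x` only avoids parameters where the
proportionality factor vanishes. -/
theorem excVec_mem_cone (k : Fin 10) (a b : ℂ) : excVec k a b ∈ cone := by
  have hgen : ∀ (g : ℂ → Fin 6 → ℂ) (s t : ℂ → Fin 2 → ℂ) (m : ℂ → ℂ), Continuous g →
      (∀ᶠ x in 𝓝[≠] (0 : ℂ), m x ≠ 0) → (∀ x, m x • g x = psiBi (s x) (t x)) → g 0 ∈ cone := by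
    intro g s t m hg hm h
    refine mem_cone_of_punctured hg ?_
    filter_upwards [hm] with x hx
    exact cone_of_scaled hx (h x ▸ psiBi_mem_cone _ _)
  have hx : ∀ᶠ x in 𝓝[≠] (0 : ℂ), x ≠ 0 := self_mem_nhdsWithin
  have hne : ∀ c : ℂ, ∀ᶠ x in 𝓝[≠] (0 : ℂ), c + x ≠ 0 := by
    intro c
    by_cases hc : c = 0
    · filter_upwards [self_mem_nhdsWithin] with x hx
      simpa [hc] using hx
    · have : ContinuousAt (fun x : ℂ => c + x) 0 := by fun_prop
      exact (this.eventually_ne (by simpa using hc)).filter_mono nhdsWithin_le_nhds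
  fin_cases k
  · have := hgen (fun x => ![2 * a + 2 * b + x * (a ^ 2 + 4 * a * b + b ^ 2)
        + x ^ 2 * (2 * a ^ 2 * b + 2 * a * b ^ 2) + x ^ 3 * (a ^ 2 * b ^ 2),
        a + 2 * b + x * (2 * a * b + b ^ 2) + x ^ 2 * (a * b ^ 2),
        2 * a + b + x * (2 * a * b + a ^ 2) + x ^ 2 * (a ^ 2 * b), a + b + x * (a * b), b, a])
      (fun x => ![1 + x * a, 1]) (fun x => ![1 + x * b, 1]) (fun x => x)
      (by refine continuous_pi fun i => ?_
          fin_cases i <;> simp <;> fun_prop) hx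
      (fun x => by ext i; fin_cases i <;> simp [psiBi] <;> ring)
    simpa [excVec] using this
  · have := hgen (fun x => ![a + x, b, 0, 0, 0, 0])
      (fun x => ![a + x, b]) (fun x => ![1, 0]) (fun x => a + x)
      (by refine continuous_pi fun i => ?_
          fin_cases i <;> simp <;> fun_prop) (hne a)
      (fun x => by ext i; fin_cases i <;> simp [psiBi] <;> ring)
    simpa [excVec] using this
  · have := hgen (fun x => ![x * (a ^ 2 - b ^ 2), x * (x * a ^ 2 * b - b ^ 2), a - x * b ^ 2, x * (a * b - b ^ 2),
          x * (x * a * b ^ 2 - b ^ 2), b - x * b ^ 2])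
      (fun x => ![1, x * b]) (fun x => ![x * a, 1]) (fun x => x)
      (by refine continuous_pi fun i => ?_
          fin_cases i <;> simp <;> fun_prop) hx
      (fun x => by ext i; fin_cases i <;> simp [psiBi] <;> ring)
    simpa [excVec] using this
  · have := hgen (fun x => ![a + x, a + x, a + x, a + x, b, a + x])
      (fun x => ![0, 1]) (fun x => ![a + x - b, a + x]) (fun x => -(a + x))
      (by refine continuous_pi fun i => ?_
          fin_cases i <;> simp <;> fun_prop) ((hne a).mono fun x hx => neg_ne_zero.2 hx)
      (fun x => by ext i; fin_cases i <;> simp [psiBi] <;> ring)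
    simpa [excVec] using this
  · have := hgen (fun x => ![a + x, a + x, a + x, a + x, a + x, b])
      (fun x => ![a + x - b, a + x]) (fun x => ![0, 1]) (fun x => -(a + x))
      (by refine continuous_pi fun i => ?_
          fin_cases i <;> simp <;> fun_prop) ((hne a).mono fun x hx => neg_ne_zero.2 hx)
      (fun x => by ext i; fin_cases i <;> simp [psiBi] <;> ring)
    simpa [excVec] using this
  · have := hgen (fun x => ![x * (a ^ 2 - b ^ 2), a - x * b ^ 2, x * (x * a ^ 2 * b - b ^ 2),
          x * (a * b - b ^ 2), b - x * b ^ 2, x * (x * a * b ^ 2 - b ^ 2)])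
      (fun x => ![x * a, 1]) (fun x => ![1, x * b]) (fun x => x)
      (by refine continuous_pi fun i => ?_
          fin_cases i <;> simp <;> fun_prop) hx
      (fun x => by ext i; fin_cases i <;> simp [psiBi] <;> ring)
    simpa [excVec] using this
  · have := hgen (fun x => ![a + x, 0, b, 0, 0, 0])
      (fun x => ![1, 0]) (fun x => ![a + x, b]) (fun x => a + x)
      (by refine continuous_pi fun i => ?_
          fin_cases i <;> simp <;> fun_prop) (hne a)
      (fun x => by ext i; fin_cases i <;> simp [psiBi] <;> ring)
    simpa [excVec] using this
  · have := hgen (fun x => ![a, b + x, a, b + x, 0, b + x])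
      (fun x => ![a - (b + x), b + x]) (fun x => ![1, 1]) (fun x => a - 2 * (b + x))
      (by refine continuous_pi fun i => ?_
          fin_cases i <;> simp <;> fun_prop) ?_
      (fun x => by ext i; fin_cases i <;> simp [psiBi] <;> ring)
    · simpa [excVec] using this
    · filter_upwards [hne (b - a / 2)] with x hx h
      exact hx (by linear_combination -h / 2)
  · have := hgen (fun x => ![0, b + x, a + x, 0, b + x, a + x])
      (fun x => ![-(a + x), b + x]) (fun x => ![b + x, -(a + x)])
      (fun x => -(a + x) * (b + x) * (a + b + 2 * x))
      (by refine continuous_pi fun i => ?_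
          fin_cases i <;> simp <;> fun_prop) ?_
      (fun x => by ext i; fin_cases i <;> simp [psiBi] <;> ring)
    · simpa [excVec] using this
    · filter_upwards [hne a, hne b, hne ((a + b) / 2)] with x h1 h2 h3
      refine mul_ne_zero (mul_ne_zero (neg_ne_zero.2 h1) h2) fun h => h3 ?_
      linear_combination h / 2
  · have := hgen (fun x => ![a, a, b + x, b + x, b + x, 0])
      (fun x => ![1, 1]) (fun x => ![a - (b + x), b + x]) (fun x => a - 2 * (b + x))
      (by refine continuous_pi fun i => ?_
          fin_cases i <;> simp <;> fun_prop) ?_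
      (fun x => by ext i; fin_cases i <;> simp [psiBi] <;> ring)
    · simpa [excVec] using this
    · filter_upwards [hne (b - a / 2)] with x hx h
      exact hx (by linear_combination -h / 2)

/-! ### The blow-down -/

/-- The equations of the blow-down in homogeneous coordinates. -/
def Incident (z : Fin 6 → ℂ) (s t : Fin 2 → ℂ) : Prop :=
  s 0 * z 4 = s 1 * (z 3 - z 5) ∧ s 0 * z 3 = s 1 * (z 2 - z 5) ∧
  s 0 * z 1 = s 1 * (z 0 - z 5) ∧ t 0 * z 5 = t 1 * (z 3 - z 4) ∧
  t 0 * z 3 = t 1 * (z 1 - z 4) ∧ t 0 * z 2 = t 1 * (z 0 - z 4)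

theorem scaled_eq_iff {a b : ℂ} (ha : a ≠ 0) (hb : b ≠ 0) (x y u v w : ℂ) :
    (a * x) * (b * u) = (a * y) * (b * v - b * w) ↔ x * u = y * (v - w) := by
  have h : (a * x) * (b * u) - (a * y) * (b * v - b * w) = (a * b) * (x * u - y * (v - w)) := by
    ring
  rw [← sub_eq_zero, h, mul_eq_zero, or_iff_right (mul_ne_zero ha hb), sub_eq_zero]

theorem blowDown_iff {P : P5} {p : P1 × P1} {z : Fin 6 → ℂ} {s t : Fin 2 → ℂ}
    (hz : Represents P z) (hs : Represents p.1 s) (ht : Represents p.2 t) :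
    BlowDown P p ↔ Incident z s t := by
  obtain ⟨a, ha, hz⟩ := hz.rep
  obtain ⟨b, hb, hs⟩ := hs.rep
  obtain ⟨c, hc, ht⟩ := ht.rep
  simp only [BlowDown, Incident, hz, hs, ht, Pi.smul_apply, smul_eq_mul,
    scaled_eq_iff hb ha, scaled_eq_iff hc ha]

theorem psiBi_smul (a b : ℂ) (s t : Fin 2 → ℂ) :
    psiBi (a • s) (b • t) = (a ^ 2 * b ^ 2) • psiBi s t := by
  ext i; fin_cases i <;> simp [psiBi] <;> ring

theorem psiBi_aff (a b : ℂ) : psiBi ![a, 1] ![b, 1] = psiVec a b := by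
  ext i; fin_cases i <;> simp [psiBi, psiVec]

theorem incident_psiBi (s t : Fin 2 → ℂ) : Incident (psiBi s t) s t := by
  refine ⟨?_, ?_, ?_, ?_, ?_, ?_⟩ <;> simp [psiBi] <;> ring

theorem Gz_smul (a : ℂ) (z : Fin 6 → ℂ) : Gz (a • z) = a ^ 2 * Gz z := by
  simp only [Gz, Pi.smul_apply, smul_eq_mul]; ring

theorem Hz_smul (a : ℂ) (z : Fin 6 → ℂ) : Hz (a • z) = a ^ 2 * Hz z := by
  simp only [Hz, Pi.smul_apply, smul_eq_mul]; ring

theorem Gz_psiBi (s t : Fin 2 → ℂ) : Gz (psiBi s t) = bihomG s t := by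
  simp [Gz, psiBi, bihomG]; ring

theorem Hz_psiBi (s t : Fin 2 → ℂ) : Hz (psiBi s t) = bihomH s t := by
  simp [Hz, psiBi, bihomH]; ring

/-- For fixed `(s, t)` the incidence equations are linear in `z` and solved by `psiBi s t`. Away
from the nodes the solution space is one-dimensional, without assuming that `z` lies on the surface.
-/
theorem fiber_standard {p q : P1} (hp : (p, q) ∉ nodes) : ∃ s t, Represents p s ∧
    Represents q t ∧ psiBi s t ≠ 0 ∧ ∀ z, Incident z s t → ∃ c : ℂ, z = c • psiBi s t := by
  rcases P1_cases p with rfl | ⟨a, rfl⟩ <;> rcases P1_cases q with rfl | ⟨b, rfl⟩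
  · refine ⟨_, _, represents_infty, represents_infty, fun h => ?_, ?_⟩
    · simpa [psiBi] using congrFun h 0
    · rintro z ⟨h1, h2, h3, h4, h5, h6⟩
      simp at h1 h2 h3 h4 h5 h6
      refine ⟨z 0, ?_⟩
      ext i; fin_cases i <;> simp [psiBi, *]
  · have hb : b ≠ 0 := by
      rintro rfl; exact hp (by simp [nodes])
    refine ⟨_, _, represents_infty, represents_aff b, fun h => ?_, ?_⟩
    · simpa [psiBi, hb] using congrFun h 0
    · rintro z ⟨h1, h2, h3, h4, h5, h6⟩
      simp at h1 h2 h3 h4 h5 h6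
      have h5' : z 5 = 0 := by simpa [h1, h2, hb] using h4
      refine ⟨z 2 / b, ?_⟩
      ext i; fin_cases i <;> simp [psiBi, *] <;> simp [h1] at h6 <;> rw [← h6] <;> field_simp
  · have ha : a ≠ 0 := by
      rintro rfl; exact hp (by simp [nodes])
    refine ⟨_, _, represents_aff a, represents_infty, fun h => ?_, ?_⟩
    · simpa [psiBi, ha] using congrFun h 0
    · rintro z ⟨h1, h2, h3, h4, h5, h6⟩
      simp at h1 h2 h3 h4 h5 h6
      have h5' : z 4 = 0 := by simpa [h4, h5, ha] using h1
      refine ⟨z 1 / a, ?_⟩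
      ext i; fin_cases i <;> simp [psiBi, *] <;> simp [h4] at h3 <;> rw [← h3] <;> field_simp
  · have hab : a - 1 ≠ 0 ∨ b - 1 ≠ 0 := by
      by_contra! h
      obtain rfl : a = 1 := by linear_combination h.1
      obtain rfl : b = 1 := by linear_combination h.2
      exact hp (by simp [nodes])
    refine ⟨_, _, represents_aff a, represents_aff b, fun h => ?_, ?_⟩
    · rw [psiBi_aff] at h
      rcases hab with hab | hab
      · exact hab (by simpa [psiVec] using congrFun h 5)
      · exact hab (by simpa [psiVec] using congrFun h 4)
    · rintro z ⟨h1, h2, h3, h4, h5, h6⟩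
      simp at h1 h2 h3 h4 h5 h6
      -- Eliminating `z 3` gives `(a - 1) z₄ = (b - 1) z₅`, and `z₄`, `z₅` determine the other
      -- coordinates.
      have hc : ∃ c, z 5 = c * (a - 1) ∧ z 4 = c * (b - 1) := by
        rcases hab with hab | hab
        · refine ⟨z 5 / (a - 1), by field_simp, ?_⟩
          field_simp; linear_combination h1 - h4
        · refine ⟨z 4 / (b - 1), ?_, by field_simp⟩
          field_simp; linear_combination h4 - h1
      obtain ⟨c, hc5, hc4⟩ := hc
      refine ⟨c, ?_⟩
      rw [psiBi_aff]
      have e3 : z 3 = c * (a * b - 1) := by linear_combination -h1 + hc5 + a * hc4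
      have e2 : z 2 = c * (a ^ 2 * b - 1) := by linear_combination -h2 + hc5 + a * e3
      have e1 : z 1 = c * (a * b ^ 2 - 1) := by linear_combination -h5 + hc4 + b * e3
      have e0 : z 0 = c * (a ^ 2 * b ^ 2 - 1) := by linear_combination -h3 + hc5 + a * e1
      ext i; fin_cases i <;> simp [psiVec, *]

theorem fiber_regular {p : P1 × P1} {s t : Fin 2 → ℂ} (hs : Represents p.1 s)
    (ht : Represents p.2 t) (hp : p ∉ nodes) :
    psiBi s t ≠ 0 ∧ ∀ P : P5, BlowDown P p ↔ Represents P (psiBi s t) := by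
  obtain ⟨s', t', hs', ht', h0, h⟩ := fiber_standard (p := p.1) (q := p.2) hp
  obtain ⟨a, ha, rfl⟩ := hs'.smul_eq hs
  obtain ⟨b, hb, rfl⟩ := ht'.smul_eq ht
  have hab : a ^ 2 * b ^ 2 ≠ 0 := mul_ne_zero (pow_ne_zero 2 ha) (pow_ne_zero 2 hb)
  rw [psiBi_smul]
  refine ⟨smul_ne_zero hab h0, fun P => ?_⟩
  constructor
  · intro hP
    obtain ⟨c, hc⟩ := h _ ((blowDown_iff (represents_rep P) hs' ht').1 hP)
    have hc0 : c ≠ 0 := by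
      rintro rfl
      exact P.rep_nonzero (by simpa using hc)
    have h1 : Represents P (c⁻¹ • P.rep) := (represents_rep P).of_smul (inv_ne_zero hc0)
    rw [hc, smul_smul, inv_mul_cancel₀ hc0, one_smul] at h1
    exact h1.of_smul hab
  · intro hP
    rw [blowDown_iff hP hs ht, ← psiBi_smul]
    exact incident_psiBi _ _

theorem fiber_unique {p : P1 × P1} (hp : p ∉ nodes) : ∃! P, P ∈ dP5 ∧ BlowDown P p := by
  obtain ⟨h0, h⟩ := fiber_regular (represents_rep p.1) (represents_rep p.2) hp
  have hr : Represents (Projectivization.mk ℂ _ h0) (psiBi p.1.rep p.2.rep) := ⟨h0, rfl⟩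
  refine ⟨Projectivization.mk ℂ _ h0, ⟨(mem_dP5_iff hr).2 (psiBi_mem_cone _ _), (h _).2 hr⟩, ?_⟩
  rintro P ⟨-, hP⟩
  exact ((h P).1 hP).unique hr

theorem excLine_subset (k : Fin 10) : excLine k ⊆ dP5 := by
  rintro P ⟨a, b, h⟩
  exact (mem_dP5_iff h).2 (excVec_mem_cone k a b)

/-- At a node the linear incidence equations have rank four, not five, and the projectivized
solution space is exactly an exceptional line. -/
theorem fiber_zero_infty : {P | P ∈ dP5 ∧ BlowDown P (aff 0, infty)} = excLine 5 := by
  ext P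
  constructor
  · rintro ⟨-, h⟩
    rw [blowDown_iff (represents_rep P) (represents_aff 0) represents_infty] at h
    obtain ⟨h1, h2, h3, h4, h5, h6⟩ := h
    simp at h1 h2 h3 h4 h5 h6
    refine ⟨P.rep 1, P.rep 4, ?_⟩
    convert! represents_rep P using 1
    have h0 : P.rep 0 = 0 := by linear_combination -h3 + h4
    ext i; fin_cases i <;> simp [excVec, h0, h4, h5, h6]
  · intro h
    refine ⟨excLine_subset 5 h, ?_⟩
    obtain ⟨a, b, h⟩ := h
    rw [blowDown_iff h (represents_aff 0) represents_infty]
    simp [Incident, excVec]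

theorem fiber_infty_zero : {P | P ∈ dP5 ∧ BlowDown P (infty, aff 0)} = excLine 2 := by
  ext P
  constructor
  · rintro ⟨-, h⟩
    rw [blowDown_iff (represents_rep P) represents_infty (represents_aff 0)] at h
    obtain ⟨h1, h2, h3, h4, h5, h6⟩ := h
    simp at h1 h2 h3 h4 h5 h6
    refine ⟨P.rep 2, P.rep 5, ?_⟩
    convert! represents_rep P using 1
    have h0 : P.rep 0 = 0 := by linear_combination -h6 + h1
    ext i; fin_cases i <;> simp [excVec, h0, h1, h2, h3]
  · intro h
    refine ⟨excLine_subset 2 h, ?_⟩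
    obtain ⟨a, b, h⟩ := h
    rw [blowDown_iff h represents_infty (represents_aff 0)]
    simp [Incident, excVec]

theorem fiber_one_one : {P | P ∈ dP5 ∧ BlowDown P (aff 1, aff 1)} = excLine 0 := by
  ext P
  constructor
  · rintro ⟨-, h⟩
    rw [blowDown_iff (represents_rep P) (represents_aff 1) (represents_aff 1)] at h
    obtain ⟨h1, h2, h3, h4, h5, h6⟩ := h
    simp at h1 h2 h3 h4 h5 h6
    refine ⟨P.rep 5, P.rep 4, ?_⟩
    convert! represents_rep P using 1
    have e3 : P.rep 3 = P.rep 5 + P.rep 4 := by linear_combination -h1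
    have e2 : P.rep 2 = 2 * P.rep 5 + P.rep 4 := by linear_combination -h2 + e3
    have e1 : P.rep 1 = P.rep 5 + 2 * P.rep 4 := by linear_combination -h5 + e3
    have e0 : P.rep 0 = 2 * P.rep 5 + 2 * P.rep 4 := by linear_combination -h3 + e1
    ext i; fin_cases i <;> simp [excVec, e0, e1, e2, e3]
  · intro h
    refine ⟨excLine_subset 0 h, ?_⟩
    obtain ⟨a, b, h⟩ := h
    rw [blowDown_iff h (represents_aff 1) (represents_aff 1)]
    simp [Incident, excVec]
    refine ⟨?_, ?_, ?_, ?_⟩ <;> ring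

/-- The quadrics needed are the `2 × 2` minors of the matrix with rows `(z₃ - z₅, z₂ - z₅, z₀ -
z₅)`, `(z₄, z₃, z₁)` and of the one with rows `(z₃ - z₄, z₁ - z₄, z₀ - z₄)`, `(z₅, z₃, z₂)`; all
have this shape. -/
theorem cone_minor {z : Fin 6 → ℂ} (hz : z ∈ cone) (i j k l m n : Fin 6)
    (h : ∀ σ τ, psiVec σ τ i * (psiVec σ τ j - psiVec σ τ k)
      = psiVec σ τ l * (psiVec σ τ m - psiVec σ τ n)) :
    z i * (z j - z k) = z l * (z m - z n) := by
  have := hz (MvPolynomial.X i * (MvPolynomial.X j - MvPolynomial.X k)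
    - MvPolynomial.X l * (MvPolynomial.X m - MvPolynomial.X n)) (1 + 1)
    (((MvPolynomial.isHomogeneous_X ℂ i).mul
      ((MvPolynomial.isHomogeneous_X ℂ j).sub (MvPolynomial.isHomogeneous_X ℂ k))).sub
    ((MvPolynomial.isHomogeneous_X ℂ l).mul
      ((MvPolynomial.isHomogeneous_X ℂ m).sub (MvPolynomial.isHomogeneous_X ℂ n))))
    (fun σ τ => by simp [h])
  simpa [sub_eq_zero] using this

/-- The minors say that the columns `(A i, B i)` are proportional, and one nonzero column fixes the
ratio. Applied to both matrices this makes the blow-down a map. -/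
theorem existsUnique_ratio {A B : Fin 3 → ℂ} (hmin : ∀ i j, A i * B j = A j * B i)
    (hne : ∃ i, A i ≠ 0 ∨ B i ≠ 0) :
    ∃! p : P1, ∀ i, p.rep 0 * B i = p.rep 1 * A i := by
  obtain ⟨i, hi⟩ := hne
  have h0 : ![A i, B i] ≠ 0 := by
    intro h
    have e0 := congrFun h 0
    have e1 := congrFun h 1
    simp at e0 e1
    tauto
  have hr : Represents (Projectivization.mk ℂ _ h0) ![A i, B i] := ⟨h0, rfl⟩
  refine ⟨Projectivization.mk ℂ _ h0, ?_, ?_⟩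
  · obtain ⟨a, ha, hr⟩ := hr.rep
    intro j
    simp [hr]
    linear_combination a * hmin i j
  · intro p hp
    have h := hp i
    have hne : p.rep 0 ≠ 0 ∨ p.rep 1 ≠ 0 := by
      by_contra! hcon
      refine p.rep_nonzero ?_
      ext j; fin_cases j <;> simp [hcon]
    have : ∃ c : ℂ, p.rep = c • ![A i, B i] := by
      by_cases hA : A i = 0
      · have hB : B i ≠ 0 := by tauto
        refine ⟨p.rep 1 / B i, ?_⟩
        have : p.rep 0 = 0 := by simpa [hA, hB] using h
        ext j; fin_cases j <;> simp [hA, hB, this]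
      · refine ⟨p.rep 0 / A i, ?_⟩
        ext j; fin_cases j <;> simp [hA]
        field_simp; linear_combination -h
    obtain ⟨c, hc⟩ := this
    have hc0 : c ≠ 0 := by
      rintro rfl
      exact p.rep_nonzero (by simpa using hc)
    have h1 := (represents_rep p).of_smul (inv_ne_zero hc0)
    rw [hc, smul_smul, inv_mul_cancel₀ hc0, one_smul] at h1
    exact h1.unique hr

theorem blowDown_existsUnique {P : P5} (hP : P ∈ dP5) : ∃! p, BlowDown P p := by
  obtain ⟨z, hz⟩ : ∃ z, P.rep = z := ⟨_, rfl⟩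
  have hc : z ∈ cone := hz ▸ hP
  have m1 := cone_minor hc 3 3 5 4 2 5 (fun σ τ => by simp [psiVec]; ring)
  have m2 := cone_minor hc 1 3 5 4 0 5 (fun σ τ => by simp [psiVec]; ring)
  have m3 := cone_minor hc 1 2 5 3 0 5 (fun σ τ => by simp [psiVec]; ring)
  have m4 := cone_minor hc 3 3 4 5 1 4 (fun σ τ => by simp [psiVec]; ring)
  have m5 := cone_minor hc 2 3 4 5 0 4 (fun σ τ => by simp [psiVec]; ring)
  have m6 := cone_minor hc 2 1 4 3 0 4 (fun σ τ => by simp [psiVec]; ring)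
  have hz0 : z ≠ 0 := hz ▸ P.rep_nonzero
  have hs := existsUnique_ratio (A := ![z 3 - z 5, z 2 - z 5, z 0 - z 5]) (B := ![z 4, z 3, z 1])
    (by
      intro i j
      fin_cases i <;> fin_cases j <;> simp <;>
      first | ring1 | linear_combination m1 | linear_combination m2 | linear_combination m3 |
        linear_combination -m1 | linear_combination -m2 | linear_combination -m3)
    (by
      by_contra! hcon
      obtain ⟨a1, b1⟩ := hcon 0
      obtain ⟨a2, b2⟩ := hcon 1
      obtain ⟨a3, b3⟩ := hcon 2
      simp at a1 b1 a2 b2 a3 b3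
      have h5 : z 5 = 0 := by linear_combination b2 - a1
      refine hz0 ?_
      have e0 : z 0 = 0 := by linear_combination a3 + h5
      have e2 : z 2 = 0 := by linear_combination a2 + h5
      ext i; fin_cases i <;> simp [e0, e2, b1, b2, b3, h5])
  have ht := existsUnique_ratio (A := ![z 3 - z 4, z 1 - z 4, z 0 - z 4]) (B := ![z 5, z 3, z 2])
    (by
      intro i j
      fin_cases i <;> fin_cases j <;> simp <;>
      first | ring1 | linear_combination m4 | linear_combination m5 | linear_combination m6 |
        linear_combination -m4 | linear_combination -m5 | linear_combination -m6)
    (by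
      by_contra! hcon
      obtain ⟨a1, b1⟩ := hcon 0
      obtain ⟨a2, b2⟩ := hcon 1
      obtain ⟨a3, b3⟩ := hcon 2
      simp at a1 b1 a2 b2 a3 b3
      have h5 : z 4 = 0 := by linear_combination b2 - a1
      refine hz0 ?_
      have e0 : z 0 = 0 := by linear_combination a3 + h5
      have e1 : z 1 = 0 := by linear_combination a2 + h5
      ext i; fin_cases i <;> simp [e0, e1, b1, b2, b3, h5])
  simp only [Fin.forall_fin_succ, Fin.isValue, IsEmpty.forall_iff, and_true] at hs ht
  simp at hs ht
  obtain ⟨p, hp, hpu⟩ := hs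
  obtain ⟨q, hq, hqu⟩ := ht
  simp only [BlowDown, hz]
  refine ⟨(p, q), ⟨hp.1, hp.2.1, hp.2.2, hq⟩, ?_⟩
  rintro ⟨p', q'⟩ ⟨h1, h2, h3, h4⟩
  exact Prod.ext (hpu p' ⟨h1, h2, h3⟩) (hqu q' h4)

/-! ### The base points of the Wiman pencil -/

/-- The parameters `(a : b)` on the exceptional lines of the base point that belongs to the
primitive cube root of unity `w`. -/
noncomputable def bpParam (w : ℂ) (k : Fin 10) : ℂ × ℂ :=
  ![(-1, -w), (-w, 1), (-w, 1), (1, 1 + w), (1, 1 + w), (-w, 1), (-w, 1), (1 - w, 1), (-w, -1),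
    (1 - w, 1)] k

/-- Homogeneous coordinates of the base points. -/
noncomputable def bpVec (w : ℂ) (k : Fin 10) : Fin 6 → ℂ :=
  excVec k (bpParam w k).1 (bpParam w k).2

/-- The coordinate on an exceptional line in which the base points are the roots of
`X² - XY + Y²`. -/
def excCoord (k : Fin 10) (a b : ℂ) : ℂ × ℂ :=
  ![(b, -a), (a, b), (a, b), (a - b, a), (a - b, a), (a, b), (a, b), (a - b, b), (a, -b),
    (a - b, b)] k

theorem Gz_excVec (k : Fin 10) (a b : ℂ) : Gz (excVec k a b) =
    (excCoord k a b).2 ^ 2 * 1 - (excCoord k a b).1 * (excCoord k a b).2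
      + (excCoord k a b).1 ^ 2 := by
  fin_cases k <;> simp [Gz, excVec, excCoord] <;> ring

/-- Because of this vanishing, every curve `C_μ` cuts an exceptional line in the zeros of `Gz`
alone, which are base points. -/
theorem Hz_excVec (k : Fin 10) (a b : ℂ) : Hz (excVec k a b) = 0 := by
  fin_cases k <;> simp [Hz, excVec]
  all_goals ring

theorem excVec_eq_smul_bpVec {k : Fin 10} {a b w : ℂ}
    (h : (excCoord k a b).1 = -w * (excCoord k a b).2) :
    excVec k a b = (excCoord k a b).2 • bpVec w k := by
  fin_cases k <;> simp [excCoord] at h <;> ext i <;> fin_cases i <;>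
    simp [excVec, excCoord, bpVec, bpParam] <;> grind

theorem bpVec_ne_zero (w : ℂ) (k : Fin 10) : bpVec w k ≠ 0 := by
  intro h
  fin_cases k <;> simp [bpVec, bpParam, excVec] at h

theorem Gz_bpVec {w : ℂ} (hw : w ^ 2 + w + 1 = 0) (k : Fin 10) : Gz (bpVec w k) = 0 := by
  rw [bpVec, Gz_excVec]
  fin_cases k <;> simp [bpParam, excCoord] <;> grind

/-- Homogeneous coordinates of the points `0, 1, ∞, -w, -w²` of the projective line. -/
noncomputable def fiveVecs (w : ℂ) : Fin 5 → Fin 2 → ℂ :=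
  ![![0, 1], ![1, 1], ![1, 0], ![-w, 1], ![-w ^ 2, 1]]

theorem represents_fivePoints (w : ℂ) (c : Fin 5) : Represents (fivePoints w c) (fiveVecs w c) := by
  fin_cases c
  · exact represents_aff 0
  · exact represents_aff 1
  · exact represents_infty
  · exact represents_aff _
  · exact represents_aff _

/-- The images of the base points in the product of two projective lines. -/
def bpCode (k : Fin 10) : Fin 5 × Fin 5 :=
  ![(1, 1), (3, 2), (2, 0), (0, 3), (3, 0), (0, 2), (2, 3), (3, 1), (3, 4), (1, 3)] k

theorem incident_bpVec {w : ℂ} (hw : w ^ 2 + w + 1 = 0) (k : Fin 10) :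
    Incident (bpVec w k) (fiveVecs w (bpCode k).1) (fiveVecs w (bpCode k).2) := by
  fin_cases k <;> simp [Incident, bpVec, bpParam, excVec, bpCode, fiveVecs] <;> grind

/-- The base point on the `k`-th exceptional line that belongs to the cube root of unity `w`. -/
noncomputable def bp {w : ℂ} (_ : IsPrimitiveRoot w 3) (k : Fin 10) : P5 :=
  Projectivization.mk ℂ (bpVec w k)
    (bpVec_ne_zero w k)

theorem represents_bp {w : ℂ} (hw : IsPrimitiveRoot w 3) (k : Fin 10) :
    Represents (bp hw k) (bpVec w k) := ⟨_, rfl⟩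

theorem mem_basePoints_iff {P : P5} {v : Fin 6 → ℂ} (h : Represents P v) :
    P ∈ basePoints ↔ v ∈ cone ∧ Gz v = 0 ∧ Hz v = 0 := by
  rw [← mem_dP5_iff h]
  obtain ⟨a, ha, hP⟩ := h.rep
  have ha2 : a ^ 2 ≠ 0 := pow_ne_zero 2 ha
  have e : ∀ x y, x * Gz P.rep + y * Hz P.rep = a ^ 2 * (x * Gz v + y * Hz v) := by
    intro x y
    rw [hP, Gz_smul, Hz_smul]; ring
  simp only [basePoints, wimanCurve, Set.mem_ofPred_eq, e, mul_eq_zero, ha2, false_or]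
  constructor
  · intro h
    exact ⟨(h 1 0 (by simp)).1, by simpa using (h 1 0 (by simp)).2,
      by simpa using (h 0 1 (by simp)).2⟩
  · rintro ⟨h1, h2, h3⟩ x y -
    exact ⟨h1, by simp [h2, h3]⟩

theorem mem_curve_iff {P : P5} {v : Fin 6 → ℂ} {μ : ℂ} (h : Represents P v) :
    P ∈ curve μ ↔ v ∈ cone ∧ Gz v + μ * Hz v = 0 := by
  rw [← mem_dP5_iff h]
  obtain ⟨a, ha, hP⟩ := h.rep
  have ha2 : a ^ 2 ≠ 0 := pow_ne_zero 2 ha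
  have e : Gz P.rep + μ * Hz P.rep = a ^ 2 * (Gz v + μ * Hz v) := by
    rw [hP, Gz_smul, Hz_smul]; ring
  simp only [curve, wimanCurve, Set.mem_ofPred_eq, one_mul, e, mul_eq_zero, ha2, false_or]

theorem curve_inter {φ : ℂ} (hφ : φ ≠ 0) : curve φ ∩ curve (-φ) = basePoints := by
  ext P
  rw [Set.mem_inter_iff, mem_curve_iff (represents_rep P), mem_curve_iff (represents_rep P),
    mem_basePoints_iff (represents_rep P)]
  constructor
  · rintro ⟨⟨h1, h2⟩, -, h3⟩
    refine ⟨h1, by linear_combination (h2 + h3) / 2, ?_⟩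
    have : φ * Hz P.rep = 0 := by linear_combination (h2 - h3) / 2
    exact (mul_eq_zero.1 this).resolve_left hφ
  · rintro ⟨h1, h2, h3⟩
    simp [h1, h2, h3]

theorem basePoints_subset_curve (μ : ℂ) : basePoints ⊆ curve μ := by
  intro P hP
  rw [mem_basePoints_iff (represents_rep P)] at hP
  rw [mem_curve_iff (represents_rep P)]
  exact ⟨hP.1, by simp [hP.2.1, hP.2.2]⟩

theorem bp_mem_basePoints {w : ℂ} (hw : IsPrimitiveRoot w 3) (k : Fin 10) :
    bp hw k ∈ basePoints :=
  (mem_basePoints_iff (represents_bp hw k)).2 ⟨excVec_mem_cone _ _ _,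
    Gz_bpVec (cube_root_sum hw) k, Hz_excVec _ _ _⟩

theorem bp_mem_excLine {w : ℂ} (hw : IsPrimitiveRoot w 3) (k : Fin 10) :
    bp hw k ∈ excLine k := ⟨_, _, represents_bp hw k⟩

theorem excLine_root {ω : ℂ} (hω : IsPrimitiveRoot ω 3) {k : Fin 10} {P : P5} {a b : ℂ}
    (h : Represents P (excVec k a b)) (hG : Gz (excVec k a b) = 0) :
    P = bp hω k ∨ P = bp (primitive_sq hω) k := by
  rw [Gz_excVec] at hG
  set x := (excCoord k a b).1 with hx
  set y := (excCoord k a b).2 with hy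
  have hsum := cube_root_sum hω
  have hprod : (x + ω * y) * (x + ω ^ 2 * y) = 0 := by
    linear_combination hG + (x * y + y ^ 2 * (ω - 1)) * hsum
  have aux : ∀ w (hw : IsPrimitiveRoot w 3), x = -w * y → P = bp hw k := by
    intro w hw hxy
    have h' := excVec_eq_smul_bpVec (k := k) (a := a) (b := b) (w := w) hxy
    have hy0 : y ≠ 0 := by
      intro h0
      obtain ⟨hv, -⟩ := h
      exact hv (by rw [h', ← hy, h0, zero_smul])
    rw [h'] at h
    exact h.unique ((represents_bp hw k).of_smul hy0)
  rcases mul_eq_zero.1 hprod with h' | h'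
  · exact Or.inl (aux ω hω (by linear_combination h'))
  · exact Or.inr (aux _ (primitive_sq hω) (by linear_combination h'))

theorem curve_inter_excLine {ω : ℂ} (hω : IsPrimitiveRoot ω 3) (μ : ℂ) (k : Fin 10) :
    curve μ ∩ excLine k = {bp hω k, bp (primitive_sq hω) k} := by
  ext P
  constructor
  · rintro ⟨h1, a, b, h⟩
    rw [mem_curve_iff h, Hz_excVec, mul_zero, add_zero] at h1
    exact excLine_root hω h h1.2
  · rintro (rfl | rfl)
    · exact ⟨basePoints_subset_curve μ (bp_mem_basePoints _ _), bp_mem_excLine _ _⟩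
    · exact ⟨basePoints_subset_curve μ (bp_mem_basePoints _ _), bp_mem_excLine _ _⟩

theorem basePoints_inter_excLine {ω : ℂ} (hω : IsPrimitiveRoot ω 3) (k : Fin 10) :
    basePoints ∩ excLine k = {bp hω k, bp (primitive_sq hω) k} := by
  apply Set.Subset.antisymm
  · rw [← curve_inter_excLine hω 0 k]
    exact Set.inter_subset_inter_left _ (basePoints_subset_curve 0)
  · rintro P (rfl | rfl)
    · exact ⟨bp_mem_basePoints _ _, bp_mem_excLine _ _⟩
    · exact ⟨bp_mem_basePoints _ _, bp_mem_excLine _ _⟩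

theorem blowDown_bp {w : ℂ} (hw : IsPrimitiveRoot w 3) (k : Fin 10) :
    BlowDown (bp hw k) (fivePoints w (bpCode k).1, fivePoints w (bpCode k).2) :=
  (blowDown_iff (represents_bp hw k) (represents_fivePoints _ _) (represents_fivePoints _ _)).2
    (incident_bpVec (cube_root_sum hw) k)

/-- The primitive cube roots of unity. -/
noncomputable def cubeRoot (ω : ℂ) (j : Fin 2) : ℂ := ![ω, ω ^ 2] j

theorem primitive_cubeRoot {ω : ℂ} (hω : IsPrimitiveRoot ω 3) (j : Fin 2) :
    IsPrimitiveRoot (cubeRoot ω j) 3 := by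
  fin_cases j
  · exact hω
  · exact primitive_sq hω

/-- The twenty base points. -/
noncomputable def bpt {ω : ℂ} (hω : IsPrimitiveRoot ω 3) (i : Fin 10 × Fin 2) : P5 :=
  bp (primitive_cubeRoot hω i.2) i.1

/-- The action of `ω ↦ ω²` on the five points. -/
def conjCode (j : Fin 2) (c : Fin 5) : Fin 5 := ![c, ![0, 1, 2, 4, 3] c] j

theorem fivePoints_cubeRoot {ω : ℂ} (hω : IsPrimitiveRoot ω 3) (j : Fin 2) (c : Fin 5) :
    fivePoints (cubeRoot ω j) c = fivePoints ω (conjCode j c) := by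
  have h3 : ω ^ 3 = 1 := hω.pow_eq_one
  fin_cases j
  · rfl
  · have h4 : (ω ^ 2) ^ 2 = ω := by linear_combination ω * h3
    fin_cases c <;> simp [fivePoints, cubeRoot, conjCode, h4]

/-- The image of a base point, as a pair of codes. -/
def bptCode (i : Fin 10 × Fin 2) : Fin 5 × Fin 5 :=
  (conjCode i.2 (bpCode i.1).1, conjCode i.2 (bpCode i.1).2)

theorem blowDown_bpt {ω : ℂ} (hω : IsPrimitiveRoot ω 3) (i : Fin 10 × Fin 2) (p : P1 × P1) :
    BlowDown (bpt hω i) p ↔ p = Prod.map (fivePoints ω) (fivePoints ω) (bptCode i) := by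
  have h := blowDown_bp (primitive_cubeRoot hω i.2) i.1
  rw [fivePoints_cubeRoot hω, fivePoints_cubeRoot hω] at h
  have hd : bpt hω i ∈ dP5 := excLine_subset i.1 (bp_mem_excLine _ _)
  constructor
  · intro h'
    exact (blowDown_existsUnique hd).unique h' h
  · rintro rfl
    exact h

theorem bp_ne_bp_sq {ω : ℂ} (hω : IsPrimitiveRoot ω 3) (k : Fin 10) :
    bp hω k ≠ bp (primitive_sq hω) k := by
  intro h
  obtain ⟨c, hc, hv⟩ := (represents_bp hω k).smul_eq (h ▸ represents_bp (primitive_sq hω) k)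
  have hne := ne_facts hω
  have h3 : ω ^ 3 = 1 := hω.pow_eq_one
  have hs := cube_root_sum hω
  have hd := hne.2.2.2.1
  have key : ∀ i, bpVec (ω ^ 2) k i = c * bpVec ω k i := fun i => congrFun hv i
  have h0 := key 0
  have h1 := key 1
  have h2 := key 2
  have h4 := key 4
  have h5 := key 5
  fin_cases k <;> simp [bpVec, bpParam, excVec] at h0 h1 h2 h4 h5 <;> grind

/-- Two base points with the same image can only be the pair on one exceptional line, as happens
over the nodes; such pairs are separated by coordinates in `bp_ne_bp_sq`. -/
theorem bptCode_injOn : ∀ i i', bptCode i = bptCode i' → i.1 = i'.1 := by decide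

theorem bpt_injective {ω : ℂ} (hω : IsPrimitiveRoot ω 3) : Function.Injective (bpt hω) := by
  intro i i' h
  have hcode : bptCode i = bptCode i' := by
    have h1 := (blowDown_bpt hω i _).2 rfl
    rw [h, blowDown_bpt] at h1
    exact ((fivePoints_injective hω).prodMap (fivePoints_injective hω)) h1
  have h1 := bptCode_injOn i i' hcode
  obtain ⟨k, j⟩ := i
  obtain ⟨k', j'⟩ := i'
  obtain rfl : k = k' := h1
  have := bp_ne_bp_sq hω k
  fin_cases j <;> fin_cases j'
  · rfl
  · exact absurd h this
  · exact absurd h.symm this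
  · rfl

theorem mem_basePoints_cases {ω : ℂ} (hω : IsPrimitiveRoot ω 3) {P : P5} {k : Fin 10}
    (hP : P ∈ basePoints) (hk : P ∈ excLine k) : ∃ i, bpt hω i = P := by
  have : P ∈ basePoints ∩ excLine k := ⟨hP, hk⟩
  rw [basePoints_inter_excLine hω] at this
  rcases this with h | h
  · exact ⟨(k, 0), h.symm⟩
  · exact ⟨(k, 1), h.symm⟩

/-- A base point over a node lies on the exceptional line there, where the two roots are known.
Elsewhere it is determined by its image, one of the seventeen points, and each code is attained by
some `bpt`. -/
theorem basePoints_eq_range {ω : ℂ} (hω : IsPrimitiveRoot ω 3) :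
    basePoints = Set.range (bpt hω) := by
  apply Set.Subset.antisymm
  · intro P hP
    have hd : P ∈ dP5 := by
      rw [mem_dP5_iff (represents_rep P)]
      exact ((mem_basePoints_iff (represents_rep P)).1 hP).1
    obtain ⟨p, hp, -⟩ := blowDown_existsUnique hd
    by_cases hn : p ∈ nodes
    · rcases hn with rfl | rfl | rfl
      · exact mem_basePoints_cases hω hP (fiber_zero_infty.subset ⟨hd, hp⟩)
      · exact mem_basePoints_cases hω hP (fiber_infty_zero.subset ⟨hd, hp⟩)
      · exact mem_basePoints_cases hω hP (fiber_one_one.subset ⟨hd, hp⟩)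
    · have h1 := (fiber_regular (represents_rep p.1) (represents_rep p.2) hn).2
      have h2 := (mem_basePoints_iff ((h1 P).1 hp)).1 hP
      -- Any nonzero parameter recovers the seventeen points from `G = H = 0`; here it is `1`.
      rw [Gz_psiBi, Hz_psiBi, ← mem_curve0_inter one_ne_zero (represents_rep p.1)
        (represents_rep p.2), curve0_inter one_ne_zero hω, meetingPoints_eq_image] at h2
      obtain ⟨-, c, hc, rfl⟩ := h2
      have hcases : ∀ c ∈ meetingCodes, ∃ i, bptCode i = c := by decide
      obtain ⟨i, rfl⟩ := hcases c hc
      exact ⟨i, ((h1 _).1 ((blowDown_bpt hω i _).2 rfl)).unique ((h1 P).1 hp)⟩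
  · rintro P ⟨i, rfl⟩
    exact bp_mem_basePoints _ _

theorem ncard_basePoints : basePoints.ncard = 20 := by
  have hω := Complex.isPrimitiveRoot_exp 3 (by norm_num)
  rw [basePoints_eq_range hω, ← Set.image_univ, Set.ncard_image_of_injective _ (bpt_injective hω),
    Set.ncard_univ]
  simp

theorem blowDown_basePoints {ω : ℂ} (hω : IsPrimitiveRoot ω 3) :
    {p | ∃ P ∈ basePoints, BlowDown P p} = meetingPoints ω := by
  rw [basePoints_eq_range hω, meetingPoints_eq_image]
  ext p
  simp only [Set.mem_ofPred_eq, Set.exists_range_iff, blowDown_bpt, Set.mem_image]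
  have h1 : ∀ c ∈ meetingCodes, ∃ i, bptCode i = c := by decide
  have h2 : ∀ i, bptCode i ∈ meetingCodes := by decide
  constructor
  · rintro ⟨i, rfl⟩
    exact ⟨_, h2 i, rfl⟩
  · rintro ⟨c, hc, rfl⟩
    obtain ⟨i, rfl⟩ := h1 c hc
    exact ⟨i, rfl⟩

theorem ncard_basePoints_fiber {ω : ℂ} (hω : IsPrimitiveRoot ω 3) (c : Fin 5 × Fin 5) :
    {P | P ∈ basePoints ∧ BlowDown P (Prod.map (fivePoints ω) (fivePoints ω) c)}.ncard
      = (Finset.univ.filter fun i => bptCode i = c).card := by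
  have : {P | P ∈ basePoints ∧ BlowDown P (Prod.map (fivePoints ω) (fivePoints ω) c)}
      = bpt hω '' (Finset.univ.filter fun i => bptCode i = c : Finset _) := by
    rw [basePoints_eq_range hω]
    ext P
    constructor
    · rintro ⟨⟨i, rfl⟩, h⟩
      rw [blowDown_bpt] at h
      exact ⟨i, by simpa using
        (((fivePoints_injective hω).prodMap (fivePoints_injective hω)) h).symm, rfl⟩
    · rintro ⟨i, hi, rfl⟩
      refine ⟨⟨i, rfl⟩, (blowDown_bpt hω i _).2 ?_⟩
      simp at hi
      rw [hi]
  rw [this, Set.ncard_image_of_injective _ (bpt_injective hω), Set.ncard_coe_finset]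

theorem ncard_basePoints_node {p : P1 × P1} (hp : p ∈ nodes) :
    {P | P ∈ basePoints ∧ BlowDown P p}.ncard = 2 := by
  have hω := Complex.isPrimitiveRoot_exp 3 (by norm_num)
  rw [nodes_eq_image (Complex.exp (2 * Real.pi * Complex.I / (3 : ℕ)))] at hp
  obtain ⟨c, hc, rfl⟩ := hp
  rw [ncard_basePoints_fiber hω]
  have : ∀ c ∈ ({(0, 2), (2, 0), (1, 1)} : Finset (Fin 5 × Fin 5)),
    (Finset.univ.filter fun i => bptCode i = c).card = 2 := by decide
  exact this c hc

theorem ncard_basePoints_regular {ω : ℂ} (hω : IsPrimitiveRoot ω 3) {p : P1 × P1}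
    (hp : p ∈ meetingPoints ω \ nodes) : {P | P ∈ basePoints ∧ BlowDown P p}.ncard = 1 := by
  rw [nodes_eq_image ω, meetingPoints_eq_image ω] at hp
  obtain ⟨⟨c, hc, rfl⟩, hn⟩ := hp
  rw [ncard_basePoints_fiber hω]
  have : ∀ c ∈ meetingCodes, c ∉ ({(0, 2), (2, 0), (1, 1)} : Finset (Fin 5 × Fin 5)) →
    (Finset.univ.filter fun i => bptCode i = c).card = 1 := by decide
  exact this c hc fun h => hn ⟨c, h, rfl⟩

theorem bpt_mem_excLine {ω : ℂ} (hω : IsPrimitiveRoot ω 3) (i : Fin 10 × Fin 2) (k : Fin 10) :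
    bpt hω i ∈ excLine k ↔ i.1 = k := by
  constructor
  · intro h
    have : bpt hω i ∈ basePoints ∩ excLine k := ⟨bp_mem_basePoints _ _, h⟩
    rw [basePoints_inter_excLine hω] at this
    rcases this with h | h
    · have := bpt_injective hω (a₁ := i) (a₂ := (k, 0)) h
      rw [this]
    · have := bpt_injective hω (a₁ := i) (a₂ := (k, 1)) h
      rw [this]
  · rintro rfl
    exact bp_mem_excLine _ _

theorem existsUnique_excLine {P : P5} (hP : P ∈ basePoints) : ∃! k, P ∈ excLine k := by
  have hω := Complex.isPrimitiveRoot_exp 3 (by norm_num)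
  rw [basePoints_eq_range hω] at hP
  obtain ⟨i, rfl⟩ := hP
  exact ⟨i.1, (bpt_mem_excLine hω i _).2 rfl, fun k hk => ((bpt_mem_excLine hω i k).1 hk).symm⟩

theorem ncard_basePoints_inter_excLine (k : Fin 10) : (basePoints ∩ excLine k).ncard = 2 := by
  have hω := Complex.isPrimitiveRoot_exp 3 (by norm_num)
  rw [basePoints_inter_excLine hω, Set.ncard_pair (bp_ne_bp_sq hω k)]

/-- Nodes lie on every `C⁰_μ`, and the base points above them lie on every `C_μ`. Off the nodes the
fibre is the single point `psiBi s t`, at which the two equations agree. -/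
theorem image_curve (μ : ℂ) : {p | ∃ P ∈ curve μ, BlowDown P p} = curve0 μ := by
  have hω := Complex.isPrimitiveRoot_exp 3 (by norm_num)
  ext p
  have hnode : p ∈ nodes → p ∈ curve0 μ := by
    rintro (rfl | rfl | rfl)
    · rw [mem_curve0_iff (represents_aff 0) represents_infty]
      simp [bihomF, bihomG, bihomH]
    · rw [mem_curve0_iff represents_infty (represents_aff 0)]
      simp [bihomF, bihomG, bihomH]
    · rw [mem_curve0_iff (represents_aff 1) (represents_aff 1)]
      simp [bihomF, bihomG, bihomH]; norm_num
  by_cases hn : p ∈ nodes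
  · refine ⟨fun _ => hnode hn, fun _ => ?_⟩
    have h2 := ncard_basePoints_node hn
    have : {P | P ∈ basePoints ∧ BlowDown P p}.Nonempty := by
      apply Set.nonempty_of_ncard_ne_zero; omega
    obtain ⟨P, hP, h⟩ := this
    exact ⟨P, basePoints_subset_curve μ hP, h⟩
  · obtain ⟨P, ⟨hP, hb⟩, -⟩ := fiber_unique hn
    have h1 := (fiber_regular (represents_rep p.1) (represents_rep p.2) hn).2
    have hr := (h1 P).1 hb
    have hiff : P ∈ curve μ ↔ p ∈ curve0 μ := by
      rw [mem_curve_iff hr, Gz_psiBi, Hz_psiBi,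
        mem_curve0_iff (represents_rep p.1) (represents_rep p.2)]
      exact and_iff_right (psiBi_mem_cone _ _)
    constructor
    · rintro ⟨Q, hQ, hb'⟩
      rw [((h1 Q).1 hb').unique hr] at hQ
      exact hiff.1 hQ
    · intro h
      exact ⟨P, hiff.2 h, hb⟩

/-! ### Lines of the family in terms of five linear forms -/

/-- The five linear forms. -/
noncomputable def ell (σ τ u v : ℂ) : Fin 5 → ℂ :=
  ![u, v, σ * u + v, σ * u + τ * v, u + τ * v]

/-- The fifth powers of the coefficients of the five linear forms. -/
noncomputable def coef5 (σ τ : ℂ) : Fin 5 → ℂ :=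
  ![alpha5 σ τ, alpha5 τ σ, -(τ ^ 4 * beta5 σ), beta5 (σ * τ), -(σ ^ 4 * beta5 τ)]

/-- The line with coordinates `Dᵢ ℓᵢ`. -/
noncomputable def dLine (D : Fin 5 → ℂ) (σ τ : ℂ) : Submodule ℂ (Fin 5 → ℂ) :=
  Submodule.span ℂ {D * ell σ τ 1 0, D * ell σ τ 0 1}

/-- The coefficients that belong to a choice of fifth roots. -/
noncomputable def FifthRoots.coef (r : FifthRoots) : Fin 5 → ℂ :=
  ![r.a₁, r.a₂, -(r.t ^ 4 * r.b₁), r.b₃, -(r.s ^ 4 * r.b₂)]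

theorem famPoint_eq (r : FifthRoots) (σ τ u v : ℂ) :
    famPoint r σ τ u v = r.coef * ell σ τ u v := by
  ext i; fin_cases i <;> simp [famPoint, FifthRoots.coef, ell]

theorem famLine_eq (r : FifthRoots) (σ τ : ℂ) : famLine r σ τ = dLine r.coef σ τ := by
  simp only [famLine, dLine, famPoint_eq]

theorem FifthRoots.IsAt.coef_pow {r : FifthRoots} {σ τ : ℂ} (h : r.IsAt σ τ) (i : Fin 5) :
    r.coef i ^ 5 = coef5 σ τ i := by
  obtain ⟨h1, h2, h3, h4, h5, h6, h7⟩ := h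
  fin_cases i <;> simp [FifthRoots.coef, coef5]
  · exact h3
  · exact h4
  · rw [← h2, ← h5]; ring
  · exact h7
  · rw [← h1, ← h6]; ring

/-- Only the coefficients of the five forms matter for the line: since `σ` and `τ` are nonzero,
dividing by `t⁴` and `s⁴` recovers roots of `β` from them. -/
theorem exists_fifthRoots {σ τ : ℂ} (hσ : σ ≠ 0) (hτ : τ ≠ 0) {D : Fin 5 → ℂ}
    (hD : ∀ i, D i ^ 5 = coef5 σ τ i) : ∃ r : FifthRoots, r.IsAt σ τ ∧ r.coef = D := by
  obtain ⟨s, hs⟩ := IsAlgClosed.exists_pow_nat_eq σ (n := 5) (by norm_num)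
  obtain ⟨t, ht⟩ := IsAlgClosed.exists_pow_nat_eq τ (n := 5) (by norm_num)
  have hs0 : s ≠ 0 := by rintro rfl; exact hσ (by simpa using hs.symm)
  have ht0 : t ≠ 0 := by rintro rfl; exact hτ (by simpa using ht.symm)
  refine ⟨⟨s, t, D 0, D 1, -D 2 / t ^ 4, -D 4 / s ^ 4, D 3⟩,
    ⟨hs, ht, hD 0, hD 1, ?_, ?_, hD 3⟩, ?_⟩
  · have h := hD 2
    have e : coef5 σ τ 2 = -(t ^ 20 * beta5 σ) := by
      show -(τ ^ 4 * beta5 σ) = _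
      rw [← ht]; ring
    rw [e] at h
    simp only [div_pow, neg_pow (D 2)]
    rw [h]; field_simp
  · have h := hD 4
    have e : coef5 σ τ 4 = -(s ^ 20 * beta5 τ) := by
      show -(σ ^ 4 * beta5 τ) = _
      rw [← hs]; ring
    rw [e] at h
    simp only [div_pow, neg_pow (D 4)]
    rw [h]; field_simp
  · ext i; fin_cases i <;> simp [FifthRoots.coef] <;> field_simp

/-- This identity makes the family work: it holds for all `σ`, `τ` and reduces the quintic on the
line to a multiple of the product of the five forms. -/
theorem sum_coef5_mul_ell (σ τ u v : ℂ) :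
    ∑ i, coef5 σ τ i * ell σ τ u v i ^ 5 = 10 * σ * τ * H σ τ * ∏ i, ell σ τ u v i := by
  simp [Fin.sum_univ_succ, Fin.prod_univ_succ, coef5, ell, H, alpha5, beta5]
  ring

/-- This identity explains the curves: the last factor becomes `32 H² / ψ⁵` when `G = -μH` and `μ² =
32/ψ⁵ - 3/4`, so that the product is then a fifth power. -/
theorem prod_coef5 (σ τ : ℂ) :
    ∏ i, coef5 σ τ i = H σ τ ^ 3 * (σ * τ) ^ 5 * (G σ τ ^ 2 + 3 / 4 * H σ τ ^ 2) := by
  simp [Fin.prod_univ_succ, coef5, H, G, alpha5, beta5]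
  ring

theorem prod_coef5_of_mem {ψ μ σ τ : ℂ} (hμ : μ ^ 2 = 32 / ψ ^ 5 - 3 / 4)
    (hF : affF μ σ τ = 0) : ∏ i, coef5 σ τ i = (2 * σ * τ * H σ τ / ψ) ^ 5 := by
  have hG : G σ τ = -μ * H σ τ := by unfold affF at hF; linear_combination hF
  rw [prod_coef5, hG]
  have : (-μ * H σ τ) ^ 2 + 3 / 4 * H σ τ ^ 2 = 32 / ψ ^ 5 * H σ τ ^ 2 := by
    linear_combination H σ τ ^ 2 * hμ
  rw [this, div_pow]; ring

theorem H_ne_zero {σ τ : ℂ} (h : H σ τ ≠ 0) :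
    σ ≠ 0 ∧ τ ≠ 0 ∧ 1 - σ ≠ 0 ∧ 1 - τ ≠ 0 ∧ 1 - σ * τ ≠ 0 := by
  simp only [H, ne_eq, mul_eq_zero, not_or] at h
  tauto

theorem coef_ne_zero {ψ μ σ τ : ℂ} (hψ : ψ ≠ 0) (hμ : μ ^ 2 = 32 / ψ ^ 5 - 3 / 4)
    (hF : affF μ σ τ = 0) (hH : H σ τ ≠ 0) {D : Fin 5 → ℂ} (hD : ∀ i, D i ^ 5 = coef5 σ τ i)
    (i : Fin 5) : D i ≠ 0 := by
  intro h
  have h1 := prod_coef5_of_mem hμ hF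
  obtain ⟨h2, h3, -, -, -⟩ := H_ne_zero hH
  have h4 : coef5 σ τ i = 0 := by rw [← hD, h]; norm_num
  rw [Finset.prod_eq_zero (Finset.mem_univ i) h4] at h1
  have : 2 * σ * τ * H σ τ / ψ ≠ 0 :=
    div_ne_zero (mul_ne_zero (mul_ne_zero (mul_ne_zero two_ne_zero h2) h3) hH) hψ
  exact pow_ne_zero 5 this h1.symm

theorem ell_linear (σ τ u v : ℂ) : ell σ τ u v = u • ell σ τ 1 0 + v • ell σ τ 0 1 := by
  ext i; fin_cases i <;> simp [ell] <;> ring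

theorem mem_dLine {D : Fin 5 → ℂ} {σ τ : ℂ} {x : Fin 5 → ℂ} :
    x ∈ dLine D σ τ ↔ ∃ u v, x = D * ell σ τ u v := by
  rw [dLine, Submodule.mem_span_pair]
  constructor
  · rintro ⟨u, v, rfl⟩
    exact ⟨u, v, by rw [ell_linear σ τ u v, mul_add, mul_smul_comm, mul_smul_comm]⟩
  · rintro ⟨u, v, rfl⟩
    exact ⟨u, v, by rw [ell_linear σ τ u v, mul_add, mul_smul_comm, mul_smul_comm]⟩

theorem range_pair (p q : Fin 5 → ℂ) : Set.range ![p, q] = {p, q} := by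
  ext x
  simp only [Set.mem_range, Fin.exists_fin_two, Matrix.cons_val_zero, Matrix.cons_val_one,
    Set.mem_insert_iff, Set.mem_singleton_iff]
  rw [eq_comm, @eq_comm _ q]

theorem finrank_span_pair {p q : Fin 5 → ℂ} :
    Module.finrank ℂ (Submodule.span ℂ {p, q}) = 2 ↔ LinearIndependent ℂ ![p, q] := by
  rw [linearIndependent_iff_card_eq_finrank_span, Set.finrank, range_pair]
  simp [eq_comm]

theorem dworkQuintic_coef {ψ σ τ : ℂ} {D : Fin 5 → ℂ} (hD : ∀ i, D i ^ 5 = coef5 σ τ i) (u v : ℂ) :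
    dworkQuintic ψ (D * ell σ τ u v)
      = (10 * σ * τ * H σ τ - 5 * ψ * ∏ i, D i) * ∏ i, ell σ τ u v i := by
  have : ∑ i, (D * ell σ τ u v) i ^ 5 = ∑ i, coef5 σ τ i * ell σ τ u v i ^ 5 :=
    Finset.sum_congr rfl fun i _ => by rw [Pi.mul_apply, mul_pow, hD]
  rw [dworkQuintic, this, sum_coef5_mul_ell]
  simp only [Pi.mul_apply, Finset.prod_mul_distrib]
  ring

theorem exists_prod_ell_ne_zero {σ τ : ℂ} (hτ : τ ≠ 0) :
    ∃ v, ∏ i, ell σ τ 1 v i ≠ 0 := by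
  obtain ⟨v, hv⟩ := Infinite.exists_notMem_finset ({0, -σ, -σ / τ, -1 / τ} : Finset ℂ)
  simp only [Finset.mem_insert, Finset.mem_singleton, not_or] at hv
  obtain ⟨h1, h2, h3, h4⟩ := hv
  refine ⟨v, Finset.prod_ne_zero_iff.2 fun i _ => ?_⟩
  fin_cases i <;> simp [ell]
  · exact h1
  · exact fun h => h2 (by linear_combination h)
  · exact fun h => h3 (by field_simp; linear_combination h)
  · exact fun h => h4 (by field_simp; linear_combination h)

/-- On the line the quintic equals the scalar `10στH - 5ψ ∏ Dᵢ` times `∏ ℓᵢ`, and `∏ ℓᵢ` is not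
identically zero. Consequently the admissible `D` at a given parameter form one torsor under the
group `∏ gᵢ = 1`, `gᵢ⁵ = 1`. -/
theorem isDworkLine_iff {ψ μ σ τ : ℂ} (hψ : ψ ≠ 0) (hμ : μ ^ 2 = 32 / ψ ^ 5 - 3 / 4)
    (hF : affF μ σ τ = 0) (hH : H σ τ ≠ 0) {D : Fin 5 → ℂ} (hD : ∀ i, D i ^ 5 = coef5 σ τ i) :
    IsDworkLine ψ (dLine D σ τ) ↔ ∏ i, D i = 2 * σ * τ * H σ τ / ψ := by
  obtain ⟨-, hτ, -, -, -⟩ := H_ne_zero hH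
  constructor
  · rintro ⟨-, h⟩
    obtain ⟨v, hv⟩ := exists_prod_ell_ne_zero (σ := σ) hτ
    have := h _ (mem_dLine.2 ⟨1, v, rfl⟩)
    rw [dworkQuintic_coef hD, mul_eq_zero, or_iff_left hv] at this
    field_simp
    linear_combination -this / 5
  · intro h
    refine ⟨?_, fun x hx => ?_⟩
    · rw [dLine, finrank_span_pair, LinearIndependent.pair_iff]
      intro s t hst
      have h0 := congrFun hst 0
      have h1 := congrFun hst 1
      have hD0 := coef_ne_zero hψ hμ hF hH hD 0
      have hD1 := coef_ne_zero hψ hμ hF hH hD 1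
      simp [ell] at h0 h1
      tauto
    · obtain ⟨u, v, rfl⟩ := mem_dLine.1 hx
      rw [dworkQuintic_coef hD, h]
      field_simp
      ring

/-- A nonzero pair `(x, y)` killing every form with nonzero coefficient is a linear relation between
the two spanning vectors. -/
theorem not_isDworkLine_of_dependent {ψ σ τ : ℂ} {D : Fin 5 → ℂ}
    (hD : ∀ i, D i ^ 5 = coef5 σ τ i) (x y : ℂ) (hxy : x ≠ 0 ∨ y ≠ 0)
    (h : ∀ i, coef5 σ τ i = 0 ∨ ell σ τ x y i = 0) : ¬ IsDworkLine ψ (dLine D σ τ) := by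
  rintro ⟨h2, -⟩
  rw [dLine, finrank_span_pair, LinearIndependent.pair_iff] at h2
  have := h2 x y (by
    rw [← mul_smul_comm, ← mul_smul_comm, ← mul_add, ← ell_linear]
    ext i
    rcases h i with h | h
    · have : D i = 0 := by
        rw [← hD] at h
        exact pow_eq_zero_iff (by norm_num) |>.1 h
      simp [this]
    · simp [h])
  tauto

/-- On the curve `H = 0` forces `G = 0`, so the parameter is one of the finite common points; at
each of these the span degenerates. Approximating sequences therefore never sit at such a parameter.
-/
theorem IsFamilyLine.H_ne_zero {ψ μ σ τ : ℂ} {L : Submodule ℂ (Fin 5 → ℂ)}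
    (h : IsFamilyLine ψ σ τ L) (hF : affF μ σ τ = 0) : H σ τ ≠ 0 := by
  intro hH
  have hω := Complex.isPrimitiveRoot_exp 3 (by norm_num)
  generalize Complex.exp (2 * Real.pi * Complex.I / (3 : ℕ)) = ω at hω
  have hG : G σ τ = 0 := by unfold affF at hF; linear_combination hF - μ * hH
  obtain ⟨hL, r, hr, rfl⟩ := h
  rw [famLine_eq] at hL
  have hD := hr.coef_pow
  have hno := not_isDworkLine_of_dependent (ψ := ψ) hD
  have q : ∀ a, a = -ω ∨ a = -ω ^ 2 → 1 - a + a ^ 2 = 0 := fun a => (cube_root_cases hω).2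
  have h3 : ω ^ 3 = 1 := hω.pow_eq_one
  have hinv : ∀ a b, (a = -ω ∨ a = -ω ^ 2) → (b = -ω ∨ b = -ω ^ 2) → a * b = 1 →
      ∀ i, coef5 a b i = 0 := by
    intro a b ha hb hab i
    have hb' : b * a = 1 := by rw [mul_comm, hab]
    fin_cases i <;> simp [coef5, alpha5, beta5, hab, hb', q a ha, q b hb]
  rcases (G_H_zero hω).1 ⟨hG, hH⟩ with ⟨rfl, rfl⟩ | ⟨rfl, h⟩ | ⟨rfl, h⟩ | ⟨rfl, h⟩ | ⟨rfl, h⟩ |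
    ⟨rfl, rfl⟩ | ⟨rfl, rfl⟩
  · exact hno 1 0 (by simp) (fun i => by fin_cases i <;> simp [coef5, alpha5, beta5]) hL
  · exact hno 1 0 (by simp) (fun i => by fin_cases i <;> simp [coef5, alpha5, beta5, ell]) hL
  · exact hno 0 1 (by simp) (fun i => by fin_cases i <;> simp [coef5, alpha5, beta5, ell]) hL
  · exact hno (-τ) 1 (by simp) (fun i => by fin_cases i <;> simp [coef5, alpha5, beta5, ell]) hL
  · exact hno 1 (-σ) (by simp) (fun i => by fin_cases i <;> simp [coef5, alpha5, beta5, ell]) hL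
  · exact hno 1 0 (by simp) (fun i => Or.inl (hinv _ _ (Or.inl rfl) (Or.inr rfl)
      (by linear_combination h3) i)) hL
  · exact hno 1 0 (by simp) (fun i => Or.inl (hinv _ _ (Or.inr rfl) (Or.inl rfl)
      (by linear_combination h3) i)) hL

/-- The lines of the family with parameters on the curve. -/
theorem isFamilyLine_iff {ψ μ σ τ : ℂ} (hψ : ψ ≠ 0) (hμ : μ ^ 2 = 32 / ψ ^ 5 - 3 / 4)
    (hF : affF μ σ τ = 0) {L : Submodule ℂ (Fin 5 → ℂ)} :
    IsFamilyLine ψ σ τ L ↔ H σ τ ≠ 0 ∧ ∃ D : Fin 5 → ℂ, (∀ i, D i ^ 5 = coef5 σ τ i) ∧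
      ∏ i, D i = 2 * σ * τ * H σ τ / ψ ∧ L = dLine D σ τ := by
  constructor
  · intro h
    have hH := h.H_ne_zero hF
    obtain ⟨hL, r, hr, rfl⟩ := h
    rw [famLine_eq] at hL ⊢
    exact ⟨hH, _, hr.coef_pow, (isDworkLine_iff hψ hμ hF hH hr.coef_pow).1 hL, rfl⟩
  · rintro ⟨hH, D, hD, hprod, rfl⟩
    obtain ⟨hσ, hτ, -, -, -⟩ := DworkLines.H_ne_zero hH
    obtain ⟨r, hr, rfl⟩ := exists_fifthRoots hσ hτ hD
    exact ⟨(isDworkLine_iff hψ hμ hF hH hD).2 hprod, r, hr, (famLine_eq _ _ _).symm⟩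

/-! ### Limits of lines -/

theorem mem_diag_map {g : Fin 5 → ℂ} {L : Submodule ℂ (Fin 5 → ℂ)} {x : Fin 5 → ℂ} :
    x ∈ L.map (Matrix.toLin' (Matrix.diagonal g)) ↔ ∃ y ∈ L, x = g * y := by
  rw [Submodule.mem_map]
  constructor
  · rintro ⟨y, hy, rfl⟩
    exact ⟨y, hy, by ext i; simp [Matrix.mulVec_diagonal]⟩
  · rintro ⟨y, hy, rfl⟩
    exact ⟨y, hy, by ext i; simp [Matrix.mulVec_diagonal]⟩

theorem diag_map_span_pair (g p q : Fin 5 → ℂ) :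
    (Submodule.span ℂ {p, q}).map (Matrix.toLin' (Matrix.diagonal g))
      = Submodule.span ℂ {g * p, g * q} := by
  have e : ∀ y, Matrix.toLin' (Matrix.diagonal g) y = g * y := fun y => by
    ext i; simp [Matrix.mulVec_diagonal]
  rw [Submodule.map_span, Set.image_pair, e, e]

theorem span_pair_eq_of_mem {p q x y : Fin 5 → ℂ} (hpq : LinearIndependent ℂ ![p, q])
    (hxy : LinearIndependent ℂ ![x, y]) (hp : p ∈ Submodule.span ℂ {x, y})
    (hq : q ∈ Submodule.span ℂ {x, y}) : Submodule.span ℂ {p, q} = Submodule.span ℂ {x, y} := by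
  apply Submodule.eq_of_le_of_finrank_eq
  · rw [Submodule.span_le]
    rintro z (rfl | rfl)
    · exact hp
    · exact hq
  · rw [finrank_span_pair.2 hpq, finrank_span_pair.2 hxy]

/-- Independence of three vectors is an open condition: if `p₀` were outside the limit plane, `p n`
would eventually be outside the approximating planes. -/
theorem linearIndependent_of_frequently {ι : Type*} {l : Filter ι} {x y p : ι → Fin 5 → ℂ}
    {x₀ y₀ p₀ : Fin 5 → ℂ} (hx : Tendsto x l (𝓝 x₀)) (hy : Tendsto y l (𝓝 y₀))
    (hp : Tendsto p l (𝓝 p₀)) (hxy : LinearIndependent ℂ ![x₀, y₀])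
    (h : ∃ᶠ n in l, p n ∈ Submodule.span ℂ {x n, y n}) : p₀ ∈ Submodule.span ℂ {x₀, y₀} := by
  by_contra hcon
  have h3 : LinearIndependent ℂ (Fin.cons p₀ ![x₀, y₀] : Fin 3 → Fin 5 → ℂ) := by
    rw [linearIndependent_finCons, range_pair]
    exact ⟨hxy, hcon⟩
  have ht : Tendsto (fun n => (Fin.cons (p n) ![x n, y n] : Fin 3 → Fin 5 → ℂ)) l
      (𝓝 (Fin.cons p₀ ![x₀, y₀])) := by
    rw [tendsto_pi_nhds]
    intro i
    fin_cases i
    · exact hp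
    · exact hx
    · exact hy
  have hev := ht.eventually (isOpen_setOfPred_linearIndependent.mem_nhds h3)
  obtain ⟨n, hn, hn'⟩ := (h.and_eventually hev).exists
  have hn' : LinearIndependent ℂ (Fin.cons (p n) ![x n, y n] : Fin 3 → Fin 5 → ℂ) := hn'
  rw [linearIndependent_finCons, range_pair] at hn'
  exact hn'.2 hn

theorem eventually_linearIndependent {ι : Type*} {l : Filter ι} {x y : ι → Fin 5 → ℂ}
    {x₀ y₀ : Fin 5 → ℂ} (hx : Tendsto x l (𝓝 x₀)) (hy : Tendsto y l (𝓝 y₀))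
    (hxy : LinearIndependent ℂ ![x₀, y₀]) : ∀ᶠ n in l, LinearIndependent ℂ ![x n, y n] := by
  have ht : Tendsto (fun n => ![x n, y n]) l (𝓝 ![x₀, y₀]) := by
    rw [tendsto_pi_nhds]
    intro i
    fin_cases i
    · exact hx
    · exact hy
  exact ht.eventually (isOpen_setOfPred_linearIndependent.mem_nhds hxy)

theorem finite_fifth_roots : {g : Fin 5 → ℂ | ∀ i, g i ^ 5 = 1}.Finite := by
  have h1 : {z : ℂ | z ^ 5 = 1}.Finite := by
    have : {z : ℂ | z ^ 5 = 1} ⊆ (Polynomial.nthRoots 5 (1 : ℂ)).toFinset := by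
      intro z hz
      simpa [Polynomial.mem_nthRoots] using hz
    exact (Finset.finite_toSet _).subset this
  exact (Set.Finite.pi' fun _ => h1)

/-- The parameters of the curve near a point `P` of `dP₅`: the functions `σ`, `τ` of the
uniformizing parameter `e` run through all points near `P`. -/
structure IsBranch (μ : ℂ) (P : P5) (σ τ : ℂ → ℂ) : Prop where
  mem : ∀ᶠ e in 𝓝[≠] (0 : ℂ), affF μ (σ e) (τ e) = 0 ∧ H (σ e) (τ e) ≠ 0
  tendsto : ∃ (lam : ℂ → ℂ) (z : Fin 6 → ℂ), Represents P z ∧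
    Tendsto (fun e => lam e • psiVec (σ e) (τ e)) (𝓝[≠] 0) (𝓝 z)
  unique : ∀ (s t lam : ℕ → ℂ) (z : Fin 6 → ℂ), Represents P z →
    Tendsto (fun n => lam n • psiVec (s n) (t n)) atTop (𝓝 z) →
    (∀ n, affF μ (s n) (t n) = 0 ∧ H (s n) (t n) ≠ 0) →
    ∃ e : ℕ → ℂ, Tendsto e atTop (𝓝[≠] 0) ∧ ∀ᶠ n in atTop, s n = σ (e n) ∧ t n = τ (e n)

/-- Multiplying the chosen coefficients by an element `g` of `𝒢` preserves their fifth powers and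
their product, so the translated lines also belong to the family and converge to the translated
limit. -/
theorem gOrbit_subset_limitLines {ψ μ : ℂ} (hψ : ψ ≠ 0) (hμ : μ ^ 2 = 32 / ψ ^ 5 - 3 / 4) {P : P5}
    {σ τ : ℂ → ℂ} (hb : IsBranch μ P σ τ) {D : ℂ → Fin 5 → ℂ} {uv : ℂ → ℂ → ℂ → ℂ × ℂ}
    {row : ℂ → ℂ → Fin 5 → ℂ}
    (hD : ∀ᶠ e in 𝓝[≠] (0 : ℂ), (∀ i, D e i ^ 5 = coef5 (σ e) (τ e) i) ∧
      ∏ i, D e i = 2 * σ e * τ e * H (σ e) (τ e) / ψ)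
    (hlim : ∀ u v, Tendsto (fun e => D e * ell (σ e) (τ e) (uv e u v).1 (uv e u v).2)
      (𝓝[≠] 0) (𝓝 (row u v)))
    (hrow : LinearIndependent ℂ ![row 1 0, row 0 1]) :
    gOrbit (Submodule.span ℂ {row 1 0, row 0 1}) ⊆ limitLines ψ μ P := by
  rintro L ⟨g, hg, hgp, rfl⟩
  rw [diag_map_span_pair]
  obtain ⟨lam, z, hz, hlz⟩ := hb.tendsto
  have hg0 : ∀ i, g i ≠ 0 := fun i h => by have := hg i; rw [h] at this; norm_num at this
  have hrow' : LinearIndependent ℂ ![g * row 1 0, g * row 0 1] := by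
    rw [LinearIndependent.pair_iff] at hrow ⊢
    intro s t h
    refine hrow s t ?_
    ext i
    have := congrFun h i
    simp at this ⊢
    have h' : g i * (s * row 1 0 i + t * row 0 1 i) = 0 := by linear_combination this
    exact (mul_eq_zero.1 h').resolve_left (hg0 i)
  have hx : ∀ u v, Tendsto (fun e => g * (D e * ell (σ e) (τ e) (uv e u v).1 (uv e u v).2))
      (𝓝[≠] 0) (𝓝 (g * row u v)) := fun u v => (hlim u v).const_mul g
  have hgood := (hb.mem.and (hD.and (eventually_linearIndependent (hx 1 0) (hx 0 1) hrow')))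
  obtain ⟨e, he⟩ := exists_seq_tendsto (𝓝[≠] (0 : ℂ))
  obtain ⟨N, hN⟩ := eventually_atTop.1 (he.eventually hgood)
  -- The definition of a limit line imposes its conditions for every `n`, so the sequence is started
  -- at `N`.
  have he' : Tendsto (fun n => e (n + N)) atTop (𝓝[≠] 0) := he.comp (tendsto_add_atTop_nat N)
  refine ⟨fun n => σ (e (n + N)), fun n => τ (e (n + N)), fun n => lam (e (n + N)), _, _, z, _, _,
    fun n => ?_, hz, hlz.comp he', (hx 1 0).comp he', (hx 0 1).comp he', hrow', rfl⟩
  obtain ⟨⟨h1, h2⟩, ⟨h3, h4⟩, h5⟩ := hN (n + N) (by omega)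
  refine ⟨h1, ?_⟩
  rw [isFamilyLine_iff hψ hμ h1]
  refine ⟨h2, g * D (e (n + N)), fun i => ?_, ?_, ?_⟩
  · rw [Pi.mul_apply, mul_pow, hg, one_mul, h3]
  · simp only [Pi.mul_apply, Finset.prod_mul_distrib]
    rw [hgp, one_mul, h4]
  · have hmem : ∀ u v, g * (D (e (n + N)) * ell (σ (e (n + N))) (τ (e (n + N))) u v)
        ∈ dLine (g * D (e (n + N))) (σ (e (n + N))) (τ (e (n + N))) := fun u v =>
      mem_dLine.2 ⟨u, v, by rw [mul_assoc]⟩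
    refine span_pair_eq_of_mem h5 ?_ (hmem _ _) (hmem _ _)
    rw [← finrank_span_pair]
    refine ((isDworkLine_iff hψ hμ h1 h2 fun i => ?_).2 ?_).1
    · rw [Pi.mul_apply, mul_pow, hg, one_mul, h3]
    · simp only [Pi.mul_apply, Finset.prod_mul_distrib]
      rw [hgp, one_mul, h4]

/-- An arbitrary sequence eventually runs on the branch, where its coefficients are `g n` times the
chosen ones. Since `g n` ranges over a finite set, some `g₀` occurs infinitely often; along these
`n` the vectors `g₀ * row u v` are limits of points of the lines, and equal dimension finishes the
argument. -/
theorem limitLines_subset_gOrbit {ψ μ : ℂ} (hψ : ψ ≠ 0) (hμ : μ ^ 2 = 32 / ψ ^ 5 - 3 / 4) {P : P5}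
    {σ τ : ℂ → ℂ} (hb : IsBranch μ P σ τ) {D : ℂ → Fin 5 → ℂ} {uv : ℂ → ℂ → ℂ → ℂ × ℂ}
    {row : ℂ → ℂ → Fin 5 → ℂ}
    (hD : ∀ᶠ e in 𝓝[≠] (0 : ℂ), (∀ i, D e i ^ 5 = coef5 (σ e) (τ e) i) ∧
      ∏ i, D e i = 2 * σ e * τ e * H (σ e) (τ e) / ψ)
    (hlim : ∀ u v, Tendsto (fun e => D e * ell (σ e) (τ e) (uv e u v).1 (uv e u v).2)
      (𝓝[≠] 0) (𝓝 (row u v)))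
    (hrow : LinearIndependent ℂ ![row 1 0, row 0 1]) :
    limitLines ψ μ P ⊆ gOrbit (Submodule.span ℂ {row 1 0, row 0 1}) := by
  rintro L ⟨s, t, lam, x, y, z, x₀, y₀, hfam, hz, hlz, hx, hy, hxy, rfl⟩
  obtain ⟨e, he, hev⟩ := hb.unique s t lam z hz hlz fun n =>
    ⟨(hfam n).1, (hfam n).2.H_ne_zero (hfam n).1⟩
  have hfam' : ∀ n, ∃ D' : Fin 5 → ℂ, (∀ i, D' i ^ 5 = coef5 (s n) (t n) i) ∧
      ∏ i, D' i = 2 * s n * t n * H (s n) (t n) / ψ ∧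
      Submodule.span ℂ {x n, y n} = dLine D' (s n) (t n) := fun n =>
    ((isFamilyLine_iff hψ hμ (hfam n).1).1 (hfam n).2).2
  choose D' hD' hprod hspan using hfam'
  have hgood := he.eventually (hb.mem.and hD)
  set g : ℕ → Fin 5 → ℂ := fun n => D' n / D (e n) with hgdef
  have hg : ∀ᶠ n in atTop, (∀ i, g n i ^ 5 = 1) ∧ ∏ i, g n i = 1 ∧
      Submodule.span ℂ {x n, y n} = dLine (g n * D (e n)) (σ (e n)) (τ (e n)) := by
    filter_upwards [hgood, hev] with n hn hn'
    obtain ⟨⟨h1, h2⟩, h3, h4⟩ := hn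
    have hne : ∀ i, D (e n) i ≠ 0 := coef_ne_zero hψ hμ h1 h2 h3
    have hD'n := hD' n
    have hp := hprod n
    have hs := hspan n
    rw [hn'.1, hn'.2] at hD'n hp hs
    refine ⟨fun i => ?_, ?_, ?_⟩
    · change (D' n i / D (e n) i) ^ 5 = 1
      rw [div_pow, hD'n, h3, div_self]
      rw [← h3]
      exact pow_ne_zero 5 (hne i)
    · simp only [hgdef, Pi.div_apply, Finset.prod_div_distrib]
      rw [hp, h4, div_self]
      rw [← h4]
      exact Finset.prod_ne_zero_iff.2 fun i _ => hne i
    · rw [hs]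
      congr 1
      ext i
      simp [hgdef, hne i]
  have hfreq : ∃ g₀ : Fin 5 → ℂ, ∃ᶠ n in atTop, g n = g₀ ∧ (∀ i, g n i ^ 5 = 1) ∧
      ∏ i, g n i = 1 ∧
      Submodule.span ℂ {x n, y n} = dLine (g n * D (e n)) (σ (e n)) (τ (e n)) := by
    by_contra hcon
    rw [not_exists] at hcon
    have h1 : ∀ᶠ n in atTop, ∀ g₀ ∈ {g : Fin 5 → ℂ | ∀ i, g i ^ 5 = 1}, ¬ (g n = g₀ ∧
        (∀ i, g n i ^ 5 = 1) ∧ ∏ i, g n i = 1 ∧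
        Submodule.span ℂ {x n, y n} = dLine (g n * D (e n)) (σ (e n)) (τ (e n))) := by
      rw [finite_fifth_roots.eventually_all]
      intro g₀ _
      exact not_frequently.1 (hcon g₀)
    obtain ⟨n, hn, hn'⟩ := (h1.and hg).exists
    exact hn _ hn'.1 ⟨rfl, hn'⟩
  obtain ⟨g₀, hfreq⟩ := hfreq
  have hg₀ : (∀ i, g₀ i ^ 5 = 1) ∧ ∏ i, g₀ i = 1 := by
    obtain ⟨n, rfl, h1, h2, -⟩ := hfreq.exists
    exact ⟨h1, h2⟩
  have hmem : ∀ u v, g₀ * row u v ∈ Submodule.span ℂ {x₀, y₀} := by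
    intro u v
    refine linearIndependent_of_frequently hx hy (((hlim u v).const_mul g₀).comp he) hxy ?_
    refine hfreq.mono ?_
    rintro n ⟨rfl, -, -, h⟩
    rw [h]
    exact mem_dLine.2 ⟨_, _, (mul_assoc _ _ _).symm⟩
  refine ⟨g₀, hg₀.1, hg₀.2, ?_⟩
  rw [diag_map_span_pair]
  refine (span_pair_eq_of_mem ?_ hxy (hmem 1 0) (hmem 0 1)).symm
  rw [LinearIndependent.pair_iff] at hrow ⊢
  intro s t h
  refine hrow s t ?_
  ext i
  have := congrFun h i
  simp at this ⊢
  have h' : g₀ i * (s * row 1 0 i + t * row 0 1 i) = 0 := by linear_combination this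
  refine (mul_eq_zero.1 h').resolve_left fun h0 => ?_
  have := hg₀.1 i
  rw [h0] at this; norm_num at this

theorem limitLines_eq_gOrbit {ψ μ : ℂ} (hψ : ψ ≠ 0) (hμ : μ ^ 2 = 32 / ψ ^ 5 - 3 / 4) {P : P5}
    {σ τ : ℂ → ℂ} (hb : IsBranch μ P σ τ) {D : ℂ → Fin 5 → ℂ} {uv : ℂ → ℂ → ℂ → ℂ × ℂ}
    {row : ℂ → ℂ → Fin 5 → ℂ}
    (hD : ∀ᶠ e in 𝓝[≠] (0 : ℂ), (∀ i, D e i ^ 5 = coef5 (σ e) (τ e) i) ∧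
      ∏ i, D e i = 2 * σ e * τ e * H (σ e) (τ e) / ψ)
    (hlim : ∀ u v, Tendsto (fun e => D e * ell (σ e) (τ e) (uv e u v).1 (uv e u v).2)
      (𝓝[≠] 0) (𝓝 (row u v)))
    (hrow : LinearIndependent ℂ ![row 1 0, row 0 1]) :
    limitLines ψ μ P = gOrbit (Submodule.span ℂ {row 1 0, row 0 1}) :=
  (limitLines_subset_gOrbit hψ hμ hb hD hlim hrow).antisymm
    (gOrbit_subset_limitLines hψ hμ hb hD hlim hrow)

/-! ### The choice of the fifth roots -/

/-- After division by the limit `v⁵` the values approach `1`, where the principal fifth root is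
continuous. -/
theorem exists_root_tendsto {l : Filter ℂ} {f : ℂ → ℂ} {v : ℂ} (hv : v ≠ 0)
    (hf : Tendsto f l (𝓝 (v ^ 5))) : ∃ ρ : ℂ → ℂ, (∀ e, ρ e ^ 5 = f e) ∧ Tendsto ρ l (𝓝 v) := by
  refine ⟨fun e => v * (f e / v ^ 5) ^ ((1 : ℂ) / (5 : ℕ)), fun e => ?_, ?_⟩
  · rw [mul_pow, one_div, Complex.cpow_nat_inv_pow _ (by norm_num)]
    field_simp
  · have h1 : Tendsto (fun e => f e / v ^ 5) l (𝓝 1) := by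
      have := hf.div_const (v ^ 5)
      rwa [div_self (pow_ne_zero 5 hv)] at this
    have h2 : ContinuousAt (fun z : ℂ => z ^ ((1 : ℂ) / (5 : ℕ))) 1 :=
      continuousAt_cpow_const (by simp)
    have h3 := (h2.tendsto.comp h1).const_mul v
    simpa using h3

/-- Roots chosen in such a way that the points converge automatically give lines in `M_ψ`. -/
theorem eventually_prod_eq {ψ μ : ℂ} (hψ : ψ ≠ 0) (hμ : μ ^ 2 = 32 / ψ ^ 5 - 3 / 4)
    {σ τ : ℂ → ℂ} (hmem : ∀ᶠ e in 𝓝[≠] (0 : ℂ), affF μ (σ e) (τ e) = 0 ∧ H (σ e) (τ e) ≠ 0)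
    {D : ℂ → Fin 5 → ℂ} {uv : ℂ → ℂ → ℂ → ℂ × ℂ} {row : ℂ → ℂ → Fin 5 → ℂ}
    (hD : ∀ᶠ e in 𝓝[≠] (0 : ℂ), ∀ i, D e i ^ 5 = coef5 (σ e) (τ e) i)
    (hlim : ∀ u v, Tendsto (fun e => D e * ell (σ e) (τ e) (uv e u v).1 (uv e u v).2)
      (𝓝[≠] 0) (𝓝 (row u v)))
    (hrow : ∃ u v, dworkQuintic ψ (row u v) = 0 ∧ ∏ i, row u v i ≠ 0) :
    ∀ᶠ e in 𝓝[≠] (0 : ℂ), (∀ i, D e i ^ 5 = coef5 (σ e) (τ e) i) ∧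
      ∏ i, D e i = 2 * σ e * τ e * H (σ e) (τ e) / ψ := by
  obtain ⟨u, v, hrow, hne⟩ := hrow
  set x : ℂ → Fin 5 → ℂ := fun e => D e * ell (σ e) (τ e) (uv e u v).1 (uv e u v).2 with hxdef
  have hx : Tendsto x (𝓝[≠] 0) (𝓝 (row u v)) := hlim u v
  have hxi : ∀ i, Tendsto (fun e => x e i) (𝓝[≠] 0) (𝓝 (row u v i)) := fun i =>
    (tendsto_pi_nhds.1 hx) i
  have hprod : Tendsto (fun e => ∏ i, x e i) (𝓝[≠] 0) (𝓝 (∏ i, row u v i)) :=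
    tendsto_finsetProd _ fun i _ => hxi i
  have hsum : Tendsto (fun e => ∑ i, x e i ^ 5) (𝓝[≠] 0) (𝓝 (∑ i, row u v i ^ 5)) :=
    tendsto_finsetSum _ fun i _ => (hxi i).pow 5
  have hS : ∑ i, row u v i ^ 5 = 5 * ψ * ∏ i, row u v i := by
    unfold dworkQuintic at hrow; linear_combination hrow
  have hS0 : ∑ i, row u v i ^ 5 ≠ 0 := by
    rw [hS]; exact mul_ne_zero (mul_ne_zero (by norm_num) hψ) hne
  -- The quotient `θ` tends to `1` because the limit point lies on `M_ψ` and has nonzero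
  -- coordinates. It also equals `∏ Dᵢ` divided by `2στH/ψ`, a fifth root of unity, so it is
  -- eventually `1`.
  set θ : ℂ → ℂ := fun e => 5 * ψ * (∏ i, x e i) / ∑ i, x e i ^ 5 with hθdef
  have hθ : Tendsto θ (𝓝[≠] 0) (𝓝 1) := by
    have := (hprod.const_mul (5 * ψ)).div hsum hS0
    rw [hS] at this
    rwa [div_self (hS ▸ hS0)] at this
  have hfin : {z : ℂ | z ^ 5 = 1 ∧ z ≠ 1}.Finite := by
    have : {z : ℂ | z ^ 5 = 1 ∧ z ≠ 1} ⊆ (Polynomial.nthRoots 5 (1 : ℂ)).toFinset := by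
      intro z hz
      simpa [Polynomial.mem_nthRoots] using hz.1
    exact (Finset.finite_toSet _).subset this
  have hθ1 : ∀ᶠ e in 𝓝[≠] (0 : ℂ), θ e ∉ {z : ℂ | z ^ 5 = 1 ∧ z ≠ 1} :=
    hθ.eventually (hfin.isClosed.isOpen_compl.mem_nhds (by simp))
  filter_upwards [hD, hmem, hθ1, hprod.eventually_ne hne] with e h1 h2 h3 h4
  refine ⟨h1, ?_⟩
  obtain ⟨hσ, hτ, -, -, -⟩ := H_ne_zero h2.2
  have e1 : ∏ i, x e i = (∏ i, D e i) * ∏ i, ell (σ e) (τ e) (uv e u v).1 (uv e u v).2 i := by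
    simp only [hxdef, Pi.mul_apply, Finset.prod_mul_distrib]
  have e2 : ∑ i, x e i ^ 5
      = 10 * σ e * τ e * H (σ e) (τ e) * ∏ i, ell (σ e) (τ e) (uv e u v).1 (uv e u v).2 i := by
    rw [← sum_coef5_mul_ell]
    exact Finset.sum_congr rfl fun i _ => by
      change (D e i * _) ^ 5 = _
      rw [mul_pow, h1]
  have hl : ∏ i, ell (σ e) (τ e) (uv e u v).1 (uv e u v).2 i ≠ 0 := by
    intro h0; rw [e1, h0, mul_zero] at h4; exact h4 rfl
  have hK : σ e * τ e * H (σ e) (τ e) ≠ 0 := mul_ne_zero (mul_ne_zero hσ hτ) h2.2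
  have hnz : 2 * σ e * τ e * H (σ e) (τ e) / ψ ≠ 0 := by
    refine div_ne_zero ?_ hψ
    rw [show 2 * σ e * τ e * H (σ e) (τ e) = 2 * (σ e * τ e * H (σ e) (τ e)) by ring]
    exact mul_ne_zero two_ne_zero hK
  have hθe : θ e = (∏ i, D e i) / (2 * σ e * τ e * H (σ e) (τ e) / ψ) := by
    rw [hθdef]
    simp only
    rw [e1, e2]
    have h10 : 10 * σ e * τ e * H (σ e) (τ e) ≠ 0 := by
      rw [show 10 * σ e * τ e * H (σ e) (τ e) = 10 * (σ e * τ e * H (σ e) (τ e)) by ring]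
      exact mul_ne_zero (by norm_num) hK
    rw [div_eq_div_iff (mul_ne_zero h10 hl) hnz]
    field_simp
    ring
  have hθ5 : θ e ^ 5 = 1 := by
    rw [hθe, div_pow, ← prod_coef5_of_mem hμ h2.1, ← Finset.prod_pow,
      Finset.prod_congr rfl fun i _ => h1 i, div_self]
    rw [prod_coef5_of_mem hμ h2.1]
    exact pow_ne_zero 5 hnz
  have hθ1 : θ e = 1 := by
    by_contra hcon
    exact h3 ⟨hθ5, hcon⟩
  rw [hθe] at hθ1
  exact (div_eq_one_iff_eq hnz).1 hθ1

/-! ### Implicit functions -/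

-- Besides the function and its derivative, the equivalence is needed: it says that every zero of
-- `F` near the point lies on the graph, which gives the field `unique` of `IsBranch`.
open scoped ContDiff in
theorem exists_implicit {F : ℂ × ℂ → ℂ} (hF : ContDiff ℂ ω F) {y₀ A B : ℂ} (h0 : F (0, y₀) = 0)
    (hA : HasDerivAt (fun x => F (x, y₀)) A 0) (hB : HasDerivAt (fun y => F (0, y)) B y₀)
    (hB0 : B ≠ 0) : ∃ q : ℂ → ℂ, AnalyticAt ℂ q 0 ∧ q 0 = y₀ ∧ HasDerivAt q (-A / B) 0 ∧
      ∀ᶠ p in 𝓝 ((0 : ℂ), y₀), F p = 0 ↔ q p.1 = p.2 := by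
  have hFd : HasFDerivAt F (fderiv ℂ F (0, y₀)) (0, y₀) :=
    (hF.differentiable (by simp)).differentiableAt.hasFDerivAt
  set F' := fderiv ℂ F (0, y₀) with hF'
  have hA' : F' (1, 0) = A := by
    have h1 : HasDerivAt (fun x : ℂ => (x, y₀)) (1, 0) (0 : ℂ) :=
      (hasDerivAt_id _).prodMk (hasDerivAt_const _ _)
    have h2 := hFd.comp_hasDerivAt (0 : ℂ) h1
    exact h2.unique hA
  have hB' : F' (0, 1) = B := by
    have h1 : HasDerivAt (fun y : ℂ => ((0 : ℂ), y)) (0, 1) y₀ :=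
      (hasDerivAt_const _ _).prodMk (hasDerivAt_id _)
    have h2 := hFd.comp_hasDerivAt y₀ h1
    exact h2.unique hB
  have hinv : (F' ∘L .inr ℂ ℂ ℂ).IsInvertible := by
    refine ⟨ContinuousLinearEquiv.unitsEquivAut ℂ (Units.mk0 B hB0), ?_⟩
    ext
    simp [hB']
  have cd : ContDiffAt ℂ ω F (0, y₀) := hF.contDiffAt
  have hn : (ω : ℕ∞ω) ≠ 0 := by simp
  set q := cd.implicitFunction hn hinv with hq
  have hq0 : q 0 = y₀ := cd.implicitFunction_apply_self hn hinv
  have hqa : AnalyticAt ℂ q 0 := (cd.contDiffAt_implicitFunction hn hinv).analyticAt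
  have hev := cd.eventually_apply_implicitFunction hn hinv
  refine ⟨q, hqa, hq0, ?_, ?_⟩
  · have hd := hqa.differentiableAt.hasDerivAt
    have h1 : HasDerivAt (fun x : ℂ => (x, q x)) (1, deriv q 0) (0 : ℂ) :=
      (hasDerivAt_id _).prodMk hd
    have hFd' : HasFDerivAt F F' ((fun x : ℂ => (x, q x)) 0) := by
      simp only [hq0]; exact hFd
    have h2 := hFd'.comp_hasDerivAt (0 : ℂ) h1
    have h3 : HasDerivAt (F ∘ fun x : ℂ => (x, q x)) 0 0 := by
      refine (hasDerivAt_const (0 : ℂ) (0 : ℂ)).congr_of_eventuallyEq ?_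
      filter_upwards [hev] with x hx
      rw [Function.comp_apply, hx, h0]
    have h4 := h2.unique h3
    have h5 : ((1 : ℂ), deriv q 0) = (1, 0) + deriv q 0 • ((0 : ℂ), (1 : ℂ)) := by
      ext <;> simp
    rw [h5, map_add, map_smul, hA', hB', smul_eq_mul] at h4
    have : deriv q 0 = -A / B := by field_simp; linear_combination h4
    rwa [this] at hd
  · have := cd.eventually_apply_eq_iff_implicitFunction hn hinv
    rwa [h0] at this

/-- The factor `k` is the divided difference of `q` at `0`. With `q = q 0 + x k`, powers of `ε` can
be split off by identities in two independent variables `ε` and `κ`, to be specialized at `κ = k ε`.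
-/
theorem analytic_expansion {q : ℂ → ℂ} {d : ℂ} (hq : AnalyticAt ℂ q 0) (hd : HasDerivAt q d 0) :
    ∃ k : ℂ → ℂ, ContinuousAt k 0 ∧ k 0 = d ∧ (∀ x, q x = q 0 + x * k x) ∧
      (fun x => k x - d) =O[𝓝 0] fun x => x := by
  refine ⟨dslope q 0, ?_, ?_, fun x => ?_, ?_⟩
  · exact continuousAt_dslope_same.2 hq.differentiableAt
  · rw [dslope_same, hd.deriv]
  · have := sub_smul_dslope q 0 x
    simp at this
    rw [this]; ring
  · obtain ⟨p, hp⟩ := hq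
    have h1 : AnalyticAt ℂ (dslope q 0) 0 := ⟨_, hp.has_fpower_series_dslope_fslope⟩
    have h2 := h1.differentiableAt.hasDerivAt.isBigO_sub
    simpa [dslope_same, hd.deriv] using h2

theorem hasDerivAt_quartic (c0 c1 c2 c3 c4 x : ℂ) :
    HasDerivAt (fun x => c0 + c1 * x + c2 * x ^ 2 + c3 * x ^ 3 + c4 * x ^ 4)
      (c1 + 2 * c2 * x + 3 * c3 * x ^ 2 + 4 * c4 * x ^ 3) x := by
  have h1 := ((hasDerivAt_id x).const_mul c1)
  have h2 := ((hasDerivAt_pow 2 x).const_mul c2)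
  have h3 := ((hasDerivAt_pow 3 x).const_mul c3)
  have h4 := ((hasDerivAt_pow 4 x).const_mul c4)
  have := ((((hasDerivAt_const x c0).add h1).add h2).add h3).add h4
  refine (this.congr_deriv ?_)
  simp; ring

/-- The partial derivative of the affine equation with respect to the first variable. -/
noncomputable def dF (μ σ τ : ℂ) : ℂ :=
  (-1 - 1 / 2 * τ + τ * μ - 1 / 2 * τ ^ 2 - τ ^ 2 * μ - τ ^ 3)
  + 2 * (1 - 1 / 2 * τ - τ * μ + 3 * τ ^ 2 - 1 / 2 * τ ^ 3 + τ ^ 3 * μ + τ ^ 4) * σ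
  + 3 * (-τ - 1 / 2 * τ ^ 2 + τ ^ 2 * μ - 1 / 2 * τ ^ 3 - τ ^ 3 * μ - τ ^ 4) * σ ^ 2
  + 4 * (τ ^ 2 - τ ^ 3 + τ ^ 4) * σ ^ 3

theorem hasDerivAt_affF (μ σ τ : ℂ) : HasDerivAt (fun x => affF μ x τ) (dF μ σ τ) σ := by
  refine (hasDerivAt_quartic (1 - τ + τ ^ 2) _ _ _ _ σ).congr_of_eventuallyEq
    (Eventually.of_forall fun x => ?_)
  simp only [affF, G, H]; ring

theorem affF_symm (μ σ τ : ℂ) : affF μ σ τ = affF μ τ σ := by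
  simp only [affF, G, H]; ring

theorem hasDerivAt_affF_right (μ σ τ : ℂ) : HasDerivAt (fun x => affF μ σ x) (dF μ τ σ) τ := by
  simp only [affF_symm μ σ]
  exact hasDerivAt_affF μ τ σ

/-! ### Branches of the curves -/

theorem tendsto_pow_five : Tendsto (fun e : ℂ => e ^ 5) (𝓝[≠] 0) (𝓝[≠] 0) := by
  refine tendsto_nhdsWithin_iff.2 ⟨?_, ?_⟩
  · have : ContinuousAt (fun e : ℂ => e ^ 5) 0 := by fun_prop
    have h := this.tendsto
    simp only [ne_eq, OfNat.ofNat_ne_zero, not_false_eq_true, zero_pow] at h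
    exact h.mono_left nhdsWithin_le_nhds
  · filter_upwards [self_mem_nhdsWithin] with e he
    exact pow_ne_zero 5 he

theorem exists_fifth_root_seq {f : ℕ → ℂ} (hf : Tendsto f atTop (𝓝[≠] 0)) :
    ∃ e : ℕ → ℂ, Tendsto e atTop (𝓝[≠] 0) ∧ ∀ n, e n ^ 5 = f n := by
  have h := fun n => IsAlgClosed.exists_pow_nat_eq (f n) (n := 5) (by norm_num)
  choose e he using h
  obtain ⟨h1, h2⟩ := tendsto_nhdsWithin_iff.1 hf
  refine ⟨e, tendsto_nhdsWithin_iff.2 ⟨?_, ?_⟩, he⟩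
  · rw [tendsto_zero_iff_norm_tendsto_zero] at h1 ⊢
    have h3 : Tendsto (fun n => ‖f n‖ ^ ((5 : ℕ) : ℝ)⁻¹) atTop (𝓝 0) := by
      have := h1.rpow_const (p := ((5 : ℕ) : ℝ)⁻¹) (Or.inr (by norm_num))
      rwa [Real.zero_rpow (by norm_num)] at this
    refine h3.congr fun n => ?_
    rw [← he, norm_pow, Real.pow_rpow_inv_natCast (norm_nonneg _) (by norm_num)]
  · filter_upwards [h2] with n hn
    rintro h0
    apply hn
    rw [← he, h0]; norm_num

/-- On the curve `H = 0` leaves four values for `σ`, and `s₀ + e⁵` avoids them for small `e ≠ 0`. -/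
theorem eventually_H_ne_zero {μ : ℂ} (s₀ : ℂ) {t : ℂ → ℂ}
    (h : ∀ᶠ e in 𝓝[≠] (0 : ℂ), affF μ (s₀ + e ^ 5) (t e) = 0) :
    ∀ᶠ e in 𝓝[≠] (0 : ℂ), affF μ (s₀ + e ^ 5) (t e) = 0 ∧ H (s₀ + e ^ 5) (t e) ≠ 0 := by
  have hω := Complex.isPrimitiveRoot_exp 3 (by norm_num)
  generalize Complex.exp (2 * Real.pi * Complex.I / (3 : ℕ)) = ω at hω
  have hs : ∀ a : ℂ, ∀ᶠ e in 𝓝[≠] (0 : ℂ), s₀ + e ^ 5 ≠ a := by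
    intro a
    by_cases ha : s₀ = a
    · filter_upwards [self_mem_nhdsWithin] with e he h
      have : e ^ 5 = 0 := by linear_combination h - ha
      exact pow_ne_zero 5 he this
    · have : ContinuousAt (fun e : ℂ => s₀ + e ^ 5) 0 := by fun_prop
      exact (this.eventually_ne (by simpa using ha)).filter_mono nhdsWithin_le_nhds
  filter_upwards [h, hs 0, hs 1, hs (-ω), hs (-ω ^ 2)] with e h1 h2 h3 h4 h5
  refine ⟨h1, fun hH => ?_⟩
  have hG : G (s₀ + e ^ 5) (t e) = 0 := by unfold affF at h1; linear_combination h1 - μ * hH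
  rcases (G_H_zero hω).1 ⟨hG, hH⟩ with h | h | h | h | h | h | h
  · exact h3 h.1
  · exact h2 h.1
  · exact h.2.elim h4 h5
  · exact h3 h.1
  · exact h.2.elim h4 h5
  · exact h4 h.1
  · exact h5 h.1

/-- `Ψ` determines `σ` where the denominators do not vanish. -/
theorem tendsto_div_of_smul {s t lam f : ℕ → ℂ} {z : Fin 6 → ℂ}
    (hlim : Tendsto (fun n => lam n • psiVec (s n) (t n)) atTop (𝓝 z)) (i j k : Fin 6)
    (hk : z k ≠ 0)
    (h : ∀ n, f n * psiVec (s n) (t n) k = psiVec (s n) (t n) i - psiVec (s n) (t n) j) :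
    Tendsto f atTop (𝓝 ((z i - z j) / z k)) ∧ ∀ᶠ n in atTop, psiVec (s n) (t n) k ≠ 0 := by
  have hi := tendsto_pi_nhds.1 hlim
  have hne := (hi k).eventually_ne hk
  have h0 : ∀ᶠ n in atTop, lam n ≠ 0 ∧ psiVec (s n) (t n) k ≠ 0 := by
    filter_upwards [hne] with n hn
    simpa using hn
  refine ⟨(((hi i).sub (hi j)).div (hi k) hk).congr' ?_, h0.mono fun n hn => hn.2⟩
  filter_upwards [h0] with n hn
  have h1 := hn.1
  have h2 := hn.2
  simp only [Pi.div_apply, Pi.smul_apply, smul_eq_mul]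
  rw [div_eq_iff (mul_ne_zero h1 h2)]
  linear_combination -lam n * h n

/-- Both parameters are ratios of linear forms in `Ψ`, so convergence in `P⁵` forces `(σ, τ) → (s₀,
t₀)`. The denominator for `σ` is `τ - 1`; for `τ` it is `σ - 1` or `στ - 1`, whence `h4` and `h3`.
-/
theorem isBranch_regular {μ s₀ t₀ : ℂ} {P : P5} (hP : Represents P (psiVec s₀ t₀))
    (hH : H s₀ t₀ = 0) (h4 : t₀ ≠ 1) (h3 : s₀ ≠ 1 ∨ s₀ * t₀ ≠ 1) {q : ℂ → ℂ}
    (hq : ContinuousAt q 0) (hq0 : q 0 = t₀)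
    (hiff : ∀ᶠ p in 𝓝 ((0 : ℂ), t₀), affF μ (s₀ + p.1) p.2 = 0 ↔ q p.1 = p.2) :
    IsBranch μ P (fun e => s₀ + e ^ 5) (fun e => q (e ^ 5)) := by
  have hpow := tendsto_pow_five.mono_right (nhdsWithin_le_nhds (s := {0}ᶜ) (a := (0 : ℂ)))
  have hq' : Tendsto (fun e : ℂ => q (e ^ 5)) (𝓝[≠] 0) (𝓝 t₀) := hq0 ▸ hq.tendsto.comp hpow
  have hs' : Tendsto (fun e : ℂ => s₀ + e ^ 5) (𝓝[≠] 0) (𝓝 s₀) := by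
    simpa using hpow.const_add s₀
  have hp := hpow.prodMk_nhds hq'
  constructor
  · apply eventually_H_ne_zero
    filter_upwards [hp.eventually hiff] with e he
    exact he.2 rfl
  · refine ⟨fun _ => 1, _, hP, ?_⟩
    have hc : Continuous fun p : ℂ × ℂ => psiVec p.1 p.2 := by
      refine continuous_pi fun i => ?_
      fin_cases i <;> simp [psiVec] <;> fun_prop
    have h := (hc.tendsto (s₀, t₀)).comp (hs'.prodMk_nhds hq')
    simp only [one_smul, Function.comp_def] at h ⊢
    exact h
  · intro s t lam z hz hlim hcurve
    obtain ⟨a, ha, rfl⟩ := hP.smul_eq hz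
    have h41 : t₀ - 1 ≠ 0 := sub_ne_zero.2 h4
    have hst : Tendsto s atTop (𝓝 s₀) := by
      have := (tendsto_div_of_smul (f := s) hlim 3 5 4 (by simp [psiVec, ha, h41])
        (fun n => by simp [psiVec]; ring)).1
      convert! this using 2
      simp [psiVec]
      field_simp
      ring
    have htt : Tendsto t atTop (𝓝 t₀) := by
      rcases h3 with h3 | h3
      · have h31 : s₀ - 1 ≠ 0 := sub_ne_zero.2 h3
        have := (tendsto_div_of_smul (f := t) hlim 3 4 5 (by simp [psiVec, ha, h31])
          (fun n => by simp [psiVec]; ring)).1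
        convert! this using 2
        simp [psiVec]
        field_simp
        ring
      · have h31 : s₀ * t₀ - 1 ≠ 0 := sub_ne_zero.2 h3
        have := (tendsto_div_of_smul (f := t) hlim 1 4 3 (by simp [psiVec, ha, h31])
          (fun n => by simp [psiVec]; ring)).1
        convert! this using 2
        change t₀ = (a * (s₀ * t₀ ^ 2 - 1) - a * (t₀ - 1)) / (a * (s₀ * t₀ - 1))
        rw [eq_div_iff (mul_ne_zero ha h31)]
        ring
    have hs0 : Tendsto (fun n => s n - s₀) atTop (𝓝 0) := by simpa using hst.sub_const s₀
    have hev := (hs0.prodMk_nhds htt).eventually hiff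
    have hev' : ∀ᶠ n in atTop, q (s n - s₀) = t n := by
      filter_upwards [hev] with n hn
      exact hn.1 (by simpa using (hcurve n).1)
    -- Equality `s n = s₀` would give `t n = t₀`, a point where `H` vanishes.
    have hne : ∀ᶠ n in atTop, s n - s₀ ∈ ({0}ᶜ : Set ℂ) := by
      filter_upwards [hev'] with n hn h
      have h : s n - s₀ = 0 := h
      rw [h, hq0] at hn
      apply (hcurve n).2
      rw [← hn, sub_eq_zero.1 h, hH]
    obtain ⟨e, he, he5⟩ := exists_fifth_root_seq (tendsto_nhdsWithin_iff.2 ⟨hs0, hne⟩)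
    refine ⟨e, he, ?_⟩
    filter_upwards [hev'] with n hn
    simp only [he5]
    exact ⟨by ring, hn.symm⟩

/-- The equation of the curve after blowing up the point `(1, 1)`. -/
noncomputable def nodeF (μ ε k : ℂ) : ℂ :=
  (1 + k + k ^ 2) + ε * (1 + 7 / 2 * k - k * μ + 7 / 2 * k ^ 2 - k ^ 2 * μ + k ^ 3)
  + ε ^ 2 * ((1 + 9 / 2 * k - k * μ + 15 / 2 * k ^ 2 - 3 * k ^ 2 * μ + 9 / 2 * k ^ 3 - k ^ 3 * μ
      + k ^ 4)
    + ε * (3 * k + 8 * k ^ 2 - 2 * k ^ 2 * μ + 8 * k ^ 3 - 2 * k ^ 3 * μ + 3 * k ^ 4)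
    + ε ^ 2 * (4 * k ^ 2 + 15 / 2 * k ^ 3 - k ^ 3 * μ + 4 * k ^ 4)
    + ε ^ 3 * (3 * k ^ 3 + 3 * k ^ 4) + ε ^ 4 * k ^ 4)

theorem affF_node (μ ε k : ℂ) : affF μ (1 + ε) (1 + ε * k) = ε ^ 2 * nodeF μ ε k := by
  simp only [affF, G, H, nodeF]; ring

/-- A point of `E₁₂` records the limit of the slope `(τ - 1)/(σ - 1)`, namely `z₄ / z₅`. The slope
is thus a coordinate on the blow-up, in which the chosen branch is a graph over `ε`. -/
theorem isBranch_node {μ κ : ℂ} {P : P5} (hP : Represents P (excVec 0 1 κ)) (hκ : κ ≠ 0)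
    {q : ℂ → ℂ} (hq : ContinuousAt q 0) (hq0 : q 0 = κ)
    (hiff : ∀ᶠ p in 𝓝 ((0 : ℂ), κ), nodeF μ p.1 p.2 = 0 ↔ q p.1 = p.2) :
    IsBranch μ P (fun e => 1 + e ^ 5) (fun e => 1 + e ^ 5 * q (e ^ 5)) := by
  have hpow := tendsto_pow_five.mono_right (nhdsWithin_le_nhds (s := {0}ᶜ) (a := (0 : ℂ)))
  have hq' : Tendsto (fun e : ℂ => q (e ^ 5)) (𝓝[≠] 0) (𝓝 κ) := hq0 ▸ hq.tendsto.comp hpow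
  have hp := hpow.prodMk_nhds hq'
  constructor
  · apply eventually_H_ne_zero
    filter_upwards [hp.eventually hiff] with e he
    rw [affF_node, he.2 rfl, mul_zero]
  -- All six coordinates of `Ψ` are divisible by `ε = e⁵` on this branch.
  · refine ⟨fun e => (e ^ 5)⁻¹, _, hP, ?_⟩
    have hc : Continuous fun p : ℂ × ℂ => (![2 + 2 * p.2 + p.1 * (1 + 4 * p.2 + p.2 ^ 2)
        + p.1 ^ 2 * (2 * p.2 + 2 * p.2 ^ 2) + p.1 ^ 3 * p.2 ^ 2,
        1 + 2 * p.2 + p.1 * (2 * p.2 + p.2 ^ 2) + p.1 ^ 2 * p.2 ^ 2,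
        2 + p.2 + p.1 * (2 * p.2 + 1) + p.1 ^ 2 * p.2, 1 + p.2 + p.1 * p.2, p.2, 1] :
        Fin 6 → ℂ) := by
      refine continuous_pi fun i => ?_
      fin_cases i <;> simp <;> fun_prop
    have := (hc.tendsto (0, κ)).comp hp
    have h2 : excVec 0 1 κ = ![2 + 2 * κ, 1 + 2 * κ, 2 + κ, 1 + κ, κ, 1] := by simp [excVec]
    rw [h2]
    simp only [zero_mul, add_zero, ne_eq, OfNat.ofNat_ne_zero, not_false_eq_true, zero_pow] at this
    refine this.congr' ?_
    filter_upwards [self_mem_nhdsWithin] with e he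
    have he : e ≠ 0 := he
    ext i
    fin_cases i <;> simp [psiVec] <;> field_simp <;> ring
  · intro s t lam z hz hlim hcurve
    obtain ⟨a, ha, rfl⟩ := hP.smul_eq hz
    have hst := (tendsto_div_of_smul (f := s) hlim 3 5 4 (by simp [excVec, ha, hκ])
        (fun n => by simp [psiVec]; ring)).1
    have hs0 : Tendsto (fun n => s n - 1) atTop (𝓝 0) := by
      have h1 : (((a • excVec 0 1 κ) 3 - (a • excVec 0 1 κ) 5) / (a • excVec 0 1 κ) 4) = 1 := by
        simp [excVec]; field_simp; ring
      rw [h1] at hst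
      simpa using hst.sub_const 1
    have hs5 : ∀ᶠ n in atTop, s n - 1 ≠ 0 := by
      have := (tendsto_div_of_smul (f := t) hlim 3 4 5 (by simp [excVec, ha])
        (fun n => by simp [psiVec]; ring)).2
      simpa [psiVec] using this
    have hkt : Tendsto (fun n => (t n - 1) / (s n - 1)) atTop (𝓝 κ) := by
      have hi := tendsto_pi_nhds.1 hlim
      have h5 : (a • excVec 0 1 κ) 5 ≠ 0 := by simp [excVec, ha]
      have h1 := (hi 4).div (hi 5) h5
      have h2 : (a • excVec 0 1 κ) 4 / (a • excVec 0 1 κ) 5 = κ := by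
        simp [excVec]; field_simp
      rw [h2] at h1
      refine h1.congr' ?_
      filter_upwards [hs5, (hi 5).eventually_ne h5] with n hn hn5
      simp [psiVec] at hn5 ⊢
      have := hn5.1
      field_simp
    have hev := (hs0.prodMk_nhds hkt).eventually hiff
    have hev' : ∀ᶠ n in atTop, q (s n - 1) = (t n - 1) / (s n - 1) := by
      filter_upwards [hev, hs5] with n hn hn5
      refine hn.1 ?_
      have h1 := affF_node μ (s n - 1) ((t n - 1) / (s n - 1))
      rw [mul_div_cancel₀ _ hn5, add_sub_cancel, add_sub_cancel, (hcurve n).1] at h1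
      exact (mul_eq_zero.1 h1.symm).resolve_left (pow_ne_zero 2 hn5)
    obtain ⟨e, he, he5⟩ := exists_fifth_root_seq (tendsto_nhdsWithin_iff.2 ⟨hs0, hs5⟩)
    refine ⟨e, he, ?_⟩
    filter_upwards [hev', hs5] with n hn hn5
    simp only [he5]
    refine ⟨by ring, ?_⟩
    rw [hn]; field_simp; ring

/-! ### The equation for the parameter of a van Geemen line -/

theorem gamma5_neg (ω μ : ℂ) (hω : ω ^ 3 = 1) : gamma5 ω (-μ) = gamma5 (ω ^ 2) μ := by
  unfold gamma5; linear_combination (-ω * μ / 27) * hω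

theorem sq_sub_sq {ω : ℂ} (h : ω ^ 2 + ω + 1 = 0) : (ω - ω ^ 2) ^ 2 = -3 := by
  linear_combination (ω ^ 2 - 3 * ω + 3) * h

/-- As a quadratic in `γ⁵`, the equation has root sum `1/9` and root product `(2/(3ψ))⁵ = (φ² +
3/4)/243`; the two values of `gamma5` match both because `(ω - ω²)² = -3`. -/
theorem gammaEq_iff {ψ φ ω γ : ℂ} (hψ : ψ ≠ 0) (hφ : φ ^ 2 = 32 / ψ ^ 5 - 3 / 4)
    (hω : ω ^ 2 + ω + 1 = 0) :
    GammaEq ψ γ ↔ γ ^ 5 = gamma5 ω φ ∨ γ ^ 5 = gamma5 ω (-φ) := by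
  have h2 := sq_sub_sq hω
  have h32 : (2 / (3 * ψ)) ^ 5 = (φ ^ 2 + 3 / 4) / 243 := by
    rw [hφ]; field_simp; ring
  have : γ ^ 10 - 1 / 9 * γ ^ 5 + (2 / (3 * ψ)) ^ 5
      = (γ ^ 5 - gamma5 ω φ) * (γ ^ 5 - gamma5 ω (-φ)) := by
    rw [h32]; unfold gamma5; linear_combination (φ ^ 2 / 729) * h2
  rw [GammaEq, this, mul_eq_zero, sub_eq_zero, sub_eq_zero]

/-- The relations between the parameters of a van Geemen line. -/
structure IsRowData (ψ μ ω γ b c : ℂ) : Prop where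
  root : ω ^ 2 + ω + 1 = 0
  mu_eq : μ = -((ω - ω ^ 2) * (1 / 2 - 9 * γ ^ 5))
  gamma_ne : γ ≠ 0
  gamma_eq : 27 * ψ ^ 5 * γ ^ 5 * (1 - 9 * γ ^ 5) = 32
  b_ne : b ≠ 0
  c_ne : c ≠ 0
  b_pow : b ^ 5 * (1 - 9 * γ ^ 5) = 9 * γ ^ 5
  c_pow : c ^ 5 * (1 - ω) * (1 - 9 * γ ^ 5) = -1
  c_sq : 2 * c ^ 2 = -ω * ψ * b

/-- The equation for `γ`, in the form `27 ψ⁵ γ⁵ (1 - 9γ⁵) = 32`, eliminates `ψ⁵` and expresses `b⁵`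
and `c⁵` through `ω` and `γ⁵`. These values are what the limits of the coefficients have to match in
the table. -/
theorem isRowData {ψ μ ω γ : ℂ} (hψ : ψ ≠ 0) (hμ : μ ^ 2 = 32 / ψ ^ 5 - 3 / 4)
    (hω : IsPrimitiveRoot ω 3) (hγ : γ ^ 5 = gamma5 ω μ) :
    IsRowData ψ μ ω γ (coefB ψ γ) (coefC ω ψ γ) := by
  have h := cube_root_sum hω
  have h1 : ω ≠ 1 := hω.ne_one (by norm_num)
  have h2 := sq_sub_sq h
  have hg : 27 * ψ ^ 5 * γ ^ 5 * (1 - 9 * γ ^ 5) = 32 := by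
    have : 32 = (μ ^ 2 + 3 / 4) * ψ ^ 5 := by rw [hμ]; field_simp; ring
    rw [this, hγ, gamma5]
    linear_combination (-ψ ^ 5 * μ ^ 2 / 3) * h2
  have hγ0 : γ ≠ 0 := by rintro rfl; norm_num at hg
  have hg' : 1 - 9 * γ ^ 5 ≠ 0 := by intro h; rw [h] at hg; norm_num at hg
  have e1 : (1 - ω) ^ 2 = -3 * ω := by linear_combination h
  have h3 : ω ^ 3 = 1 := hω.pow_eq_one
  refine ⟨h, ?_, hγ0, hg, ?_, ?_, ?_, ?_, ?_⟩
  · rw [hγ, gamma5]; linear_combination (μ / 3) * h2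
  · simp [coefB, hψ, hγ0]
  · simp [coefC, hψ, hγ0, sub_ne_zero.2 h1.symm]
  · unfold coefB; linear_combination (9 / 32 * γ ^ 5) * hg
  · have e2 : (1 - ω) ^ 6 = -27 := by
      rw [show (1 - ω) ^ 6 = ((1 - ω) ^ 2) ^ 3 by ring, e1]; linear_combination (-27) * h3
    unfold coefC
    linear_combination (1 / 32 * ψ ^ 5 * γ ^ 5 * (1 - 9 * γ ^ 5)) * e2 - 1 / 32 * hg
  · unfold coefB coefC; linear_combination (1 / 2 * ψ ^ 2 * γ ^ 2) * e1

/-- The points of a van Geemen line. -/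
noncomputable def vgVec (ω b c u v : ℂ) : Fin 5 → ℂ :=
  ![u, v, b * u, c * u + ω * v, -ω ^ 2 * (c * u - v)]

theorem IsRowData.one_sub_ne {ψ μ ω γ b c : ℂ} (h : IsRowData ψ μ ω γ b c) :
    1 - 9 * γ ^ 5 ≠ 0 := by
  intro h0
  have := h.gamma_eq
  rw [h0] at this
  norm_num at this

/-- The coefficient of `v⁵` is `1 + ω + ω²`, that of `u⁵` is `1 + b⁵ + (1 - ω)c⁵`, and the mixed
terms are multiples of `2c² + ωψb`. -/
theorem IsRowData.dworkQuintic_vgVec {ψ μ ω γ b c : ℂ} (h : IsRowData ψ μ ω γ b c) (u v : ℂ) :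
    dworkQuintic ψ (vgVec ω b c u v) = 0 := by
  have hw := h.root
  have h3 : ω ^ 3 = 1 := by linear_combination (ω - 1) * hw
  have h1 : 1 + b ^ 5 + (1 - ω) * c ^ 5 = 0 := by
    have : (1 - 9 * γ ^ 5) * (1 + b ^ 5 + (1 - ω) * c ^ 5) = 0 := by
      linear_combination h.b_pow + h.c_pow
    exact (mul_eq_zero.1 this).resolve_left h.one_sub_ne
  have h2 := h.c_sq
  have e : ω * (2 * c ^ 2 + ω * ψ * b) = 0 := by linear_combination ω * h2
  have e1 : ω ^ 10 = ω := by linear_combination (ω * (ω ^ 6 + ω ^ 3 + 1)) * h3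
  have e2 : ω ^ 5 = ω ^ 2 := by linear_combination (ω ^ 2) * h3
  have key : dworkQuintic ψ (vgVec ω b c u v) = u ^ 5 + v ^ 5 + b ^ 5 * u ^ 5 + (c * u + ω * v) ^ 5
      - ω ^ 10 * (c * u - v) ^ 5
      + 5 * ψ * (u * v * (b * u) * (c * u + ω * v) * ω ^ 2 * (c * u - v)) := by
    simp [dworkQuintic, vgVec, Fin.sum_univ_five, Fin.prod_univ_five]; ring
  rw [key, e1]
  grind

theorem IsRowData.exists_prod_ne_zero {ψ μ ω γ b c : ℂ} (h : IsRowData ψ μ ω γ b c) :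
    ∃ u v, ∏ i, vgVec ω b c u v i ≠ 0 := by
  have hω : ω ≠ 0 := by rintro rfl; simpa using h.root
  obtain ⟨v, hv⟩ := Infinite.exists_notMem_finset ({0, -c / ω, c} : Finset ℂ)
  simp only [Finset.mem_insert, Finset.mem_singleton, not_or] at hv
  obtain ⟨h1, h2, h3⟩ := hv
  refine ⟨1, v, Finset.prod_ne_zero_iff.2 fun i _ => ?_⟩
  fin_cases i <;> simp [vgVec, h1, h.b_ne, hω]
  · exact fun h => h2 (by field_simp; linear_combination h)
  · exact fun h => h3 (by linear_combination -h)

/-- The line `(u, v, b u, c u + ω v, -ω² (c u - v))`. -/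
noncomputable def vgLine (ω b c : ℂ) : Submodule ℂ (Fin 5 → ℂ) :=
  Submodule.span ℂ {vgVec ω b c 1 0, vgVec ω b c 0 1}

theorem permLine_vgLine (π : Equiv.Perm (Fin 5)) (ω b c : ℂ) :
    permLine π (vgLine ω b c)
      = Submodule.span ℂ {vgVec ω b c 1 0 ∘ π, vgVec ω b c 0 1 ∘ π} := by
  rw [permLine, vgLine, Submodule.map_span, Set.image_pair]
  rfl

theorem linearIndependent_vgVec (π : Equiv.Perm (Fin 5)) (ω b c : ℂ) :
    LinearIndependent ℂ ![vgVec ω b c 1 0 ∘ π, vgVec ω b c 0 1 ∘ π] := by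
  rw [LinearIndependent.pair_iff]
  intro s t h
  have h0 := congrFun h (π.symm 0)
  have h1 := congrFun h (π.symm 1)
  simpa [vgVec] using And.intro h0 h1

/-! ### Limits of the family at the base points -/

/-- The mechanism common to all rows. The `i`-th coefficient has fifth power `ε^(N i) A i` with `A i
→ v i ^ 5 ≠ 0`, so with `ε = e⁵` one may take `D i = e^(N i) ρ i`, `ρ i → v i`. The same power `e^(N
i)` clears the pole of the `i`-th form after the substitution for `(u, v)`, leaving a continuous
`M`. The coordinate tends to `v i * M i`, and the product condition follows from the limit lying in
`M_ψ`. -/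
theorem limitingProcess_of {ψ μ ω γ b c : ℂ} (hψ : ψ ≠ 0) (hμ : μ ^ 2 = 32 / ψ ^ 5 - 3 / 4)
    (h : IsRowData ψ μ ω γ b c) (π : Equiv.Perm (Fin 5)) {P : Fin 6 → ℂ} {Q : P5}
    (hQ : Q ∈ basePoints) (hP : Represents Q P) {s₀ t₀ t₁ t₂ : ℂ} {n : ℕ}
    {uv : ℂ → ℂ → ℂ → ℂ × ℂ} {row : ℂ → ℂ → Fin 5 → ℂ} {T : ℂ → ℂ → ℂ} {k : ℂ → ℂ} {k₀ : ℂ}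
    (hk : ContinuousAt k 0) (hk₀ : k 0 = k₀) (hτ : AnalyticAt ℂ (fun ε => T ε (k ε)) 0)
    (hmem : ∀ᶠ ε in 𝓝 (0 : ℂ), affF μ (s₀ + ε) (T ε (k ε)) = 0)
    (hO : (fun ε => T ε (k ε) - (t₀ + t₁ * ε + t₂ * ε ^ 2)) =O[𝓝 (0 : ℂ)] fun ε => ε ^ n)
    (hb : IsBranch μ Q (fun e => s₀ + e ^ 5) (fun e => T (e ^ 5) (k (e ^ 5))))
    (N : Fin 5 → ℕ) (A : ℂ × ℂ → Fin 5 → ℂ) (hA : Continuous A) (v : Fin 5 → ℂ)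
    (hv : ∀ i, v i ≠ 0) (hAv : ∀ i, A (0, k₀) i = v i ^ 5)
    (hcoef : ∀ ε κ i, coef5 (s₀ + ε) (T ε κ) i = ε ^ N i * A (ε, κ) i)
    (M : ℂ → ℂ → ℂ × ℂ → Fin 5 → ℂ) (hM : ∀ x y, Continuous (M x y))
    (hell : ∀ e κ x y i, e ≠ 0 → e ^ N i * ell (s₀ + e ^ 5) (T (e ^ 5) κ) (uv e x y).1
      (uv e x y).2 i = M x y (e ^ 5, κ) i)
    (hrow : ∀ x y, row x y = vgVec ω b c x y ∘ π)
    (hMrow : ∀ x y i, v i * M x y (0, k₀) i = row x y i) :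
    LimitingProcess ψ μ P s₀ t₀ t₁ t₂ n uv row := by
  have hpow := tendsto_pow_five.mono_right (nhdsWithin_le_nhds (s := {0}ᶜ) (a := (0 : ℂ)))
  have hkp : Tendsto (fun e : ℂ => (e ^ 5, k (e ^ 5))) (𝓝[≠] 0) (𝓝 (0, k₀)) :=
    hpow.prodMk_nhds (hk₀ ▸ hk.tendsto.comp hpow)
  have hroot : ∀ i, ∃ ρ : ℂ → ℂ, (∀ e, ρ e ^ 5 = A (e ^ 5, k (e ^ 5)) i) ∧
      Tendsto ρ (𝓝[≠] 0) (𝓝 (v i)) := fun i => by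
    refine exists_root_tendsto (hv i) ?_
    rw [← hAv]
    exact (tendsto_pi_nhds.1 (hA.tendsto (0, k₀)) i).comp hkp
  choose ρ hρ hρv using hroot
  set D : ℂ → Fin 5 → ℂ := fun e i => e ^ N i * ρ i e with hDdef
  have hD : ∀ e i, D e i ^ 5 = coef5 (s₀ + e ^ 5) (T (e ^ 5) (k (e ^ 5))) i := fun e i => by
    rw [hcoef, ← hρ]; simp only [hDdef]; ring
  have hlim : ∀ x y, Tendsto (fun e => D e * ell (s₀ + e ^ 5) (T (e ^ 5) (k (e ^ 5)))
      (uv e x y).1 (uv e x y).2) (𝓝[≠] 0) (𝓝 (row x y)) := fun x y => by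
    rw [tendsto_pi_nhds]
    intro i
    rw [← hMrow]
    have h1 := (hρv i).mul ((tendsto_pi_nhds.1 ((hM x y).tendsto (0, k₀)) i).comp hkp)
    refine h1.congr' ?_
    filter_upwards [self_mem_nhdsWithin] with e he
    simp only [Function.comp_apply, ← hell e _ x y i he, hDdef, Pi.mul_apply]
    ring
  have hLI : LinearIndependent ℂ ![row 1 0, row 0 1] := by
    rw [hrow, hrow]; exact linearIndependent_vgVec π ω b c
  have hgood := eventually_prod_eq hψ hμ hb.mem (Eventually.of_forall hD) hlim (by
    obtain ⟨x, y, hxy⟩ := h.exists_prod_ne_zero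
    refine ⟨x, y, ?_, ?_⟩
    · rw [hrow, dworkQuintic]
      simp only [Function.comp_apply]
      rw [Equiv.sum_comp π fun i => vgVec ω b c x y i ^ 5, Equiv.prod_comp π (vgVec ω b c x y)]
      exact h.dworkQuintic_vgVec x y
    · rw [hrow]
      simp only [Function.comp_apply]
      rwa [Equiv.prod_comp π (vgVec ω b c x y)])
  have hlines := limitLines_eq_gOrbit hψ hμ hb hgood hlim hLI
  have hr : ∀ e, ∃ r : FifthRoots, e ≠ 0 → H (s₀ + e ^ 5) (T (e ^ 5) (k (e ^ 5))) ≠ 0 →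
      r.IsAt (s₀ + e ^ 5) (T (e ^ 5) (k (e ^ 5))) ∧ r.coef = D e := fun e => by
    by_cases hH : H (s₀ + e ^ 5) (T (e ^ 5) (k (e ^ 5))) = 0
    · exact ⟨⟨0, 0, 0, 0, 0, 0, 0⟩, fun _ h => (h hH).elim⟩
    · obtain ⟨hσ, hτ, -, -, -⟩ := H_ne_zero hH
      obtain ⟨r, hr⟩ := exists_fifthRoots hσ hτ (hD e)
      exact ⟨r, fun _ _ => hr⟩
  choose r hr using hr
  refine ⟨⟨fun ε => T ε (k ε), hτ, hmem, hO, r, ?_, fun x y => ?_⟩, Q, hQ, hP, hlines⟩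
  · filter_upwards [self_mem_nhdsWithin, hb.mem, hgood] with e he h1 h2
    obtain ⟨h3, h4⟩ := hr e he h1.2
    refine ⟨h3, ?_⟩
    rw [famLine_eq, h4]
    exact (isDworkLine_iff hψ hμ h1.1 h1.2 h2.1).2 h2.2
  · refine (hlim x y).congr' ?_
    filter_upwards [self_mem_nhdsWithin, hb.mem] with e he h1
    rw [famPoint_eq, (hr e he h1.2).2]

/-- Here `τ = t₀ + ε κ`, where `κ` stands for the divided difference of the implicit function, with
value `t₁` at `0` by implicit differentiation. -/
theorem limitingProcess_regular {ψ μ ω γ b c : ℂ} (hψ : ψ ≠ 0) (hμ : μ ^ 2 = 32 / ψ ^ 5 - 3 / 4)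
    (h : IsRowData ψ μ ω γ b c) (π : Equiv.Perm (Fin 5)) {Q : P5} {s₀ t₀ t₁ : ℂ}
    (hQ : Q ∈ basePoints) (hP : Represents Q (psiVec s₀ t₀)) (hH : H s₀ t₀ = 0)
    (hF : affF μ s₀ t₀ = 0) (h4 : t₀ ≠ 1) (h3 : s₀ ≠ 1 ∨ s₀ * t₀ ≠ 1)
    (hB : dF μ t₀ s₀ ≠ 0) (hA0 : dF μ s₀ t₀ + t₁ * dF μ t₀ s₀ = 0)
    {uv : ℂ → ℂ → ℂ → ℂ × ℂ} {row : ℂ → ℂ → Fin 5 → ℂ}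
    (N : Fin 5 → ℕ) (A : ℂ × ℂ → Fin 5 → ℂ) (hA : Continuous A) (v : Fin 5 → ℂ)
    (hv : ∀ i, v i ≠ 0) (hAv : ∀ i, A (0, t₁) i = v i ^ 5)
    (hcoef : ∀ ε κ i, coef5 (s₀ + ε) (t₀ + ε * κ) i = ε ^ N i * A (ε, κ) i)
    (M : ℂ → ℂ → ℂ × ℂ → Fin 5 → ℂ) (hM : ∀ x y, Continuous (M x y))
    (hell : ∀ e κ x y i, e ≠ 0 → e ^ N i * ell (s₀ + e ^ 5) (t₀ + e ^ 5 * κ) (uv e x y).1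
      (uv e x y).2 i = M x y (e ^ 5, κ) i)
    (hrow : ∀ x y, row x y = vgVec ω b c x y ∘ π)
    (hMrow : ∀ x y i, v i * M x y (0, t₁) i = row x y i) :
    LimitingProcess ψ μ (psiVec s₀ t₀) s₀ t₀ t₁ 0 2 uv row := by
  have hc : ContDiff ℂ ⊤ fun p : ℂ × ℂ => affF μ (s₀ + p.1) p.2 := by
    unfold affF G H; fun_prop
  obtain ⟨q, hqa, hq0, hqd, hiff⟩ := exists_implicit (F := fun p => affF μ (s₀ + p.1) p.2)
    hc (y₀ := t₀) (A := dF μ s₀ t₀) (B := dF μ t₀ s₀) (by simpa using hF)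
    (by
      have := hasDerivAt_affF μ (s₀ + 0) t₀
      have := this.comp_const_add s₀ 0
      simpa using this)
    (by simpa using hasDerivAt_affF_right μ s₀ t₀) hB
  have hd : -dF μ s₀ t₀ / dF μ t₀ s₀ = t₁ := by
    rw [div_eq_iff hB]; linear_combination -hA0
  rw [hd] at hqd
  obtain ⟨k, hk, hk0, hqk, hkO⟩ := analytic_expansion hqa hqd
  have hq : q = fun ε => t₀ + ε * k ε := by
    funext ε; rw [hqk, hq0]
  have hqc := hqa.continuousAt
  have hmem : ∀ᶠ ε in 𝓝 (0 : ℂ), affF μ (s₀ + ε) (q ε) = 0 := by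
    have : Tendsto (fun ε => (ε, q ε)) (𝓝 0) (𝓝 ((0 : ℂ), t₀)) := by
      have := (tendsto_id (x := 𝓝 (0 : ℂ))).prodMk_nhds hqc.tendsto
      rwa [hq0] at this
    filter_upwards [this.eventually hiff] with ε hε
    exact hε.2 rfl
  have hb := isBranch_regular hP hH h4 h3 hqc hq0 hiff
  rw [hq] at hqa hmem hb
  refine limitingProcess_of (T := fun ε κ => t₀ + ε * κ) hψ hμ h π hQ hP hk hk0 hqa hmem ?_ hb
    N A hA v hv hAv hcoef M hM hell hrow hMrow
  have := (isBigO_refl (fun x : ℂ => x) (𝓝 0)).mul hkO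
  refine this.congr (fun x => by ring) (fun x => by ring)

/-- The implicit function is now the slope, so `τ = 1 + ε(κ + ε k)`: the tangent `κ` is a root of
the quadratic part of the node, and the derivative of the slope enters only in order `ε²`. -/
theorem limitingProcess_node {ψ μ ω γ b c : ℂ} (hψ : ψ ≠ 0) (hμ : μ ^ 2 = 32 / ψ ^ 5 - 3 / 4)
    (h : IsRowData ψ μ ω γ b c) (π : Equiv.Perm (Fin 5)) {Q : P5} {κ k₀ : ℂ}
    (hQ : Q ∈ basePoints) (hP : Represents Q (excVec 0 1 κ)) (hκ : κ ^ 2 + κ + 1 = 0)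
    (hk₀ : (1 + 7 / 2 * κ - κ * μ + 7 / 2 * κ ^ 2 - κ ^ 2 * μ + κ ^ 3) + k₀ * (1 + 2 * κ) = 0)
    {uv : ℂ → ℂ → ℂ → ℂ × ℂ} {row : ℂ → ℂ → Fin 5 → ℂ}
    (N : Fin 5 → ℕ) (A : ℂ × ℂ → Fin 5 → ℂ) (hA : Continuous A) (v : Fin 5 → ℂ)
    (hv : ∀ i, v i ≠ 0) (hAv : ∀ i, A (0, k₀) i = v i ^ 5)
    (hcoef : ∀ ε k i, coef5 (1 + ε) (1 + ε * (κ + ε * k)) i = ε ^ N i * A (ε, k) i)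
    (M : ℂ → ℂ → ℂ × ℂ → Fin 5 → ℂ) (hM : ∀ x y, Continuous (M x y))
    (hell : ∀ e k x y i, e ≠ 0 → e ^ N i * ell (1 + e ^ 5) (1 + e ^ 5 * (κ + e ^ 5 * k))
      (uv e x y).1 (uv e x y).2 i = M x y (e ^ 5, k) i)
    (hrow : ∀ x y, row x y = vgVec ω b c x y ∘ π)
    (hMrow : ∀ x y i, v i * M x y (0, k₀) i = row x y i) :
    LimitingProcess ψ μ (excVec 0 1 κ) 1 1 κ k₀ 3 uv row := by
  have hc : ContDiff ℂ ⊤ fun p : ℂ × ℂ => nodeF μ p.1 p.2 := by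
    unfold nodeF; fun_prop
  have hB : 1 + 2 * κ ≠ 0 := by
    intro h0
    have : (1 + 2 * κ) ^ 2 = -3 := by linear_combination 4 * hκ
    rw [h0] at this; norm_num at this
  have hκ0 : κ ≠ 0 := by rintro rfl; simp at hκ
  obtain ⟨q, hqa, hq0, hqd, hiff⟩ := exists_implicit (F := fun p => nodeF μ p.1 p.2)
    hc (y₀ := κ) (A := 1 + 7 / 2 * κ - κ * μ + 7 / 2 * κ ^ 2 - κ ^ 2 * μ + κ ^ 3)
    (B := 1 + 2 * κ) (by simp [nodeF]; linear_combination hκ)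
    (by
      have h1 := (hasDerivAt_id (0 : ℂ)).mul_const
        (1 + 7 / 2 * κ - κ * μ + 7 / 2 * κ ^ 2 - κ ^ 2 * μ + κ ^ 3)
      have h2 : DifferentiableAt ℂ (fun ε : ℂ => ((1 + 9 / 2 * κ - κ * μ + 15 / 2 * κ ^ 2
          - 3 * κ ^ 2 * μ + 9 / 2 * κ ^ 3 - κ ^ 3 * μ + κ ^ 4)
          + ε * (3 * κ + 8 * κ ^ 2 - 2 * κ ^ 2 * μ + 8 * κ ^ 3 - 2 * κ ^ 3 * μ + 3 * κ ^ 4)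
          + ε ^ 2 * (4 * κ ^ 2 + 15 / 2 * κ ^ 3 - κ ^ 3 * μ + 4 * κ ^ 4)
          + ε ^ 3 * (3 * κ ^ 3 + 3 * κ ^ 4) + ε ^ 4 * κ ^ 4)) 0 := by fun_prop
      have h3 := (hasDerivAt_pow 2 (0 : ℂ)).mul h2.hasDerivAt
      have h4 := ((hasDerivAt_const (0 : ℂ) (1 + κ + κ ^ 2)).add h1).add h3
      refine h4.congr_deriv ?_
      simp)
    (by
      have h1 := (hasDerivAt_quartic 1 1 1 0 0 κ).congr_deriv
        (show _ = 1 + 2 * κ by ring)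
      refine h1.congr_of_eventuallyEq (Eventually.of_forall fun x => ?_)
      simp [nodeF]) hB
  have hd : -(1 + 7 / 2 * κ - κ * μ + 7 / 2 * κ ^ 2 - κ ^ 2 * μ + κ ^ 3) / (1 + 2 * κ) = k₀ := by
    rw [div_eq_iff hB]; linear_combination -hk₀
  rw [hd] at hqd
  obtain ⟨k, hk, hk0, hqk, hkO⟩ := analytic_expansion hqa hqd
  have hq : q = fun ε => κ + ε * k ε := by
    funext ε; rw [hqk, hq0]
  have hqc := hqa.continuousAt
  have hmem : ∀ᶠ ε in 𝓝 (0 : ℂ), affF μ (1 + ε) (1 + ε * q ε) = 0 := by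
    have : Tendsto (fun ε => (ε, q ε)) (𝓝 0) (𝓝 ((0 : ℂ), κ)) := by
      have := (tendsto_id (x := 𝓝 (0 : ℂ))).prodMk_nhds hqc.tendsto
      rwa [hq0] at this
    filter_upwards [this.eventually hiff] with ε hε
    rw [affF_node, hε.2 rfl, mul_zero]
  have hb := isBranch_node hP hκ0 hqc hq0 hiff
  have hτa : AnalyticAt ℂ (fun ε => 1 + ε * q ε) 0 :=
    analyticAt_const.add (analyticAt_id.mul hqa)
  rw [hq] at hτa hmem hb
  refine limitingProcess_of (T := fun ε k => 1 + ε * (κ + ε * k)) hψ hμ h π hQ hP hk hk0 hτa hmem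
    ?_ hb N A hA v hv hAv hcoef M hM hell hrow hMrow
  have := (isBigO_refl (fun x : ℂ => x ^ 2) (𝓝 0)).mul hkO
  refine this.congr (fun x => by ring) (fun x => by ring)

theorem represents_bp_excVec {w : ℂ} (hw : IsPrimitiveRoot w 3) {k : Fin 10} {a b : ℂ}
    (h : (excCoord k a b).1 = -w * (excCoord k a b).2) (h0 : (excCoord k a b).2 ≠ 0) :
    Represents (bp hw k) (excVec k a b) := by
  rw [excVec_eq_smul_bpVec h]
  exact (represents_bp hw k).of_smul h0

theorem represents_bp_three {w : ℂ} (hw : IsPrimitiveRoot w 3) :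
    Represents (bp hw 3) (psiVec 0 (-w)) := by
  have h : psiVec 0 (-w) = excVec 3 (-1) (-w - 1) := by simp [psiVec, excVec]
  rw [h]
  exact represents_bp_excVec hw (by simp [excCoord]; ring) (by simp [excCoord])

theorem represents_bp_nine {w : ℂ} (hw : IsPrimitiveRoot w 3) :
    Represents (bp hw 9) (psiVec 1 (-w)) := by
  have h : psiVec 1 (-w) = excVec 9 (w ^ 2 - 1) (-w - 1) := by simp [psiVec, excVec]
  rw [h]
  refine represents_bp_excVec hw (by simp [excCoord]; ring) ?_
  intro h0
  have h0 : -w - 1 = 0 := h0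
  exact pow_ne_zero 2 (hw.ne_zero (by norm_num)) (by linear_combination cube_root_sum hw + h0)

theorem represents_bp_eight {w : ℂ} (hw : IsPrimitiveRoot w 3) :
    Represents (bp hw 8) (psiVec (-w) (-w ^ 2)) := by
  have h3 := hw.pow_eq_one
  have hs := cube_root_sum hw
  have h : psiVec (-w) (-w ^ 2) = excVec 8 (w ^ 2) w := by
    ext i
    fin_cases i <;> simp [psiVec, excVec] <;> grind
  rw [h]
  refine represents_bp_excVec hw (by simp [excCoord]; ring) ?_
  simpa [excCoord] using hw.ne_zero (by norm_num)

theorem represents_bp_zero {w : ℂ} (hw : IsPrimitiveRoot w 3) :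
    Represents (bp hw 0) (excVec 0 1 w) :=
  represents_bp_excVec hw (by simp [excCoord]) (by simp [excCoord])

theorem primitive_ne_zero {w : ℂ} (hw : IsPrimitiveRoot w 3) : w ≠ 0 := hw.ne_zero (by norm_num)

/-- The permutation of the coordinates given by a list of values and that of the inverse. -/
def permOf (f g : Fin 5 → Fin 5) (h : Function.LeftInverse g f := by decide)
    (h' : Function.RightInverse g f := by decide) : Equiv.Perm (Fin 5) := ⟨f, g, h, h'⟩

theorem one_add_two_mul_ne {w : ℂ} (hw : IsPrimitiveRoot w 3) : 1 + 2 * w ≠ 0 := by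
  intro h0
  have : (1 + 2 * w) ^ 2 = -3 := by linear_combination 4 * cube_root_sum hw
  rw [h0] at this; norm_num at this

theorem neg_primitive_ne_one {w : ℂ} (hw : IsPrimitiveRoot w 3) : -w ≠ 1 := fun h =>
  (ne_facts hw).2.2.1 (by linear_combination -h)

theorem limitingProcess_zero_root {ψ μ ω γ b c : ℂ} (hψ : ψ ≠ 0)
    (hμ : μ ^ 2 = 32 / ψ ^ 5 - 3 / 4) (hω : IsPrimitiveRoot ω 3)
    (h : IsRowData ψ μ ω γ b c) :
    LimitingProcess ψ μ (psiVec 0 (-ω)) 0 (-ω) (9 * γ ^ 5) 0 2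
        (fun e u v => (c * u / e ^ 5, -v))
        (fun u v => ![u, v, -ω ^ 2 * (c * u - v), c * u + ω * v, b * u]) := by
  have hw := h.root
  have hb := h.b_pow
  have hc := h.c_pow
  have hc0 := h.c_ne
  have hb0 := h.b_ne
  have hm := h.mu_eq
  have hw0 := primitive_ne_zero hω
  have hg := h.one_sub_ne
  have h2w := one_add_two_mul_ne hω
  refine limitingProcess_regular hψ hμ h (permOf ![0, 1, 4, 3, 2] ![0, 1, 4, 3, 2])
    (bp_mem_basePoints hω 3) (represents_bp_three hω) (by simp [H])
    (by simp [affF, G, H]; linear_combination hw) (neg_primitive_ne_one hω) (by simp) ?_ ?_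
    -- The first and last coefficients contain `σ⁴` and one more simple zero, since `1 - τ + τ²`
    -- vanishes at `-ω`.
    ![5, 0, 0, 0, 5]
    (fun p => ![(1 - p.1) * (1 - (-ω + p.1 * p.2)) * (1 - p.1 * (-ω + p.1 * p.2))
        * (p.1 * p.2 ^ 2 - p.2 * (1 + 2 * ω) - (-ω + p.1 * p.2) * (1 + (-ω + p.1 * p.2))
          + p.1 * (-ω + p.1 * p.2) ^ 2),
      alpha5 (-ω + p.1 * p.2) p.1, -((-ω + p.1 * p.2) ^ 4 * beta5 p.1),
      beta5 (p.1 * (-ω + p.1 * p.2)),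
      -((1 - (-ω + p.1 * p.2)) * (p.1 * p.2 ^ 2 - p.2 * (1 + 2 * ω)))])
    -- At `ε = 0` the forms become `(cx, -y, cx - y, cx + ωy, cx)`; these roots turn them into the
    -- coordinates of the row.
    ?_ ![1 / c, -1, -ω ^ 2, 1, b / c] ?_ ?_ ?_
    (fun x y p => ![c * x, -y, c * x - y, c * x - (-ω + p.1 * p.2) * y,
      c * x - p.1 * (-ω + p.1 * p.2) * y]) ?_ ?_ ?_ ?_
  · simp only [dF]
    intro h0
    exact h2w (by linear_combination -h0)
  · simp only [dF, hm]
    grind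
  · refine continuous_pi fun i => ?_
    fin_cases i <;> simp [alpha5, beta5] <;> fun_prop
  · intro i
    fin_cases i <;> simp [hc0, hw0, hb0]
  · intro i
    fin_cases i <;> simp [alpha5, beta5, div_pow]
    · field_simp; grind
    · grind
    · grind
    · field_simp; grind
  · intro ε κ i
    fin_cases i
    · simp [coef5, alpha5]
      linear_combination (ε ^ 4 * (1 - ε) * (1 - (-ω + ε * κ)) * (1 - ε * (-ω + ε * κ))) * hw
    · simp [coef5]
    · simp [coef5]
    · simp [coef5]
    · simp [coef5, beta5]
      linear_combination (ε ^ 4 * (1 - (-ω + ε * κ))) * hw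
  · intro x y
    refine continuous_pi fun i => ?_
    fin_cases i <;> simp <;> fun_prop
  · intro e κ x y i he
    fin_cases i <;> simp [ell] <;> field_simp <;> ring
  · intro x y
    ext i
    fin_cases i <;> simp [vgVec, permOf]
  · intro x y i
    fin_cases i <;> simp <;> field_simp

theorem limitingProcess_one_root {ψ μ ω γ b c : ℂ} (hψ : ψ ≠ 0)
    (hμ : μ ^ 2 = 32 / ψ ^ 5 - 3 / 4) (hω : IsPrimitiveRoot ω 3)
    (h : IsRowData ψ μ ω γ b c) :
    LimitingProcess ψ μ (psiVec 1 (-ω)) 1 (-ω) (9 * ω * γ ^ 5) 0 2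
        (fun e u v => (-ω ^ 2 * v / e, -(c * u + ω * v) / e))
        (fun u v => ![v, c * u + ω * v, -ω ^ 2 * (c * u - v), u, b * u]) := by
  have hw := h.root
  have hb := h.b_pow
  have hc := h.c_pow
  have hc0 := h.c_ne
  have hb0 := h.b_ne
  have hm := h.mu_eq
  have hw0 := primitive_ne_zero hω
  have hg := h.one_sub_ne
  have h2w := one_add_two_mul_ne hω
  refine limitingProcess_regular hψ hμ h (permOf ![1, 3, 4, 0, 2] ![3, 0, 4, 1, 2])
    (bp_mem_basePoints hω 9) (represents_bp_nine hω) (by simp [H])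
    (by simp [affF, G, H]; linear_combination (ω ^ 2 + 2 * ω + 1) * hw) (neg_primitive_ne_one hω)
    (by simpa using neg_primitive_ne_one hω) ?_ ?_
    ![1, 1, 1, 1, 1]
    (fun p => ![-((1 + p.1) ^ 4 * (1 - (-ω + p.1 * p.2)) * (1 - (1 + p.1) * (-ω + p.1 * p.2)) * (1 - (-ω + p.1 * p.2) * (1 + (1 + p.1)) + (-ω + p.1 * p.2) ^ 2 * (1 - (1 + p.1) + (1 + p.1) ^ 2))),
      -((-ω + p.1 * p.2) ^ 4 * (1 - (-ω + p.1 * p.2)) * (1 - (1 + p.1) * (-ω + p.1 * p.2)) * (1 - (1 + p.1) * (1 + (-ω + p.1 * p.2)) + (1 + p.1) ^ 2 * (1 - (-ω + p.1 * p.2) + (-ω + p.1 * p.2) ^ 2))),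
      (-ω + p.1 * p.2) ^ 4 * (1 - (1 + p.1) + (1 + p.1) ^ 2),
      (1 - (1 + p.1) * (-ω + p.1 * p.2)) * (p.1 * (p.2 - ω + p.1 * p.2) ^ 2 - (p.2 - ω + p.1 * p.2) * (1 + 2 * ω)),
      -((1 + p.1) ^ 4 * (1 - (-ω + p.1 * p.2)) * (p.1 * p.2 ^ 2 - p.2 * (1 + 2 * ω)))])
    ?_ ![-ω, -1, ω ^ 2, ω ^ 2 / c, b * ω ^ 2 / c] ?_ ?_ ?_
    (fun x y p => ![-ω ^ 2 * y, -(c * x + ω * y), -((1 + p.1) * ω ^ 2 * y + (c * x + ω * y)),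
      -((1 + p.1) * ω ^ 2 * y + (-ω + p.1 * p.2) * (c * x + ω * y)),
      -(ω ^ 2 * y + (-ω + p.1 * p.2) * (c * x + ω * y))]) ?_ ?_ ?_ ?_
  · simp only [dF]
    intro h0
    exact (ne_facts hω).2.1 (by grind)
  · simp only [dF, hm]
    grind
  · refine continuous_pi fun i => ?_
    fin_cases i <;> simp <;> fun_prop
  · intro i
    fin_cases i <;> simp [hc0, hw0, hb0]
  · intro i
    fin_cases i <;> simp [div_pow]
    · grind
    · grind
    · grind
    · field_simp; grind
    · field_simp; grind
  · intro ε κ i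
    fin_cases i
    · simp [coef5, alpha5]; ring
    · simp [coef5, alpha5]; ring
    · simp [coef5, beta5]; ring
    · simp [coef5, beta5]
      linear_combination (1 - (1 + ε) * (-ω + ε * κ)) * hw
    · simp [coef5, beta5]
      linear_combination ((1 + ε) ^ 4 * (1 - (-ω + ε * κ))) * hw
  · intro x y
    refine continuous_pi fun i => ?_
    fin_cases i <;> simp <;> fun_prop
  · intro e κ x y i he
    fin_cases i <;> simp [ell] <;> field_simp <;> ring
  · intro x y
    ext i
    fin_cases i <;> simp [vgVec, permOf]
  · intro x y i
    fin_cases i <;> simp <;> field_simp <;> grind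

theorem dF_root (μ : ℂ) {w : ℂ} (h : w ^ 2 + w + 1 = 0) :
    dF μ (-w) (-w ^ 2) = (w - 1) / 2 + μ * w ^ 2 := by
  unfold dF; grind

theorem dF_root_sq (μ : ℂ) {w : ℂ} (h : w ^ 2 + w + 1 = 0) :
    dF μ (-w ^ 2) (-w) = (w ^ 2 - 1) / 2 + μ * w := by
  unfold dF; grind

theorem alpha5_of_eq {σ τ x : ℂ} (h : 1 - σ * τ = x) :
    alpha5 σ τ = σ ^ 4 * (1 - σ) * (1 - τ) * x
      * (1 - τ * (1 + σ) + τ ^ 2 * (1 - σ + σ ^ 2)) := by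
  rw [alpha5, h]

/-- All five coefficients have a simple zero in `ε`. Divided by `ε`, those with index `0`, `1`, `3`
tend to the same value `δ⁵`, which is the origin of `δ`. -/
theorem limitingProcess_root_root {ψ μ ω γ b c δ : ℂ} (hψ : ψ ≠ 0)
    (hμ : μ ^ 2 = 32 / ψ ^ 5 - 3 / 4) (hω : IsPrimitiveRoot ω 3)
    (h : IsRowData ψ μ ω γ b c) (hδ : δ ^ 5 = ω ^ 2 / (9 * γ ^ 5)) :
    LimitingProcess ψ μ (psiVec (-ω) (-ω ^ 2)) (-ω) (-ω ^ 2)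
          (ω * (2 / (3 * ψ)) ^ 5 / γ ^ 10) 0 2
          (fun e u v => ((c * u + ω * v) / (δ * e), -ω ^ 2 * (c * u - v) / (δ * e)))
          (fun u v => ![c * u + ω * v, -ω ^ 2 * (c * u - v), b * u, v, u]) := by
  have hw := h.root
  have hb := h.b_pow
  have hc := h.c_pow
  have hc0 := h.c_ne
  have hb0 := h.b_ne
  have hm := h.mu_eq
  have hw0 := primitive_ne_zero hω
  have hg := h.one_sub_ne
  have h2w := one_add_two_mul_ne hω
  have hγ := h.gamma_ne
  have h3 := hω.pow_eq_one
  have hδ0 : δ ≠ 0 := by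
    rintro rfl
    have : ω ^ 2 / (9 * γ ^ 5) ≠ 0 :=
      div_ne_zero (pow_ne_zero 2 hw0) (mul_ne_zero (by norm_num) (pow_ne_zero 5 hγ))
    exact this (by rw [← hδ]; simp)
  have hδ' : δ ^ 5 * (9 * γ ^ 5) = ω ^ 2 := by rw [hδ]; field_simp
  -- The equation for `γ` reads `(2/(3ψ))⁵ = γ⁵(1 - 9γ⁵)/9`; it removes `ψ` from the slope.
  have ht : ω * (2 / (3 * ψ)) ^ 5 / γ ^ 10 = ω * (1 - 9 * γ ^ 5) / (9 * γ ^ 5) := by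
    field_simp
    linear_combination (-9) * h.gamma_eq
  rw [ht]
  refine limitingProcess_regular hψ hμ h (permOf ![3, 4, 2, 1, 0] ![4, 3, 2, 0, 1])
    (bp_mem_basePoints hω 8) (represents_bp_eight hω) (by simp [H]; grind)
    (by simp only [affF, G, H]; grind) (neg_primitive_ne_one (primitive_sq hω))
    (Or.inl (neg_primitive_ne_one hω)) ?_ ?_
    ![1, 1, 1, 1, 1]
    (fun p => ![-((-ω + p.1) ^ 4 * (1 - (-ω + p.1)) * (1 - (-ω ^ 2 + p.1 * p.2)) * (-ω * p.2 - ω ^ 2 + p.1 * p.2) * (1 - (-ω ^ 2 + p.1 * p.2) * (1 + (-ω + p.1)) + (-ω ^ 2 + p.1 * p.2) ^ 2 * (1 - (-ω + p.1) + (-ω + p.1) ^ 2))),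
      -((-ω ^ 2 + p.1 * p.2) ^ 4 * (1 - (-ω + p.1)) * (1 - (-ω ^ 2 + p.1 * p.2)) * (-ω * p.2 - ω ^ 2 + p.1 * p.2) * (1 - (-ω + p.1) * (1 + (-ω ^ 2 + p.1 * p.2)) + (-ω + p.1) ^ 2 * (1 - (-ω ^ 2 + p.1 * p.2) + (-ω ^ 2 + p.1 * p.2) ^ 2))),
      -((-ω ^ 2 + p.1 * p.2) ^ 4 * (1 - (-ω + p.1)) * (p.1 - (1 + 2 * ω))),
      -((-ω * p.2 - ω ^ 2 + p.1 * p.2) * (1 - (-ω + p.1) * (-ω ^ 2 + p.1 * p.2) + ((-ω + p.1) * (-ω ^ 2 + p.1 * p.2)) ^ 2)),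
      -((-ω + p.1) ^ 4 * (1 - (-ω ^ 2 + p.1 * p.2)) * (p.1 * p.2 ^ 2 - p.2 * (1 + 2 * ω ^ 2)))])
    ?_ ![δ, δ, b * δ / c, δ, -ω * δ / c] ?_ ?_ ?_
    (fun x y p => ![(c * x + ω * y) / δ, -ω ^ 2 * (c * x - y) / δ,
      ((-ω + p.1) * (c * x + ω * y) - ω ^ 2 * (c * x - y)) / δ,
      ((-ω + p.1) * (c * x + ω * y) - (-ω ^ 2 + p.1 * p.2) * ω ^ 2 * (c * x - y)) / δ,
      ((c * x + ω * y) - (-ω ^ 2 + p.1 * p.2) * ω ^ 2 * (c * x - y)) / δ]) ?_ ?_ ?_ ?_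
  · rw [dF_root_sq μ hw, hm]
    intro h0
    have h9 : (ω ^ 2 - 1) * (9 * γ ^ 5) = 0 := by
      linear_combination h0 - (1 / 2 - 9 * γ ^ 5) * h3
    rcases mul_eq_zero.1 h9 with h9 | h9
    · exact (ne_facts hω).2.2.2.2.1 (by linear_combination h9)
    · exact mul_ne_zero (by norm_num) (pow_ne_zero 5 hγ) h9
  · have hγ5 : γ ^ 5 ≠ 0 := pow_ne_zero 5 hγ
    rw [dF_root μ hw, dF_root_sq μ hw, hm]
    generalize γ ^ 5 = g at hγ5
    clear hδ ht hμ hψ h hb hc hδ'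
    field_simp
    grind
  · refine continuous_pi fun i => ?_
    fin_cases i <;> simp <;> fun_prop
  · intro i
    fin_cases i <;> simp [hc0, hw0, hb0, hδ0]
  · intro i
    have hγ5 : γ ^ 5 ≠ 0 := pow_ne_zero 5 hγ
    fin_cases i <;> simp [div_pow]
    · field_simp; grind
    · field_simp; grind
    · field_simp; grind
    · field_simp; grind
    · field_simp; grind
  · intro ε κ i
    fin_cases i
    · change alpha5 (-ω + ε) (-ω ^ 2 + ε * κ) = ε ^ 1 * -((-ω + ε) ^ 4 * (1 - (-ω + ε)) * (1 - (-ω ^ 2 + ε * κ)) * (-ω * κ - ω ^ 2 + ε * κ) * (1 - (-ω ^ 2 + ε * κ) * (1 + (-ω + ε)) + (-ω ^ 2 + ε * κ) ^ 2 * (1 - (-ω + ε) + (-ω + ε) ^ 2)))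
      rw [alpha5_of_eq (x := -(ε * (-ω * κ - ω ^ 2 + ε * κ))) (by linear_combination -h3)]
      generalize -ω + ε = σ
      generalize -ω ^ 2 + ε * κ = τ
      ring
    · change alpha5 (-ω ^ 2 + ε * κ) (-ω + ε) = ε ^ 1 * -((-ω ^ 2 + ε * κ) ^ 4 * (1 - (-ω + ε)) * (1 - (-ω ^ 2 + ε * κ)) * (-ω * κ - ω ^ 2 + ε * κ) * (1 - (-ω + ε) * (1 + (-ω ^ 2 + ε * κ)) + (-ω + ε) ^ 2 * (1 - (-ω ^ 2 + ε * κ) + (-ω ^ 2 + ε * κ) ^ 2)))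
      rw [alpha5_of_eq (x := -(ε * (-ω * κ - ω ^ 2 + ε * κ))) (by linear_combination -h3)]
      -- Once `1 - στ` is written as a multiple of `ε`, the identity holds for independent `σ` and
      -- `τ`.
      generalize -ω + ε = σ
      generalize -ω ^ 2 + ε * κ = τ
      ring
    · simp [coef5, beta5]
      linear_combination ((-ω ^ 2 + ε * κ) ^ 4 * (1 - (-ω + ε))) * hw
    · simp [coef5, beta5]
      linear_combination (-(1 - (-ω + ε) * (-ω ^ 2 + ε * κ) + ((-ω + ε) * (-ω ^ 2 + ε * κ)) ^ 2)) * h3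
    · simp [coef5, beta5]
      linear_combination ((-ω + ε) ^ 4 * (1 - (-ω ^ 2 + ε * κ)) * (1 - ω + ω ^ 2)) * hw
  · intro x y
    refine continuous_pi fun i => ?_
    fin_cases i <;> simp <;> fun_prop
  · intro e κ x y i he
    fin_cases i <;> simp [ell] <;> field_simp <;> ring
  · intro x y
    ext i
    fin_cases i <;> simp [vgVec, permOf]
  · intro x y i
    fin_cases i <;> simp <;> field_simp <;> grind

/-- The last factor of `alpha5` has order three rather than two along a tangent with `1 + κ + κ² =
0`, so the first two coefficients have order six and `u`, `v` are of size `e⁻⁶`. These leading terms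
cancel to that order in the other three forms; the corrections of size `e⁻¹` supply the finite
limit. -/
theorem limitingProcess_node_sq {ψ μ ω γ b c : ℂ} (hψ : ψ ≠ 0)
    (hμ : μ ^ 2 = 32 / ψ ^ 5 - 3 / 4) (hω : IsPrimitiveRoot ω 3)
    (h : IsRowData ψ μ ω γ b c) :
    LimitingProcess ψ μ (excVec 0 1 (ω ^ 2)) 1 1 (ω ^ 2) (ω + 9 * γ ^ 5) 3
        (fun e u v => (ω * c * u / e ^ 6 - (ω * c * u - v) / (2 * e),
          -(ω * c * u) / e ^ 6 - (ω * c * u - v) / (2 * e)))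
        (fun u v => ![b * u, u, v, -ω ^ 2 * (c * u - v), c * u + ω * v]) := by
  have hw := h.root
  have hb := h.b_pow
  have hc := h.c_pow
  have hc0 := h.c_ne
  have hb0 := h.b_ne
  have hm := h.mu_eq
  have hw0 := primitive_ne_zero hω
  have hg := h.one_sub_ne
  have h2w := one_add_two_mul_ne hω
  have hw2 : ((ω ^ 2)) ^ 2 + (ω ^ 2) + 1 = 0 := cube_root_sum (primitive_sq hω)
  refine limitingProcess_node hψ hμ h (permOf ![2, 0, 1, 4, 3] ![1, 2, 0, 4, 3])
    (bp_mem_basePoints (primitive_sq hω) 0) (represents_bp_zero (primitive_sq hω)) hw2 ?_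
    ![6, 6, 1, 1, 1]
    (fun p => ![-((1 + p.1) ^ 4 * ((ω ^ 2) + p.1 * p.2) * (1 + ((ω ^ 2) + p.1 * p.2) + p.1 * ((ω ^ 2) + p.1 * p.2)) * (2 * (ω ^ 2) * p.2 + p.2 + p.1 * p.2 ^ 2 + ((ω ^ 2) + p.1 * p.2) ^ 2 + 2 * ((ω ^ 2) + p.1 * p.2) + p.1 * ((ω ^ 2) + p.1 * p.2) ^ 2)),
      -((1 + p.1 * ((ω ^ 2) + p.1 * p.2)) ^ 4 * ((ω ^ 2) + p.1 * p.2) * (1 + ((ω ^ 2) + p.1 * p.2) + p.1 * ((ω ^ 2) + p.1 * p.2)) * (2 * (ω ^ 2) * p.2 + p.2 + p.1 * p.2 ^ 2 + ((ω ^ 2) + p.1 * p.2) + 2 * ((ω ^ 2) + p.1 * p.2) ^ 2 + p.1 * ((ω ^ 2) + p.1 * p.2) ^ 2)),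
      (1 + p.1 * ((ω ^ 2) + p.1 * p.2)) ^ 4 * (1 - (1 + p.1) + (1 + p.1) ^ 2),
      -((1 + ((ω ^ 2) + p.1 * p.2) + p.1 * ((ω ^ 2) + p.1 * p.2)) * (1 - (1 + p.1) * (1 + p.1 * ((ω ^ 2) + p.1 * p.2)) + ((1 + p.1) * (1 + p.1 * ((ω ^ 2) + p.1 * p.2))) ^ 2)),
      (1 + p.1) ^ 4 * ((ω ^ 2) + p.1 * p.2) * (1 - (1 + p.1 * ((ω ^ 2) + p.1 * p.2)) + (1 + p.1 * ((ω ^ 2) + p.1 * p.2)) ^ 2)])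
    ?_ ![b * ω ^ 2 / c, -ω ^ 2 / c, 1, ω ^ 2, ω] ?_ ?_ ?_
    (fun x y p => ![ω * c * x - p.1 * (ω * c * x - y) / 2, -(ω * c * x) - p.1 * (ω * c * x - y) / 2,
      y - p.1 * (ω * c * x - y) / 2,
      y - p.1 * (ω * c * x - y) / 2 + (ω ^ 2 + p.1 * p.2) * (-(ω * c * x) - p.1 * (ω * c * x - y) / 2),
      -(ω * c * x - y) + (ω ^ 2 + p.1 * p.2) * (-(ω * c * x) - p.1 * (ω * c * x - y) / 2)]) ?_ ?_ ?_ ?_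
  · simp only [hm]
    grind
  · refine continuous_pi fun i => ?_
    fin_cases i <;> simp <;> fun_prop
  · intro i
    fin_cases i <;> simp [hc0, hw0, hb0]
  · intro i
    fin_cases i <;> simp [div_pow]
    · field_simp; grind
    · field_simp; grind
    · grind
    · grind
  · intro ε κ i
    fin_cases i
    · simp [coef5, alpha5]
      linear_combination (-((1 + ε) ^ 4 * ((ω ^ 2) + ε * κ) * (1 + ((ω ^ 2) + ε * κ) + ε * ((ω ^ 2) + ε * κ)) * ε ^ 5)) * hw2
    · simp [coef5, alpha5]
      linear_combination (-((1 + ε * ((ω ^ 2) + ε * κ)) ^ 4 * ((ω ^ 2) + ε * κ) * (1 + ((ω ^ 2) + ε * κ) + ε * ((ω ^ 2) + ε * κ)) * ε ^ 5)) * hw2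
    · simp [coef5, beta5]; ring
    · simp [coef5, beta5]; ring
    · simp [coef5, beta5]; ring
  · intro x y
    refine continuous_pi fun i => ?_
    fin_cases i <;> simp <;> fun_prop
  · intro e κ x y i he
    fin_cases i <;> simp [ell] <;> field_simp <;> ring
  · intro x y
    ext i
    fin_cases i <;> simp [vgVec, permOf]
  · intro x y i
    fin_cases i <;> simp <;> field_simp <;> grind

theorem limitingProcess_node_one {ψ μ ω γ b c : ℂ} (hψ : ψ ≠ 0)
    (hμ : μ ^ 2 = 32 / ψ ^ 5 - 3 / 4) (hω : IsPrimitiveRoot ω 3)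
    (h : IsRowData ψ μ ω γ b c) :
    LimitingProcess ψ μ (excVec 0 1 ω) 1 1 ω (-(ω + 9 * γ ^ 5)) 3
        (fun e u v => (-(ω * c * u) / e ^ 6 + (ω * c * u + v) / (2 * e),
          ω * c * u / e ^ 6 + (ω * c * u + v) / (2 * e)))
        (fun u v => ![u, b * u, v, c * u + ω * v, -ω ^ 2 * (c * u - v)]) := by
  have hw := h.root
  have hb := h.b_pow
  have hc := h.c_pow
  have hc0 := h.c_ne
  have hb0 := h.b_ne
  have hm := h.mu_eq
  have hw0 := primitive_ne_zero hω
  have hg := h.one_sub_ne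
  have h2w := one_add_two_mul_ne hω
  have hw2 : (ω) ^ 2 + ω + 1 = 0 := cube_root_sum hω
  refine limitingProcess_node hψ hμ h (permOf ![0, 2, 1, 3, 4] ![0, 2, 1, 3, 4])
    (bp_mem_basePoints hω 0) (represents_bp_zero hω) hw2 ?_
    ![6, 6, 1, 1, 1]
    (fun p => ![-((1 + p.1) ^ 4 * (ω + p.1 * p.2) * (1 + (ω + p.1 * p.2) + p.1 * (ω + p.1 * p.2)) * (2 * ω * p.2 + p.2 + p.1 * p.2 ^ 2 + (ω + p.1 * p.2) ^ 2 + 2 * (ω + p.1 * p.2) + p.1 * (ω + p.1 * p.2) ^ 2)),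
      -((1 + p.1 * (ω + p.1 * p.2)) ^ 4 * (ω + p.1 * p.2) * (1 + (ω + p.1 * p.2) + p.1 * (ω + p.1 * p.2)) * (2 * ω * p.2 + p.2 + p.1 * p.2 ^ 2 + (ω + p.1 * p.2) + 2 * (ω + p.1 * p.2) ^ 2 + p.1 * (ω + p.1 * p.2) ^ 2)),
      (1 + p.1 * (ω + p.1 * p.2)) ^ 4 * (1 - (1 + p.1) + (1 + p.1) ^ 2),
      -((1 + (ω + p.1 * p.2) + p.1 * (ω + p.1 * p.2)) * (1 - (1 + p.1) * (1 + p.1 * (ω + p.1 * p.2)) + ((1 + p.1) * (1 + p.1 * (ω + p.1 * p.2))) ^ 2)),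
      (1 + p.1) ^ 4 * (ω + p.1 * p.2) * (1 - (1 + p.1 * (ω + p.1 * p.2)) + (1 + p.1 * (ω + p.1 * p.2)) ^ 2)])
    ?_ ![-ω ^ 2 / c, b * ω ^ 2 / c, 1, ω, ω ^ 2] ?_ ?_ ?_
    (fun x y p => ![-(ω * c * x) + p.1 * (ω * c * x + y) / 2, ω * c * x + p.1 * (ω * c * x + y) / 2,
      ω * c * x + y + (-(ω * c * x) + p.1 * (ω * c * x + y) / 2),
      ω * c * x + y + (-(ω * c * x) + p.1 * (ω * c * x + y) / 2)
        + (ω + p.1 * p.2) * (ω * c * x + p.1 * (ω * c * x + y) / 2),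
      ω * c * x + y + (ω + p.1 * p.2) * (ω * c * x + p.1 * (ω * c * x + y) / 2)]) ?_ ?_ ?_ ?_
  · simp only [hm]
    grind
  · refine continuous_pi fun i => ?_
    fin_cases i <;> simp <;> fun_prop
  · intro i
    fin_cases i <;> simp [hc0, hw0, hb0]
  · intro i
    fin_cases i <;> simp [div_pow]
    · field_simp; grind
    · field_simp; grind
    · grind
    · grind
  · intro ε κ i
    fin_cases i
    · simp [coef5, alpha5]
      linear_combination (-((1 + ε) ^ 4 * (ω + ε * κ) * (1 + (ω + ε * κ) + ε * (ω + ε * κ)) * ε ^ 5)) * hw2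
    · simp [coef5, alpha5]
      linear_combination (-((1 + ε * (ω + ε * κ)) ^ 4 * (ω + ε * κ) * (1 + (ω + ε * κ) + ε * (ω + ε * κ)) * ε ^ 5)) * hw2
    · simp [coef5, beta5]; ring
    · simp [coef5, beta5]; ring
    · simp [coef5, beta5]; ring
  · intro x y
    refine continuous_pi fun i => ?_
    fin_cases i <;> simp <;> fun_prop
  · intro e κ x y i he
    fin_cases i <;> simp [ell] <;> field_simp <;> ring
  · intro x y
    ext i
    fin_cases i <;> simp [vgVec, permOf]
  · intro x y i
    fin_cases i <;> simp <;> field_simp <;> grind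

/-! ### Permutations of the coordinates -/

theorem permLine_permLine (π π' : Equiv.Perm (Fin 5)) (L : Submodule ℂ (Fin 5 → ℂ)) :
    permLine π (permLine π' L) = permLine (π' * π) L := by
  rw [permLine, permLine, permLine, ← Submodule.map_comp]
  rfl

theorem permLine_one (L : Submodule ℂ (Fin 5 → ℂ)) : permLine 1 L = L := by
  have : LinearMap.funLeft ℂ ℂ (1 : Equiv.Perm (Fin 5)) = LinearMap.id := by ext; rfl
  rw [permLine, this, Submodule.map_id]

theorem permLine_span_pair (π : Equiv.Perm (Fin 5)) (x y : Fin 5 → ℂ) :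
    permLine π (Submodule.span ℂ {x, y}) = Submodule.span ℂ {x ∘ π, y ∘ π} := by
  rw [permLine, Submodule.map_span, Set.image_pair]
  rfl

theorem mem_permLine {π : Equiv.Perm (Fin 5)} {L : Submodule ℂ (Fin 5 → ℂ)} {x : Fin 5 → ℂ} :
    x ∈ permLine π L ↔ ∃ y ∈ L, y ∘ π = x := Submodule.mem_map

theorem finrank_permLine (π : Equiv.Perm (Fin 5)) (L : Submodule ℂ (Fin 5 → ℂ)) :
    Module.finrank ℂ (permLine π L) = Module.finrank ℂ L := by
  have h : Function.Injective (LinearMap.funLeft ℂ ℂ π) :=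
    LinearMap.funLeft_injective_of_surjective ℂ ℂ π π.surjective
  exact (Submodule.equivMapOfInjective _ h L).finrank_eq.symm

/-- Coordinate permutations normalize the diagonal group. -/
theorem gOrbit_permLine (π : Equiv.Perm (Fin 5)) (L : Submodule ℂ (Fin 5 → ℂ)) :
    gOrbit (permLine π L) = permLine π '' gOrbit L := by
  have key : ∀ g : Fin 5 → ℂ, (permLine π L).map (Matrix.toLin' (Matrix.diagonal (g ∘ π)))
      = permLine π (L.map (Matrix.toLin' (Matrix.diagonal g))) := fun g => by
    ext x
    rw [mem_diag_map, mem_permLine]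
    constructor
    · rintro ⟨y, hy, rfl⟩
      obtain ⟨z, hz, rfl⟩ := mem_permLine.1 hy
      exact ⟨g * z, mem_diag_map.2 ⟨z, hz, rfl⟩, rfl⟩
    · rintro ⟨y, hy, rfl⟩
      obtain ⟨z, hz, rfl⟩ := mem_diag_map.1 hy
      exact ⟨z ∘ π, mem_permLine.2 ⟨z, hz, rfl⟩, rfl⟩
  ext L'
  constructor
  · rintro ⟨g, hg, hp, rfl⟩
    refine ⟨_, ⟨g ∘ π.symm, fun i => hg _, ?_, rfl⟩, ?_⟩
    · rw [← hp]; exact Equiv.prod_comp π.symm g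
    · rw [← key, Function.comp_assoc]; simp
  · rintro ⟨_, ⟨g, hg, hp, rfl⟩, rfl⟩
    refine ⟨g ∘ π, fun i => hg _, ?_, (key g).symm⟩
    rw [← hp]; exact Equiv.prod_comp π g

/-! ### Symmetries of the family -/

/-- A birational symmetry of the family of lines: a map `f` of the parameters that multiplies
`μ` by `s`, lifts to the map `A` on `dP₅` and permutes the coordinates by `π`. -/
structure IsFamilySymmetry (s : ℂ) (f : ℂ → ℂ → ℂ × ℂ) (π : Equiv.Perm (Fin 5))
    (A : (Fin 6 → ℂ) → (Fin 6 → ℂ)) : Prop where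
  affF_eq : ∀ μ σ τ, H σ τ ≠ 0 → affF μ σ τ = 0 → affF (s * μ) (f σ τ).1 (f σ τ).2 = 0
  H_ne : ∀ σ τ, H σ τ ≠ 0 → H (f σ τ).1 (f σ τ).2 ≠ 0
  coef : ∀ σ τ, H σ τ ≠ 0 → ∃ (m : Fin 5 → ℂ) (l : ℂ), l ≠ 0 ∧ (∀ i, m i ≠ 0) ∧
    (∀ i, coef5 (f σ τ).1 (f σ τ).2 i * m i ^ 5 = l * coef5 σ τ (π i)) ∧
    (f σ τ).1 * (f σ τ).2 * H (f σ τ).1 (f σ τ).2 * ∏ i, m i = l * (σ * τ * H σ τ) ∧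
    ∀ u v, ∃ u' v', ∀ i, ell (f σ τ).1 (f σ τ).2 u' v' i = m i * ell σ τ u v (π i)
  map_psi : ∀ σ τ, H σ τ ≠ 0 → ∃ l : ℂ, A (psiVec σ τ) = l • psiVec (f σ τ).1 (f σ τ).2
  map_smul : ∀ (c : ℂ) z, A (c • z) = c • A z
  continuous : Continuous A
  sq_one : s ^ 2 = 1

/-- From admissible coefficients `D` at `(σ, τ)` one gets `a D(π i) / m i` at the new parameters,
where `a⁵ = l`. The three conditions in `coef` give their fifth powers, their product and the
matching of the linear forms. -/
theorem IsFamilySymmetry.isFamilyLine {s : ℂ} {f : ℂ → ℂ → ℂ × ℂ} {π : Equiv.Perm (Fin 5)}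
    {A : (Fin 6 → ℂ) → (Fin 6 → ℂ)} (h : IsFamilySymmetry s f π A) {ψ μ σ τ : ℂ} (hψ : ψ ≠ 0)
    (hμ : μ ^ 2 = 32 / ψ ^ 5 - 3 / 4) (hF : affF μ σ τ = 0) {L : Submodule ℂ (Fin 5 → ℂ)}
    (hL : IsFamilyLine ψ σ τ L) :
    IsFamilyLine ψ (f σ τ).1 (f σ τ).2 (permLine π L) := by
  have hμ' : (s * μ) ^ 2 = 32 / ψ ^ 5 - 3 / 4 := by rw [mul_pow, h.sq_one, one_mul, hμ]
  have hdim := hL.1.1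
  obtain ⟨hH, D, hD, hprod, rfl⟩ := (isFamilyLine_iff hψ hμ hF).1 hL
  have hF' := h.affF_eq μ σ τ hH hF
  have hH' := h.H_ne σ τ hH
  obtain ⟨m, l, hl, hm, hcoef, hmprod, hell⟩ := h.coef σ τ hH
  obtain ⟨a, ha⟩ := IsAlgClosed.exists_pow_nat_eq l (n := 5) (by norm_num)
  have ha0 : a ≠ 0 := by rintro rfl; exact hl (by simpa using ha.symm)
  have hD' : ∀ i, (a * D (π i) / m i) ^ 5 = coef5 (f σ τ).1 (f σ τ).2 i := fun i => by
    rw [div_pow, mul_pow, ha, hD, div_eq_iff (pow_ne_zero 5 (hm i)), hcoef]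
  have hm0 : ∏ i, m i ≠ 0 := Finset.prod_ne_zero_iff.2 fun i _ => hm i
  have hprod' : ∏ i, a * D (π i) / m i
      = 2 * (f σ τ).1 * (f σ τ).2 * H (f σ τ).1 (f σ τ).2 / ψ := by
    rw [Finset.prod_div_distrib, Finset.prod_mul_distrib, Equiv.prod_comp π D, hprod,
      Finset.prod_const, Finset.card_univ, Fintype.card_fin, ha]
    field_simp
    linear_combination -hmprod
  refine (isFamilyLine_iff hψ hμ' hF').2 ⟨hH', _, hD', hprod', ?_⟩
  apply Submodule.eq_of_le_of_finrank_eq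
  · intro x hx
    obtain ⟨y, hy, rfl⟩ := mem_permLine.1 hx
    obtain ⟨u, v, rfl⟩ := mem_dLine.1 hy
    obtain ⟨u', v', huv⟩ := hell u v
    have e : (D * ell σ τ u v) ∘ π = a⁻¹ • ((fun i => a * D (π i) / m i) *
        ell (f σ τ).1 (f σ τ).2 u' v') := by
      ext i
      simp only [Function.comp_apply, Pi.mul_apply, Pi.smul_apply, smul_eq_mul, huv]
      have := hm i
      field_simp
    rw [e]
    exact Submodule.smul_mem _ _ (mem_dLine.2 ⟨u', v', rfl⟩)
  · rw [finrank_permLine, hdim]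
    exact ((isDworkLine_iff hψ hμ' hF' hH' hD').2 hprod').1.symm

theorem IsFamilySymmetry.limitLines_subset {s : ℂ} {f : ℂ → ℂ → ℂ × ℂ} {π : Equiv.Perm (Fin 5)}
    {A : (Fin 6 → ℂ) → (Fin 6 → ℂ)} (h : IsFamilySymmetry s f π A) {ψ μ : ℂ} (hψ : ψ ≠ 0)
    (hμ : μ ^ 2 = 32 / ψ ^ 5 - 3 / 4) {P P' : P5} {z₀ : Fin 6 → ℂ} (hP : Represents P z₀)
    (hP' : Represents P' (A z₀)) :
    permLine π '' limitLines ψ μ P ⊆ limitLines ψ (s * μ) P' := by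
  rintro _ ⟨L, ⟨σ, τ, lam, x, y, z, x₀, y₀, hfam, hz, hlz, hx, hy, hxy, rfl⟩, rfl⟩
  have hH := fun n => (hfam n).2.H_ne_zero (hfam n).1
  choose l hl using fun n => h.map_psi (σ n) (τ n) (hH n)
  have hcomp : ∀ {w : ℕ → Fin 5 → ℂ} {w₀ : Fin 5 → ℂ}, Tendsto w atTop (𝓝 w₀) →
      Tendsto (fun n => w n ∘ π) atTop (𝓝 (w₀ ∘ π)) := fun hw => by
    rw [tendsto_pi_nhds] at hw ⊢
    exact fun i => hw (π i)
  refine ⟨fun n => (f (σ n) (τ n)).1, fun n => (f (σ n) (τ n)).2, fun n => lam n * l n,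
    fun n => x n ∘ π, fun n => y n ∘ π, A z, x₀ ∘ π, y₀ ∘ π, fun n => ⟨?_, ?_⟩, ?_, ?_, hcomp hx,
    hcomp hy, ?_, permLine_span_pair _ _ _⟩
  · exact h.affF_eq _ _ _ (hH n) (hfam n).1
  · rw [← permLine_span_pair]
    exact h.isFamilyLine hψ hμ (hfam n).1 (hfam n).2
  · obtain ⟨a, ha, rfl⟩ := hP.smul_eq hz
    rw [h.map_smul]
    exact hP'.of_smul ha
  · have := (h.continuous.tendsto z).comp hlz
    refine this.congr fun n => ?_
    rw [Function.comp_apply, h.map_smul, hl, smul_smul]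
  · rw [← finrank_span_pair] at hxy ⊢
    rw [← permLine_span_pair, finrank_permLine, hxy]

/-- The reverse inclusion comes from applying the same symmetry at `P'`: it leads back to `P`, the
sign squares to one and the permutation is an involution. -/
theorem IsFamilySymmetry.limitLines_eq {s : ℂ} {f : ℂ → ℂ → ℂ × ℂ} {π : Equiv.Perm (Fin 5)}
    {A : (Fin 6 → ℂ) → (Fin 6 → ℂ)} (h : IsFamilySymmetry s f π A) (hπ : π * π = 1) {ψ μ : ℂ}
    (hψ : ψ ≠ 0) (hμ : μ ^ 2 = 32 / ψ ^ 5 - 3 / 4) {P P' : P5} {z z' : Fin 6 → ℂ}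
    (hP : Represents P z) (hP' : Represents P' (A z)) (hQ : Represents P' z')
    (hQ' : Represents P (A z')) {L : Submodule ℂ (Fin 5 → ℂ)} (hL : limitLines ψ μ P = gOrbit L) :
    limitLines ψ (s * μ) P' = gOrbit (permLine π L) := by
  have hμ' : (s * μ) ^ 2 = 32 / ψ ^ 5 - 3 / 4 := by rw [mul_pow, h.sq_one, one_mul, hμ]
  rw [gOrbit_permLine, ← hL]
  refine Set.Subset.antisymm (fun L' hL' => ?_) (h.limitLines_subset hψ hμ hP hP')
  refine ⟨permLine π L', ?_, by rw [permLine_permLine, hπ, permLine_one]⟩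
  have := h.limitLines_subset hψ hμ' hQ hQ' ⟨L', hL', rfl⟩
  rwa [← mul_assoc, ← sq, h.sq_one, one_mul] at this

/-- Three involutions are used. The exchange of `σ` and `τ` fixes `G` and `H`; the inversion and the
reflection below preserve `G` and change the sign of `H`, up to a common factor, so they interchange
the curves for `±μ`. -/
theorem isFamilySymmetry_swap : IsFamilySymmetry 1 (fun σ τ => (τ, σ))
    (permOf ![1, 0, 4, 3, 2] ![1, 0, 4, 3, 2]) (fun z => ![z 0, z 2, z 1, z 3, z 5, z 4]) where
  affF_eq μ σ τ _ h := by rw [one_mul, affF_symm, h]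
  H_ne σ τ h := by
    have : H τ σ = H σ τ := by unfold H; ring
    rwa [this]
  coef σ τ h := by
    refine ⟨fun _ => 1, 1, one_ne_zero, fun _ => one_ne_zero, fun i => ?_, ?_, fun u v => ?_⟩
    · fin_cases i <;> simp [coef5, permOf, mul_comm]
    · simp [H]; ring
    · refine ⟨v, u, fun i => ?_⟩
      fin_cases i <;> simp [ell, permOf] <;> ring
  map_psi σ τ _ := by
    refine ⟨1, ?_⟩
    ext i
    fin_cases i <;> simp [psiVec] <;> ring
  map_smul c z := by ext i; fin_cases i <;> simp
  continuous := by
    refine continuous_pi fun i => ?_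
    fin_cases i <;> simp <;> fun_prop
  sq_one := by norm_num

theorem isFamilySymmetry_inv : IsFamilySymmetry (-1) (fun σ τ => (1 / σ, 1 / τ))
    (permOf ![1, 0, 2, 3, 4] ![1, 0, 2, 3, 4])
    (fun z => ![-z 0, z 5 - z 0, z 4 - z 0, z 3 - z 0, z 2 - z 0, z 1 - z 0]) where
  affF_eq μ σ τ hH h := by
    obtain ⟨hσ, hτ, -, -, -⟩ := H_ne_zero hH
    have : affF (-1 * μ) (1 / σ) (1 / τ) = affF μ σ τ / (σ * τ) ^ 4 := by
      simp only [affF, G, H]; field_simp; ring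
    simp only [this, h, zero_div]
  H_ne σ τ h := by
    obtain ⟨hσ, hτ, -, -, -⟩ := H_ne_zero h
    have : H (1 / σ) (1 / τ) = -H σ τ / (σ * τ) ^ 4 := by
      simp only [H]; field_simp; ring
    simp only [this]
    exact div_ne_zero (neg_ne_zero.2 h) (pow_ne_zero 4 (mul_ne_zero hσ hτ))
  coef σ τ h := by
    obtain ⟨hσ, hτ, -, -, -⟩ := H_ne_zero h
    refine ⟨![1, 1, 1 / σ, 1 / (σ * τ), 1 / τ], -1 / (σ * τ) ^ 8, ?_, fun i => ?_, fun i => ?_, ?_,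
      fun u v => ⟨v, u, fun i => ?_⟩⟩
    · exact div_ne_zero (by norm_num) (pow_ne_zero 8 (mul_ne_zero hσ hτ))
    · fin_cases i <;> simp [hσ, hτ]
    · fin_cases i <;> simp [coef5, permOf, alpha5, beta5] <;> field_simp <;> ring
    · simp [Fin.prod_univ_five, H]; field_simp; ring
    · fin_cases i <;> simp [ell, permOf] <;> field_simp <;> ring
  map_psi σ τ h := by
    obtain ⟨hσ, hτ, -, -, -⟩ := H_ne_zero h
    refine ⟨σ ^ 2 * τ ^ 2, ?_⟩
    ext i
    fin_cases i <;> simp [psiVec] <;> field_simp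
  map_smul c z := by ext i; fin_cases i <;> simp <;> ring
  continuous := by
    refine continuous_pi fun i => ?_
    fin_cases i <;> simp <;> fun_prop
  sq_one := by norm_num

theorem isFamilySymmetry_refl : IsFamilySymmetry (-1) (fun σ τ => (1 - σ, τ / (τ - 1)))
    (permOf ![3, 1, 2, 0, 4] ![3, 1, 2, 0, 4])
    (fun z => ![z 0 - 2 * z 1 + 2 * z 4, -z 1 + 2 * z 4, z 0 - 2 * z 1 - z 2 + 2 * z 3 + z 4,
      z 4 - z 1 + z 3, z 4, -z 1 + 2 * z 3 - z 5]) where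
  affF_eq μ σ τ hH h := by
    obtain ⟨hσ, hτ, h1, h2, h3⟩ := H_ne_zero hH
    have h2' : τ - 1 ≠ 0 := by grind
    have : affF (-1 * μ) (1 - σ) (τ / (τ - 1)) = affF μ σ τ / (τ - 1) ^ 4 := by
      simp only [affF, G, H]; field_simp; ring
    simp only [this, h, zero_div]
  H_ne σ τ h := by
    obtain ⟨hσ, hτ, h1, h2, h3⟩ := H_ne_zero h
    have h2' : τ - 1 ≠ 0 := by grind
    have : H (1 - σ) (τ / (τ - 1)) = -H σ τ / (τ - 1) ^ 4 := by
      simp only [H]; field_simp; ring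
    simp only [this]
    exact div_ne_zero (neg_ne_zero.2 h) (pow_ne_zero 4 h2')
  coef σ τ h := by
    obtain ⟨hσ, hτ, h1, h2, h3⟩ := H_ne_zero h
    have h2' : τ - 1 ≠ 0 := by grind
    have h1' : 1 - σ ≠ 0 := by grind
    -- The coordinates `0` and `1` force `u' = m₀ ℓ₃(u, v)` and `v' = m₁ ℓ₁(u, v)`; the other `m i`
    -- are the factors then appearing in the remaining forms.
    refine ⟨![1 / (1 - σ), -(τ - 1), 1, σ, σ / (1 - σ)], σ / ((1 - σ) * (τ - 1) ^ 4), ?_,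
      fun i => ?_, fun i => ?_, ?_,
      fun u v => ⟨(σ * u + τ * v) / (1 - σ), -(τ - 1) * v, fun i => ?_⟩⟩
    · exact div_ne_zero hσ (mul_ne_zero h1' (pow_ne_zero 4 h2'))
    · fin_cases i <;> simp [hσ, h1']
      grind
    · fin_cases i <;> simp [coef5, permOf, alpha5, beta5] <;> field_simp <;> ring
    · simp [Fin.prod_univ_five, H]; field_simp; ring
    · fin_cases i <;> simp [ell, permOf] <;> field_simp <;> ring
  map_psi σ τ h := by
    obtain ⟨hσ, hτ, h1, h2, h3⟩ := H_ne_zero h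
    have h2' : τ - 1 ≠ 0 := by grind
    refine ⟨(τ - 1) ^ 2, ?_⟩
    ext i
    fin_cases i <;> simp [psiVec] <;> field_simp <;> ring
  map_smul c z := by ext i; fin_cases i <;> simp <;> ring
  continuous := by
    refine continuous_pi fun i => ?_
    fin_cases i <;> simp <;> fun_prop
  sq_one := by norm_num

/-! ### Limit lines at all base points. -/

theorem LimitingProcess.limitLines_eq {ψ μ ω b c : ℂ} {P : Fin 6 → ℂ} {s₀ t₀ t₁ t₂ : ℂ} {n : ℕ}
    {uv : ℂ → ℂ → ℂ → ℂ × ℂ} {row : ℂ → ℂ → Fin 5 → ℂ}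
    (h : LimitingProcess ψ μ P s₀ t₀ t₁ t₂ n uv row) {Q : P5} (hQ : Represents Q P)
    (π : Equiv.Perm (Fin 5)) (hrow : ∀ x y, row x y = vgVec ω b c x y ∘ π) :
    limitLines ψ μ Q = gOrbit (permLine π (vgLine ω b c)) := by
  obtain ⟨-, Q', -, hQ', h⟩ := h
  rw [hQ.unique hQ', h, permLine_vgLine, hrow, hrow]

/-- The permutation of the coordinates that gives the limit line at a base point of the `k`-th
exceptional line. -/
def basePerm (k : Fin 10) : Equiv.Perm (Fin 5) :=
  ![permOf ![0, 2, 1, 3, 4] ![0, 2, 1, 3, 4], permOf ![0, 1, 2, 4, 3] ![0, 1, 2, 4, 3],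
    permOf ![2, 4, 3, 0, 1] ![3, 4, 0, 2, 1], permOf ![0, 1, 4, 3, 2] ![0, 1, 4, 3, 2],
    permOf ![1, 0, 2, 3, 4] ![1, 0, 2, 3, 4], permOf ![4, 2, 1, 0, 3] ![3, 2, 1, 4, 0],
    permOf ![1, 0, 3, 4, 2] ![1, 0, 4, 2, 3], permOf ![3, 1, 2, 0, 4] ![3, 1, 2, 0, 4],
    permOf ![3, 4, 2, 1, 0] ![4, 3, 2, 0, 1], permOf ![1, 3, 4, 0, 2] ![3, 0, 4, 1, 2]] k

theorem coefC_sq {ω ψ γ : ℂ} (hω : ω ^ 2 + ω + 1 = 0) :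
    coefC (ω ^ 2) ψ γ = -ω ^ 2 * coefC ω ψ γ := by
  unfold coefC
  linear_combination (1 / 2 * ψ * γ * (1 - ω)) * hω

theorem vgVec_sq {ω b c : ℂ} (hω : ω ^ 2 + ω + 1 = 0) (u v : ℂ) :
    vgVec (ω ^ 2) b (-ω ^ 2 * c) u v = vgVec ω b c u v ∘ Equiv.swap 3 4 := by
  ext i
  fin_cases i <;> simp [vgVec, Equiv.swap_apply_def]
  · ring
  · linear_combination ((c * u * (ω ^ 3 + 1) + v * ω) * (ω - 1)) * hω

/-- For fixed `γ` the coefficient `c` becomes `-ω²c`, which turns each of the last two forms into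
the other. -/
theorem vgLine_sq {ω ψ γ : ℂ} (hω : ω ^ 2 + ω + 1 = 0) :
    vgLine (ω ^ 2) (coefB ψ γ) (coefC (ω ^ 2) ψ γ)
      = permLine (Equiv.swap 3 4) (vgLine ω (coefB ψ γ) (coefC ω ψ γ)) := by
  rw [coefC_sq hω, permLine_vgLine, ← vgVec_sq hω, ← vgVec_sq hω, vgLine]

theorem refl_bpVec {w : ℂ} (hs : w ^ 2 + w + 1 = 0) :
    (fun z : Fin 6 → ℂ => ![z 0 - 2 * z 1 + 2 * z 4, -z 1 + 2 * z 4,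
      z 0 - 2 * z 1 - z 2 + 2 * z 3 + z 4, z 4 - z 1 + z 3, z 4, -z 1 + 2 * z 3 - z 5])
      (bpVec (w ^ 2) 0) = (-w ^ 2) • bpVec w 5 ∧
    (fun z : Fin 6 → ℂ => ![z 0 - 2 * z 1 + 2 * z 4, -z 1 + 2 * z 4,
      z 0 - 2 * z 1 - z 2 + 2 * z 3 + z 4, z 4 - z 1 + z 3, z 4, -z 1 + 2 * z 3 - z 5])
      (bpVec w 5) = (-w) • bpVec (w ^ 2) 0 := by
  constructor <;> ext i <;> fin_cases i <;> simp [bpVec, bpParam, excVec] <;> grind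

theorem inv_bpVec {w : ℂ} (hs : w ^ 2 + w + 1 = 0) :
    (fun z : Fin 6 → ℂ => ![-z 0, z 5 - z 0, z 4 - z 0, z 3 - z 0, z 2 - z 0, z 1 - z 0])
      (bpVec (w ^ 2) 3) = (w ^ 2) • bpVec w 6 ∧
    (fun z : Fin 6 → ℂ => ![-z 0, z 5 - z 0, z 4 - z 0, z 3 - z 0, z 2 - z 0, z 1 - z 0])
      (bpVec w 6) = w • bpVec (w ^ 2) 3 := by
  constructor <;> ext i <;> fin_cases i <;> simp [bpVec, bpParam, excVec] <;> grind

/-- The limits of the family at a base point. -/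
theorem limitLines_bp {ψ μ w γ : ℂ} (hψ : ψ ≠ 0) (hμ : μ ^ 2 = 32 / ψ ^ 5 - 3 / 4)
    (hw : IsPrimitiveRoot w 3) (hγ : γ ^ 5 = gamma5 w μ) (k : Fin 10) :
    limitLines ψ μ (bp hw k)
      = gOrbit (permLine (basePerm k) (vgLine w (coefB ψ γ) (coefC w ψ γ))) := by
  -- These four exceptional lines are read off the table. The parameters are quantified anew because
  -- the symmetries of sign `-1` need the result for `w²` and `-μ`.
  have base : ∀ {ψ μ w γ : ℂ}, ψ ≠ 0 → μ ^ 2 = 32 / ψ ^ 5 - 3 / 4 →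
      ∀ hw : IsPrimitiveRoot w 3, γ ^ 5 = gamma5 w μ → ∀ k, (k = 0 ∨ k = 3 ∨ k = 8 ∨ k = 9) →
      limitLines ψ μ (bp hw k)
        = gOrbit (permLine (basePerm k) (vgLine w (coefB ψ γ) (coefC w ψ γ))) := by
    intro ψ μ w γ hψ hμ hw hγ k hk
    have h := isRowData hψ hμ hw hγ
    rcases hk with rfl | rfl | rfl | rfl
    · exact (limitingProcess_node_one hψ hμ hw h).limitLines_eq (represents_bp_zero hw)
        (basePerm 0) fun x y => by ext i; fin_cases i <;> simp [vgVec, basePerm, permOf]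
    · exact (limitingProcess_zero_root hψ hμ hw h).limitLines_eq (represents_bp_three hw)
        (basePerm 3) fun x y => by ext i; fin_cases i <;> simp [vgVec, basePerm, permOf]
    · have hne : 9 * γ ^ 5 ≠ 0 := mul_ne_zero (by norm_num) (pow_ne_zero 5 h.gamma_ne)
      obtain ⟨δ, hδ⟩ := IsAlgClosed.exists_pow_nat_eq (w ^ 2 / (9 * γ ^ 5)) (n := 5) (by norm_num)
      exact (limitingProcess_root_root hψ hμ hw h hδ).limitLines_eq (represents_bp_eight hw)
        (basePerm 8) fun x y => by ext i; fin_cases i <;> simp [vgVec, basePerm, permOf]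
    · exact (limitingProcess_one_root hψ hμ hw h).limitLines_eq (represents_bp_nine hw)
        (basePerm 9) fun x y => by ext i; fin_cases i <;> simp [vgVec, basePerm, permOf]
  have hs := cube_root_sum hw
  have h3 := hw.pow_eq_one
  have hw0 := primitive_ne_zero hw
  have swp : ∀ {k k'}, limitLines ψ μ (bp hw k)
        = gOrbit (permLine (basePerm k) (vgLine w (coefB ψ γ) (coefC w ψ γ))) →
      (∀ i, bpVec w k' i = bpVec w k (![0, 2, 1, 3, 5, 4] i)) →
      basePerm k * permOf ![1, 0, 4, 3, 2] ![1, 0, 4, 3, 2] = basePerm k' →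
      limitLines ψ μ (bp hw k')
        = gOrbit (permLine (basePerm k') (vgLine w (coefB ψ γ) (coefC w ψ γ))) := by
    intro k k' h hk hπ
    have := isFamilySymmetry_swap.limitLines_eq (by decide) hψ hμ (represents_bp hw k)
      (P' := bp hw k') (z' := bpVec w k') ?_ (represents_bp hw k') ?_ h
    · rwa [one_mul, permLine_permLine, hπ] at this
    · convert! represents_bp hw k' using 1
      ext i
      rw [hk]
      fin_cases i <;> rfl
    · convert! represents_bp hw k using 1
      ext i
      fin_cases i <;> simp [hk]
  -- Here the base point for `w²` on the curve of `-μ` is carried to the one for `w` on the curve of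
  -- `μ`. The same `γ` serves both, as `gamma5 (w²) (-μ) = gamma5 w μ`.
  have conj : ∀ {k k'} {f : ℂ → ℂ → ℂ × ℂ} {π : Equiv.Perm (Fin 5)}
      {A : (Fin 6 → ℂ) → (Fin 6 → ℂ)}, IsFamilySymmetry (-1) f π A → π * π = 1 →
      (k = 0 ∨ k = 3 ∨ k = 8 ∨ k = 9) →
      (∃ a : ℂ, a ≠ 0 ∧ A (bpVec (w ^ 2) k) = a • bpVec w k') →
      (∃ a : ℂ, a ≠ 0 ∧ A (bpVec w k') = a • bpVec (w ^ 2) k) →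
      Equiv.swap 3 4 * (basePerm k * π) = basePerm k' →
      limitLines ψ μ (bp hw k')
        = gOrbit (permLine (basePerm k') (vgLine w (coefB ψ γ) (coefC w ψ γ))) := by
    rintro k k' f π A hf hππ hk ⟨a, ha, hA⟩ ⟨a', ha', hA'⟩ hπ
    have hμ' : (-μ) ^ 2 = 32 / ψ ^ 5 - 3 / 4 := by rw [neg_sq, hμ]
    have hγ' : γ ^ 5 = gamma5 (w ^ 2) (-μ) := by
      rw [hγ, ← gamma5_neg w (-μ) h3, neg_neg]
    have := hf.limitLines_eq hππ hψ hμ' (represents_bp (primitive_sq hw) k) (P' := bp hw k')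
      (z' := bpVec w k') (hA ▸ (represents_bp hw k').of_smul ha) (represents_bp hw k')
      (hA' ▸ (represents_bp (primitive_sq hw) k).of_smul ha')
      (base hψ hμ' (primitive_sq hw) hγ' k hk)
    rwa [neg_one_mul, neg_neg, vgLine_sq hs, permLine_permLine, permLine_permLine, hπ] at this
  -- The reflection leads from index `0` to `5` and the inversion from `3` to `6`; exchanging `σ`
  -- and `τ` then turns `6, 5, 3, 9` into `1, 2, 4, 7`.
  have h5 := conj (k := 0) (k' := 5) isFamilySymmetry_refl (by decide) (by simp)
    ⟨-w ^ 2, by simp [hw0], (refl_bpVec hs).1⟩ ⟨-w, by simp [hw0], (refl_bpVec hs).2⟩ (by decide)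
  have h6 := conj (k := 3) (k' := 6) isFamilySymmetry_inv (by decide) (by simp)
    ⟨w ^ 2, by simp [hw0], (inv_bpVec hs).1⟩ ⟨w, by simp [hw0], (inv_bpVec hs).2⟩ (by decide)
  have hb := base hψ hμ hw hγ
  have hv : ∀ k k' : Fin 10, ((k, k') = (6, 1) ∨ (k, k') = (5, 2) ∨ (k, k') = (3, 4) ∨
      (k, k') = (9, 7)) → ∀ i, bpVec w k' i = bpVec w k (![0, 2, 1, 3, 5, 4] i) := by
    intro k k' h i
    simp only [Prod.mk.injEq] at h
    rcases h with ⟨rfl, rfl⟩ | ⟨rfl, rfl⟩ | ⟨rfl, rfl⟩ | ⟨rfl, rfl⟩ <;> fin_cases i <;> rfl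
  fin_cases k
  · exact hb 0 (by simp)
  · exact swp h6 (hv 6 1 (by simp)) (by decide)
  · exact swp h5 (hv 5 2 (by simp)) (by decide)
  · exact hb 3 (by simp)
  · exact swp (hb 3 (by simp)) (hv 3 4 (by simp)) (by decide)
  · exact h5
  · exact h6
  · exact swp (hb 9 (by simp)) (hv 9 7 (by simp)) (by decide)
  · exact hb 8 (by simp)
  · exact hb 9 (by simp)

/-! ### The orbits of the van Geemen lines -/

theorem mem_vgLine {ω b c : ℂ} {x : Fin 5 → ℂ} :
    x ∈ vgLine ω b c ↔ ∃ u v, x = vgVec ω b c u v := by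
  rw [vgLine, Submodule.mem_span_pair]
  have e : ∀ u v, u • vgVec ω b c 1 0 + v • vgVec ω b c 0 1 = vgVec ω b c u v := fun u v => by
    ext i
    fin_cases i <;> simp [vgVec] <;> ring
  simp only [e, eq_comm]

/-- The cyclic permutation of the coordinates `1`, `3`, `4`. -/
def threeCycle : Equiv.Perm (Fin 5) := permOf ![0, 3, 2, 4, 1] ![0, 4, 2, 1, 3]

/-- The reparametrization `(u, v) ↦ (u, cu + ωv)` permutes the forms with indices `1`, `3`, `4`
cyclically and fixes the other two. -/
theorem permLine_threeCycle {ω b c : ℂ} (hω : ω ^ 2 + ω + 1 = 0) :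
    permLine threeCycle (vgLine ω b c) = vgLine ω b c := by
  apply Submodule.eq_of_le_of_finrank_eq
  · intro x hx
    obtain ⟨y, hy, rfl⟩ := mem_permLine.1 hx
    obtain ⟨u, v, rfl⟩ := mem_vgLine.1 hy
    refine mem_vgLine.2 ⟨u, c * u + ω * v, ?_⟩
    ext i
    fin_cases i <;> simp [vgVec, threeCycle, permOf]
    · linear_combination (-(c * u)) * hω
    · linear_combination (v * (1 - ω)) * hω
  · exact finrank_permLine _ _

theorem permLine_threeCycle_pow {ω b c : ℂ} (hω : ω ^ 2 + ω + 1 = 0) (n : ℕ)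
    (π : Equiv.Perm (Fin 5)) :
    permLine (threeCycle ^ n * π) (vgLine ω b c) = permLine π (vgLine ω b c) := by
  induction n with
  | zero => simp
  | succ n ih =>
    rw [pow_succ', mul_assoc, ← permLine_permLine, permLine_threeCycle hω, ih]

/-- Among the five forms only `u` and `bu` are proportional, so the pair of coordinates `{0, 2}` is
intrinsic to the line. -/
theorem vgVec_two_zeros {ω b c u v : ℂ} (hω : ω ^ 2 + ω + 1 = 0) (hb : b ≠ 0) (hc : c ≠ 0)
    {i j : Fin 5} (hij : i ≠ j) (hi : vgVec ω b c u v i = 0) (hj : vgVec ω b c u v j = 0)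
    (h0 : u ≠ 0 ∨ v ≠ 0) : u = 0 ∧ (i = 0 ∧ j = 2 ∨ i = 2 ∧ j = 0) := by
  have hω0 : ω ≠ 0 := by rintro rfl; simp at hω
  have hω1 : ω ^ 2 ≠ 0 := pow_ne_zero 2 hω0
  have hu : u = 0 ∨ v = 0 ∨ c * u + ω * v = 0 ∧ c * u - v = 0 := by
    fin_cases i <;> fin_cases j <;> simp [vgVec, hb, hω0] at hij hi hj <;> tauto
  have hcu : c * u = 0 → u = 0 := fun h => (mul_eq_zero.1 h).resolve_left hc
  have hωv : ω * v = 0 → v = 0 := fun h => (mul_eq_zero.1 h).resolve_left hω0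
  have huv : u = 0 ∧ v ≠ 0 := by
    by_cases hu0 : u = 0
    · exact ⟨hu0, by tauto⟩
    · exfalso
      have hv : v = 0 := by
        rcases hu with h | h | ⟨h1, h2⟩
        · exact (hu0 h).elim
        · exact h
        · have : ω ^ 2 * v = 0 := by linear_combination v * hω - h1 + h2
          exact (mul_eq_zero.1 this).resolve_left hω1
      have hcu' : c * u ≠ 0 := mul_ne_zero hc hu0
      subst hv
      fin_cases i <;> fin_cases j <;> simp [vgVec, hb, hω0, hc, hu0] at hij hi hj
  obtain ⟨rfl, hv⟩ := huv
  refine ⟨rfl, ?_⟩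
  fin_cases i <;> fin_cases j <;> simp [vgVec, hω0, hv] at hij hi hj ⊢

theorem eq_of_pow_eq {a b : ℂ} (ha : a ^ 5 = 1) (hb : b ^ 5 = 1) (h : a ^ 3 = b ^ 3) : a = b := by
  calc a = (a ^ 3) ^ 2 / a ^ 5 := by
        have : a ≠ 0 := by rintro rfl; norm_num at ha
        field_simp
    _ = (b ^ 3) ^ 2 / b ^ 5 := by rw [h, ha, hb]
    _ = b := by
        have : b ≠ 0 := by rintro rfl; norm_num at hb
        field_simp

theorem perm_cases (τ : Equiv.Perm (Fin 5)) (h0 : τ 0 = 0) (h2 : τ 2 = 2)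
    (h : (τ 1 = 1 ∧ τ 3 = 3 ∧ τ 4 = 4) ∨ (τ 1 = 3 ∧ τ 3 = 4 ∧ τ 4 = 1) ∨
      (τ 1 = 4 ∧ τ 3 = 1 ∧ τ 4 = 3)) : ∃ n : Fin 3, τ = threeCycle ^ (n : ℕ) := by
  rcases h with ⟨h1, h3, h4⟩ | ⟨h1, h3, h4⟩ | ⟨h1, h3, h4⟩
  · refine ⟨0, Equiv.ext fun i => ?_⟩
    fin_cases i <;> simp [h0, h1, h2, h3, h4]
  · refine ⟨1, Equiv.ext fun i => ?_⟩
    fin_cases i <;> simp [h0, h1, h2, h3, h4] <;> rfl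
  · refine ⟨2, Equiv.ext fun i => ?_⟩
    fin_cases i <;> simp [h0, h1, h2, h3, h4] <;> rfl

/-- A permutation of the coordinates that maps the line to a translate of itself under the
diagonal group is a power of the three-cycle. -/
theorem perm_eq_pow {ω b c : ℂ} (hω : IsPrimitiveRoot ω 3) (hb : b ≠ 0) (hc : c ≠ 0)
    (hb10 : b ^ 10 ≠ 1) {g : Fin 5 → ℂ} (hg : ∀ i, g i ^ 5 = 1) {τ : Equiv.Perm (Fin 5)}
    (h : (vgLine ω b c).map (Matrix.toLin' (Matrix.diagonal g)) = permLine τ (vgLine ω b c)) :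
    ∃ n : Fin 3, τ = threeCycle ^ (n : ℕ) := by
  have hs := cube_root_sum hω
  have h3 : ω ^ 3 = 1 := hω.pow_eq_one
  obtain ⟨hω0, hω1, hωm, hωs, hω21, -⟩ := ne_facts hω
  have hg0 : ∀ i, g i ≠ 0 := fun i h => by have := hg i; rw [h] at this; norm_num at this
  have key : ∀ u v, ∃ u' v', ∀ i, vgVec ω b c u' v' (τ i) = g i * vgVec ω b c u v i := by
    intro u v
    have := mem_diag_map.2 ⟨vgVec ω b c u v, mem_vgLine.2 ⟨u, v, rfl⟩, (rfl : _ = g * _)⟩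
    rw [h] at this
    obtain ⟨y, hy, hyτ⟩ := mem_permLine.1 this
    obtain ⟨u', v', rfl⟩ := mem_vgLine.1 hy
    exact ⟨u', v', fun i => congrFun hyτ i⟩
  -- The point with `u = 0` has the two vanishing coordinates `0` and `2`; hence `τ` preserves `{0,
  -- 2}`.
  obtain ⟨u', v', huv⟩ := key 0 1
  have hne : u' ≠ 0 ∨ v' ≠ 0 := by
    by_contra! hcon
    obtain ⟨rfl, rfl⟩ := hcon
    have := huv 1
    have h0 : ∀ i, vgVec ω b c 0 0 i = 0 := fun i => by fin_cases i <;> simp [vgVec]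
    rw [h0] at this
    simp [vgVec] at this
    exact hg0 1 this.symm
  obtain ⟨rfl, hτ⟩ := vgVec_two_zeros hs hb hc (τ.injective.ne (show (0 : Fin 5) ≠ 2 by decide))
    ((huv 0).trans (by simp [vgVec])) ((huv 2).trans (by simp [vgVec])) hne
  have hv' : v' ≠ 0 := by tauto
  rcases hτ with ⟨h0, h2⟩ | ⟨h0, h2⟩
  · refine perm_cases τ h0 h2 ?_
    -- Cubing removes the powers of `ω`. It shows that `g 1`, `g 3`, `g 4` have equal cubes, hence
    -- are equal as fifth roots of unity; then `τ` must respect the cyclic order of `1, ω, ω²`.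
    have hcube : ∀ i : Fin 5, i ≠ 0 → i ≠ 2 → vgVec ω b c 0 v' (τ i) ^ 3 = v' ^ 3 := by
      intro i hi0 hi2
      have e0 : τ i ≠ 0 := fun h => hi0 (τ.injective (h.trans h0.symm))
      have e2 : τ i ≠ 2 := fun h => hi2 (τ.injective (h.trans h2.symm))
      generalize τ i = j at e0 e2
      fin_cases j <;> simp [vgVec] at e0 e2 ⊢
      · rw [mul_pow, h3, one_mul]
      · rw [mul_pow, ← pow_mul, mul_comm 2 3, pow_mul, h3, one_pow, one_mul]
    have k1 : vgVec ω b c 0 v' (τ 1) = g 1 := (huv 1).trans (by simp [vgVec])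
    have k3 : vgVec ω b c 0 v' (τ 3) = g 3 * ω := (huv 3).trans (by simp [vgVec])
    have k4 : vgVec ω b c 0 v' (τ 4) = g 4 * ω ^ 2 := (huv 4).trans (by simp [vgVec])
    have c1 := hcube 1 (by decide) (by decide)
    have c3 := hcube 3 (by decide) (by decide)
    have c4 := hcube 4 (by decide) (by decide)
    rw [k1] at c1
    rw [k3, mul_pow, h3, mul_one] at c3
    rw [k4, mul_pow, ← pow_mul, mul_comm 2 3, pow_mul, h3, one_pow, mul_one] at c4
    have e13 := eq_of_pow_eq (hg 1) (hg 3) (c1.trans c3.symm)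
    have e14 := eq_of_pow_eq (hg 1) (hg 4) (c1.trans c4.symm)
    rw [← e13, ← k1] at k3
    rw [← e14, ← k1] at k4
    have i1 : τ 1 ≠ 0 := fun h => absurd (τ.injective (h.trans h0.symm)) (by decide)
    have i2 : τ 1 ≠ 2 := fun h => absurd (τ.injective (h.trans h2.symm)) (by decide)
    generalize τ 1 = j1 at *
    generalize τ 3 = j3 at *
    generalize τ 4 = j4 at *
    fin_cases j1 <;> fin_cases j3 <;> fin_cases j4 <;>
      simp [vgVec, hv', hω0] at i1 i2 k3 k4 ⊢ <;> grind
  -- If `τ` exchanged `0` and `2`, comparing these coordinates would give `g 0 = b² g 2`, whence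
  -- `b¹⁰ = 1`.
  · exfalso
    obtain ⟨u₂, v₂, huv₂⟩ := key 1 0
    have k0 := huv₂ 0
    have k2 := huv₂ 2
    rw [h0] at k0
    rw [h2] at k2
    simp [vgVec] at k0 k2
    apply hb10
    have e : g 0 = b ^ 2 * g 2 := by rw [← k0, k2]; ring
    have e5 := hg 0
    rw [e, mul_pow, hg 2, ← pow_mul, mul_one] at e5
    exact e5

/-- Scalars fix every line, so `g` is normalized by `g 0 = 1`; comparing coordinates of the images
of the two basis points then leaves only the identity. -/
theorem diag_stabilizer {ω b c : ℂ} (hb : b ≠ 0) (hc : c ≠ 0) (hω : ω ≠ 0) {g : Fin 5 → ℂ}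
    (h0 : g 0 = 1)
    (h : (vgLine ω b c).map (Matrix.toLin' (Matrix.diagonal g)) = vgLine ω b c) : g = 1 := by
  have key : ∀ u v, ∃ u' v', ∀ i, vgVec ω b c u' v' i = g i * vgVec ω b c u v i := by
    intro u v
    have := mem_diag_map.2 ⟨vgVec ω b c u v, mem_vgLine.2 ⟨u, v, rfl⟩, (rfl : _ = g * _)⟩
    rw [h] at this
    obtain ⟨u', v', h⟩ := mem_vgLine.1 this
    exact ⟨u', v', fun i => congrFun h.symm i⟩
  obtain ⟨u, v, k⟩ := key 1 0
  obtain ⟨u', v', k'⟩ := key 0 1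
  have a0 := k 0
  have a1 := k 1
  have a2 := k 2
  have a3 := k 3
  have a4 := k 4
  have b0 := k' 0
  have b1 := k' 1
  have b3 := k' 3
  simp only [vgVec, h0, Matrix.cons_val, mul_one, mul_zero, add_zero, zero_add, sub_zero,
    zero_sub] at a0 a1 a2 a3 a4 b0 b1 b3
  subst a0 a1
  have e2 : g 2 = 1 := mul_right_cancel₀ hb (by linear_combination -a2)
  have e3 : g 3 = 1 := mul_right_cancel₀ hc (by linear_combination -a3)
  have e4 : g 4 = 1 :=
    mul_right_cancel₀ (mul_ne_zero (pow_ne_zero 2 hω) hc) (by linear_combination a4)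
  have e1 : g 1 = 1 := mul_right_cancel₀ hω (by
    linear_combination b3 - ω * b1 - c * b0 + ω * e3)
  ext i
  fin_cases i
  exacts [h0, e1, e2, e3, e4]

/-- The permutation of the coordinates that gives the limit line for the base point with index
`(k, j)` and the sign with index `s`. -/
def limPerm (i : Fin 10 × Fin 2 × Fin 2) : Equiv.Perm (Fin 5) :=
  Equiv.swap 0 2 ^ ((i.2.1 + i.2.2 : Fin 2) : ℕ) * (Equiv.swap 3 4 ^ (i.2.1 : ℕ) * basePerm i.1)

/-- An invariant of the left coset of a permutation modulo the three-cycle. -/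
def cosetKey (ρ : Equiv.Perm (Fin 5)) : Fin 5 × Fin 5 × Bool :=
  (ρ.symm 0, ρ.symm 2, (decide (ρ.symm 1 < ρ.symm 3)).xor
    ((decide (ρ.symm 3 < ρ.symm 4)).xor (decide (ρ.symm 4 < ρ.symm 1))))

/-- The three-cycle shifts the preimages of `1`, `3`, `4` cyclically, and the Boolean entry is the
cyclic orientation of these three positions. -/
theorem cosetKey_threeCycle_pow (n : Fin 3) (ρ : Equiv.Perm (Fin 5)) :
    cosetKey (threeCycle ^ (n : ℕ) * ρ) = cosetKey ρ := by
  have key : ∀ ρ, cosetKey (threeCycle * ρ) = cosetKey ρ := fun ρ => by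
    have h0 : (threeCycle * ρ).symm 0 = ρ.symm 0 := rfl
    have h1 : (threeCycle * ρ).symm 1 = ρ.symm 4 := rfl
    have h2 : (threeCycle * ρ).symm 2 = ρ.symm 2 := rfl
    have h3 : (threeCycle * ρ).symm 3 = ρ.symm 1 := rfl
    have h4 : (threeCycle * ρ).symm 4 = ρ.symm 3 := rfl
    simp only [cosetKey, h0, h1, h2, h3, h4]
    congr 2
    cases decide (ρ.symm 4 < ρ.symm 1) <;> cases decide (ρ.symm 1 < ρ.symm 3) <;>
      cases decide (ρ.symm 3 < ρ.symm 4) <;> rfl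
  fin_cases n
  · simp
  · simp [key]
  · simp [pow_two, mul_assoc, key]

theorem cosetKey_limPerm_injective :
    ∀ i i', cosetKey (limPerm i) = cosetKey (limPerm i') → i = i' := by decide +kernel

theorem threeCycle_pow_injective : ∀ m n : Fin 3,
    threeCycle ^ (m : ℕ) = threeCycle ^ (n : ℕ) → m = n := by decide

theorem threeCycle_pow_mul_limPerm_injective : Function.Injective
    fun x : Fin 3 × (Fin 10 × Fin 2 × Fin 2) => threeCycle ^ (x.1 : ℕ) * limPerm x.2 := by
  rintro ⟨m, i⟩ ⟨n, i'⟩ h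
  simp only at h
  have h1 := congrArg cosetKey h
  rw [cosetKey_threeCycle_pow, cosetKey_threeCycle_pow] at h1
  obtain rfl := cosetKey_limPerm_injective _ _ h1
  rw [threeCycle_pow_injective _ _ (mul_right_cancel h)]

/-- Since `3 · 40 = 5!`, injectivity of the products implies surjectivity. -/
theorem exists_limPerm (ρ : Equiv.Perm (Fin 5)) :
    ∃ (n : Fin 3) (i : _), ρ = threeCycle ^ (n : ℕ) * limPerm i := by
  have h := (Fintype.bijective_iff_injective_and_card _).2
    ⟨threeCycle_pow_mul_limPerm_injective, by simp [Fintype.card_perm, Nat.factorial]⟩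
  obtain ⟨⟨n, i⟩, h⟩ := h.2 ρ
  exact ⟨n, i, h.symm⟩

theorem diag_map_diag (g h : Fin 5 → ℂ) (L : Submodule ℂ (Fin 5 → ℂ)) :
    (L.map (Matrix.toLin' (Matrix.diagonal h))).map (Matrix.toLin' (Matrix.diagonal g))
      = L.map (Matrix.toLin' (Matrix.diagonal (g * h))) := by
  ext x
  simp only [mem_diag_map]
  constructor
  · rintro ⟨_, ⟨y, hy, rfl⟩, rfl⟩
    exact ⟨y, hy, by rw [mul_assoc]⟩
  · rintro ⟨y, hy, rfl⟩
    exact ⟨_, ⟨y, hy, rfl⟩, by rw [mul_assoc]⟩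

theorem diag_map_one (L : Submodule ℂ (Fin 5 → ℂ)) :
    L.map (Matrix.toLin' (Matrix.diagonal 1)) = L := by
  ext x
  simp

theorem diag_map_smul (a : ℂ) (ha : a ≠ 0) (g : Fin 5 → ℂ) (L : Submodule ℂ (Fin 5 → ℂ)) :
    L.map (Matrix.toLin' (Matrix.diagonal (a • g)))
      = L.map (Matrix.toLin' (Matrix.diagonal g)) := by
  ext x
  simp only [mem_diag_map]
  constructor
  · rintro ⟨y, hy, rfl⟩
    exact ⟨a • y, L.smul_mem a hy, by rw [smul_mul_assoc, mul_smul_comm]⟩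
  · rintro ⟨y, hy, rfl⟩
    exact ⟨a⁻¹ • y, L.smul_mem _ hy, by rw [smul_mul_assoc, mul_smul_comm, smul_inv_smul₀ ha]⟩

theorem fifth_root_ne_zero {g : Fin 5 → ℂ} (hg : ∀ i, g i ^ 5 = 1) (i : Fin 5) : g i ≠ 0 :=
  fun h => by have := hg i; rw [h] at this; norm_num at this

theorem mem_gOrbit_self (L : Submodule ℂ (Fin 5 → ℂ)) : L ∈ gOrbit L :=
  ⟨1, by simp, by simp, (diag_map_one L).symm⟩

theorem gOrbit_trans {L L' L'' : Submodule ℂ (Fin 5 → ℂ)} (h : L' ∈ gOrbit L)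
    (h' : L'' ∈ gOrbit L') : L'' ∈ gOrbit L := by
  obtain ⟨g, hg, hp, rfl⟩ := h
  obtain ⟨k, hk, hq, rfl⟩ := h'
  exact ⟨k * g, fun i => by rw [Pi.mul_apply, mul_pow, hg, hk, one_mul],
    by simp [Finset.prod_mul_distrib, hp, hq], diag_map_diag _ _ _⟩

theorem gOrbit_symm {L L' : Submodule ℂ (Fin 5 → ℂ)} (h : L' ∈ gOrbit L) : L ∈ gOrbit L' := by
  obtain ⟨g, hg, hp, rfl⟩ := h
  refine ⟨g⁻¹, fun i => by rw [Pi.inv_apply, inv_pow, hg, inv_one],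
    by simp [Finset.prod_inv_distrib, hp], ?_⟩
  rw [diag_map_diag]
  have : g⁻¹ * g = 1 := by ext i; simp [fifth_root_ne_zero hg i]
  rw [this, diag_map_one]

theorem permLine_injective (π : Equiv.Perm (Fin 5)) : Function.Injective (permLine π) := by
  intro L L' h
  have := congrArg (permLine π⁻¹) h
  rwa [permLine_permLine, permLine_permLine, mul_inv_cancel, permLine_one, permLine_one] at this

/-- The orbit of a van Geemen line has `5³` elements. -/
theorem ncard_gOrbit_vgLine {ω b c : ℂ} (hb : b ≠ 0) (hc : c ≠ 0) (hω : ω ≠ 0) :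
    (gOrbit (vgLine ω b c)).ncard = 125 := by
  have hζ := Complex.isPrimitiveRoot_exp 5 (by norm_num)
  generalize Complex.exp (2 * Real.pi * Complex.I / (5 : ℕ)) = ζ at hζ
  have h5 : ζ ^ 5 = 1 := hζ.pow_eq_one
  have hζ0 : ζ ≠ 0 := hζ.ne_zero (by norm_num)
  -- Representatives of the group modulo scalars: entry `0` is `1`, the next three are free and the
  -- last is fixed by the product. Division by `g 0` keeps the product because `g 0 ^ 5 = 1`.
  set t : Fin 5 × Fin 5 × Fin 5 → Fin 5 → ℂ := fun i => ![1, ζ ^ (i.1 : ℕ), ζ ^ (i.2.1 : ℕ),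
    ζ ^ (i.2.2 : ℕ), (ζ ^ (i.1 : ℕ) * ζ ^ (i.2.1 : ℕ) * ζ ^ (i.2.2 : ℕ))⁻¹] with ht
  have hpow : ∀ n : ℕ, (ζ ^ n) ^ 5 = 1 := fun n => by rw [← pow_mul, mul_comm, pow_mul, h5, one_pow]
  have ht5 : ∀ i j, t i j ^ 5 = 1 := fun i j => by
    fin_cases j <;> simp [ht, hpow, mul_pow]
  have htp : ∀ i, ∏ j, t i j = 1 := fun i => by
    simp [ht, Fin.prod_univ_five]
    field_simp
  have hrange : gOrbit (vgLine ω b c)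
      = Set.range fun i => (vgLine ω b c).map (Matrix.toLin' (Matrix.diagonal (t i))) := by
    ext L
    constructor
    · rintro ⟨g, hg, hp, rfl⟩
      have hg0 := fifth_root_ne_zero hg
      have hex : ∀ j, ∃ n : Fin 5, ζ ^ (n : ℕ) = g j / g 0 := fun j => by
        obtain ⟨n, hn, h⟩ := hζ.eq_pow_of_pow_eq_one (ξ := g j / g 0)
          (by rw [div_pow, hg, hg, div_one])
        exact ⟨⟨n, hn⟩, h⟩
      choose n hn using hex
      refine ⟨(n 1, n 2, n 3), ?_⟩
      have e : g = g 0 • t (n 1, n 2, n 3) := by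
        ext j
        fin_cases j <;> simp [ht, hn]
        · exact (mul_div_cancel₀ _ (hg0 0)).symm
        · exact (mul_div_cancel₀ _ (hg0 0)).symm
        · exact (mul_div_cancel₀ _ (hg0 0)).symm
        · rw [Fin.prod_univ_five] at hp
          have := hg 0
          have h1 := hg0 1
          have h2 := hg0 2
          have h3 := hg0 3
          have h0 := hg0 0
          field_simp
          grind
      simp only
      conv_rhs => rw [e]
      rw [diag_map_smul _ (hg0 0)]
    · rintro ⟨i, rfl⟩
      exact ⟨t i, ht5 i, htp i, rfl⟩
  have hinj : Function.Injective
      fun i => (vgLine ω b c).map (Matrix.toLin' (Matrix.diagonal (t i))) := by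
    intro i i' h
    simp only at h
    have h0 : ∀ j, t i' j ≠ 0 := fifth_root_ne_zero (ht5 i')
    have h1 := congrArg (fun L => L.map (Matrix.toLin' (Matrix.diagonal (t i')⁻¹))) h
    simp only [diag_map_diag] at h1
    have e : (t i')⁻¹ * t i' = 1 := by ext j; simp [h0 j]
    rw [e, diag_map_one] at h1
    have h2 := diag_stabilizer hb hc hω (by simp [ht]) h1
    have h3 : ∀ j, t i j = t i' j := fun j => by
      have := congrFun h2 j
      simp only [Pi.mul_apply, Pi.inv_apply, Pi.one_apply] at this
      rwa [inv_mul_eq_one₀ (h0 j), eq_comm] at this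
    have a1 := hζ.pow_inj i.1.2 i'.1.2 (h3 1)
    have a2 := hζ.pow_inj i.2.1.2 i'.2.1.2 (h3 2)
    have a3 := hζ.pow_inj i.2.2.2 i'.2.2.2 (h3 3)
    exact Prod.ext (Fin.ext a1) (Prod.ext (Fin.ext a2) (Fin.ext a3))
  rw [hrange, Set.ncard_range_of_injective hinj]
  simp

theorem ncard_gOrbit_permLine {ω b c : ℂ} (hb : b ≠ 0) (hc : c ≠ 0) (hω : ω ≠ 0)
    (π : Equiv.Perm (Fin 5)) : (gOrbit (permLine π (vgLine ω b c))).ncard = 125 := by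
  rw [gOrbit_permLine, Set.ncard_image_of_injective _ (permLine_injective π),
    ncard_gOrbit_vgLine hb hc hω]

/-- A common line would give a diagonal map relating the two permuted lines; by `perm_eq_pow` the
permutations then lie in one coset of the three-cycle, and the coset keys of distinct indices
differ. -/
theorem disjoint_gOrbit_limPerm {ω b c : ℂ} (hω : IsPrimitiveRoot ω 3) (hb : b ≠ 0) (hc : c ≠ 0)
    (hb10 : b ^ 10 ≠ 1) {i i' : Fin 10 × Fin 2 × Fin 2} (hi : i ≠ i') :
    Disjoint (gOrbit (permLine (limPerm i) (vgLine ω b c)))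
      (gOrbit (permLine (limPerm i') (vgLine ω b c))) := by
  rw [Set.disjoint_left]
  intro L h h'
  apply hi
  have h1 := gOrbit_trans h' (gOrbit_symm h)
  rw [gOrbit_permLine] at h1
  obtain ⟨_, ⟨g, hg, -, rfl⟩, h2⟩ := h1
  have h3 := congrArg (permLine (limPerm i')⁻¹) h2
  rw [permLine_permLine, mul_inv_cancel, permLine_one, permLine_permLine] at h3
  obtain ⟨n, hn⟩ := perm_eq_pow hω hb hc hb10 hg h3
  rw [mul_inv_eq_iff_eq_mul] at hn
  apply cosetKey_limPerm_injective
  rw [hn, cosetKey_threeCycle_pow]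

/-! ### All van Geemen lines -/

/-- The substitution `u ↦ ξu` absorbs the factor in `c` and leaves `ξ⁻¹` and `ξ` on the coordinates
`0` and `2`. For `ξ⁵ = 1` this is an element of `𝒢`, so the orbit depends on `γ` only through `γ⁵`.
-/
theorem vgLine_mul_root {ψ ω γ ξ : ℂ} (hξ0 : ξ ≠ 0) :
    vgLine ω (coefB ψ (ξ * γ)) (coefC ω ψ (ξ * γ)) = (vgLine ω (coefB ψ γ) (coefC ω ψ γ)).map
      (Matrix.toLin' (Matrix.diagonal ![ξ⁻¹, 1, ξ, 1, 1])) := by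
  ext x
  rw [mem_vgLine, mem_diag_map]
  constructor
  · rintro ⟨u, v, rfl⟩
    refine ⟨_, mem_vgLine.2 ⟨ξ * u, v, rfl⟩, ?_⟩
    ext i
    fin_cases i <;> simp [vgVec, coefB, coefC] <;> field_simp
    simp
  · rintro ⟨y, hy, rfl⟩
    obtain ⟨u, v, rfl⟩ := mem_vgLine.1 hy
    refine ⟨ξ⁻¹ * u, v, ?_⟩
    ext i
    fin_cases i <;> simp [vgVec, coefB, coefC] <;> field_simp
    simp

/-- Passing to `2/(3ψγ)` replaces `b` by `1/b` and `c` by `c/b`, that is, it takes `bu` instead of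
`u` as the parameter. -/
theorem vgLine_inv {ψ ω γ : ℂ} (hψ : ψ ≠ 0) (hγ : γ ≠ 0) :
    vgLine ω (coefB ψ (2 / (3 * ψ * γ))) (coefC ω ψ (2 / (3 * ψ * γ)))
      = permLine (Equiv.swap 0 2) (vgLine ω (coefB ψ γ) (coefC ω ψ γ)) := by
  ext x
  rw [mem_vgLine, mem_permLine]
  constructor
  · rintro ⟨u, v, rfl⟩
    refine ⟨_, mem_vgLine.2 ⟨(coefB ψ γ)⁻¹ * u, v, rfl⟩, ?_⟩
    ext i
    fin_cases i <;> simp [vgVec, coefB, coefC, Equiv.swap_apply_def] <;> field_simp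
    · norm_num
    · simp
  · rintro ⟨y, hy, rfl⟩
    obtain ⟨u, v, rfl⟩ := mem_vgLine.1 hy
    refine ⟨coefB ψ γ * u, v, ?_⟩
    ext i
    fin_cases i <;> simp [vgVec, coefB, coefC, Equiv.swap_apply_def] <;> field_simp
    norm_num

theorem span_vgPoint (ω ζ b c : ℂ) (k l : ℤ) :
    Submodule.span ℂ {vgPoint ω ζ b c k l 1 0, vgPoint ω ζ b c k l 0 1}
      = (vgLine ω b c).map (Matrix.toLin' (Matrix.diagonal
          ![1, 1, ζ ^ (-k - l), ζ ^ k, ζ ^ l])) := by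
  have e : ∀ u v, vgPoint ω ζ b c k l u v = ![1, 1, ζ ^ (-k - l), ζ ^ k, ζ ^ l] * vgVec ω b c u v :=
    fun u v => by
      ext i
      fin_cases i <;> simp [vgPoint, vgVec] <;> ring
  rw [vgLine, diag_map_span_pair, e, e]

theorem gamma5_inv {ψ φ ω γ : ℂ} (hφ : φ ^ 2 = 32 / ψ ^ 5 - 3 / 4)
    (hω : ω ^ 2 + ω + 1 = 0) (hψ : ψ ≠ 0) (hγ0 : γ ≠ 0) (hγ : γ ^ 5 = gamma5 ω φ) :
    (2 / (3 * ψ * γ)) ^ 5 = gamma5 ω (-φ) := by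
  have h : gamma5 ω φ * gamma5 ω (-φ) = (2 / (3 * ψ)) ^ 5 := by
    have h32 : (2 / (3 * ψ)) ^ 5 = (φ ^ 2 + 3 / 4) / 243 := by
      rw [hφ]; field_simp; ring
    rw [h32]; unfold gamma5; linear_combination (-φ ^ 2 / 729) * sq_sub_sq hω
  rw [← hγ] at h
  have h5 : γ ^ 5 ≠ 0 := pow_ne_zero 5 hγ0
  rw [← div_div, div_pow, ← h]
  field_simp

/-- The two signs. -/
noncomputable def signed (φ : ℂ) (s : Fin 2) : ℂ := ![φ, -φ] s

theorem signed_sq (φ : ℂ) (s : Fin 2) : signed φ s ^ 2 = φ ^ 2 := by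
  fin_cases s <;> simp [signed]

theorem mem_pair_iff_signed {φ μ : ℂ} : μ ∈ ({φ, -φ} : Set ℂ) ↔ ∃ s, signed φ s = μ := by
  constructor
  · rintro (rfl | rfl)
    exacts [⟨0, rfl⟩, ⟨1, rfl⟩]
  · rintro ⟨s, rfl⟩
    fin_cases s <;> simp [signed]

/-- Conjugating `ω` and changing the sign of `φ` have the same effect on `gamma5`, so the value is
that of `γ⁵` when `j + s` is even and the other root when it is odd. Hence the exponent `j + s` of
the swap from `vgLine_inv`; conjugation alone accounts for the other swap. -/
theorem exists_vgLine_eq {ψ φ ω γ : ℂ} (hψ : ψ ≠ 0) (hφ : φ ^ 2 = 32 / ψ ^ 5 - 3 / 4)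
    (hω : IsPrimitiveRoot ω 3) (hγ : γ ^ 5 = gamma5 ω φ) (hγ0 : γ ≠ 0) (j s : Fin 2) :
    ∃ γ' : ℂ, γ' ^ 5 = gamma5 (cubeRoot ω j) (signed φ s) ∧
      vgLine (cubeRoot ω j) (coefB ψ γ') (coefC (cubeRoot ω j) ψ γ')
        = permLine (Equiv.swap 0 2 ^ ((j + s : Fin 2) : ℕ) * Equiv.swap 3 4 ^ (j : ℕ))
          (vgLine ω (coefB ψ γ) (coefC ω ψ γ)) := by
  have hs := cube_root_sum hω
  have h3 := hω.pow_eq_one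
  have hinv := gamma5_inv hφ hs hψ hγ0 hγ
  fin_cases j <;> fin_cases s
  · exact ⟨γ, hγ, (permLine_one _).symm⟩
  · refine ⟨2 / (3 * ψ * γ), hinv, ?_⟩
    refine (vgLine_inv hψ hγ0).trans ?_
    simp [cubeRoot]
  · refine ⟨2 / (3 * ψ * γ), ?_, ?_⟩
    · exact hinv.trans (gamma5_neg ω φ h3)
    · refine (vgLine_sq hs).trans ?_
      rw [vgLine_inv hψ hγ0, permLine_permLine]
      simp
  · refine ⟨γ, ?_, ?_⟩
    · refine hγ.trans ?_
      have := gamma5_neg ω (-φ) h3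
      rwa [neg_neg] at this
    · refine (vgLine_sq hs).trans ?_
      simp

theorem limitLines_bpt {ψ φ ω γ : ℂ} (hψ : ψ ≠ 0) (hφ : φ ^ 2 = 32 / ψ ^ 5 - 3 / 4)
    (hω : IsPrimitiveRoot ω 3) (hγ : γ ^ 5 = gamma5 ω φ) (hγ0 : γ ≠ 0) (k : Fin 10)
    (j s : Fin 2) :
    limitLines ψ (signed φ s) (bpt hω (k, j))
      = gOrbit (permLine (limPerm (k, j, s)) (vgLine ω (coefB ψ γ) (coefC ω ψ γ))) := by
  obtain ⟨γ', hγ', h⟩ := exists_vgLine_eq hψ hφ hω hγ hγ0 j s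
  have := limitLines_bp hψ ((signed_sq φ s).trans hφ) (primitive_cubeRoot hω j) hγ' k
  rw [h, permLine_permLine, mul_assoc] at this
  exact this

theorem mul_root_mem_gOrbit {ψ ω γ ξ : ℂ} (hξ : ξ ^ 5 = 1) :
    vgLine ω (coefB ψ (ξ * γ)) (coefC ω ψ (ξ * γ))
      ∈ gOrbit (vgLine ω (coefB ψ γ) (coefC ω ψ γ)) := by
  have hξ0 : ξ ≠ 0 := by rintro rfl; norm_num at hξ
  refine ⟨_, fun i => ?_, ?_, vgLine_mul_root hξ0⟩
  · fin_cases i <;> simp [hξ]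
  · simp [Fin.prod_univ_five, hξ0]

theorem gOrbit_permLine_subset_vanGeemenLines {ψ φ ω γ : ℂ} (hψ : ψ ≠ 0)
    (hφ : φ ^ 2 = 32 / ψ ^ 5 - 3 / 4) (hω : IsPrimitiveRoot ω 3) (hγ : γ ^ 5 = gamma5 ω φ)
    (ρ : Equiv.Perm (Fin 5)) :
    gOrbit (permLine ρ (vgLine ω (coefB ψ γ) (coefC ω ψ γ))) ⊆ vanGeemenLines ψ := by
  rw [gOrbit_permLine]
  rintro _ ⟨_, ⟨g, hg, hp, rfl⟩, rfl⟩
  have hζ := Complex.isPrimitiveRoot_exp 5 (by norm_num)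
  generalize Complex.exp (2 * Real.pi * Complex.I / (5 : ℕ)) = ζ at hζ
  have hg0 := fifth_root_ne_zero hg
  have hex : ∀ a b, ∃ n : ℕ, ζ ^ n = g a / g b := fun a b => by
    obtain ⟨n, -, h⟩ := hζ.eq_pow_of_pow_eq_one (ξ := g a / g b)
      (by rw [div_pow, hg, hg, div_one])
    exact ⟨n, h⟩
  obtain ⟨k, hk⟩ := hex 3 1
  obtain ⟨l, hl⟩ := hex 4 1
  -- The diagonal element is scaled to have entry `1` at index `1`; its entry at `0` is then
  -- absorbed into `γ` as a fifth root of unity, and the rest has the form prescribed by `k` and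
  -- `l`.
  set ξ := g 1 / g 0 with hξ
  have hξ5 : ξ ^ 5 = 1 := by rw [hξ, div_pow, hg, hg, div_one]
  have hξ0 : ξ ≠ 0 := div_ne_zero (hg0 1) (hg0 0)
  have hζ0 : ζ ≠ 0 := hζ.ne_zero (by norm_num)
  refine ⟨ω, ζ, ξ * γ, k, l, ρ, hω, hζ, ?_, ?_⟩
  · rw [gammaEq_iff hψ hφ (cube_root_sum hω), mul_pow, hξ5, one_mul]
    exact Or.inl hγ
  · rw [span_vgPoint, vgLine_mul_root hξ0, diag_map_diag]
    have e : g = g 1 • (![1, 1, ζ ^ (-(k : ℤ) - l), ζ ^ (k : ℤ), ζ ^ (l : ℤ)]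
        * ![ξ⁻¹, 1, ξ, 1, 1]) := by
      rw [Fin.prod_univ_five] at hp
      have h5 := hg 1
      have n0 := hg0 0
      have n1 := hg0 1
      have n3 := hg0 3
      have n4 := hg0 4
      have e2 : ζ ^ (-(k : ℤ) - l) = (g 1) ^ 2 / (g 3 * g 4) := by
        rw [sub_eq_add_neg, zpow_add₀ hζ0, zpow_neg, zpow_neg, zpow_natCast, zpow_natCast, hk, hl]
        field_simp
      ext i
      fin_cases i <;> simp [e2, hk, hl, hξ]
      · field_simp
      · field_simp
        exact mul_left_cancel₀ n1 (by linear_combination hp - h5)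
      · field_simp
      · field_simp
    conv_lhs => rw [e]
    rw [diag_map_smul _ (hg0 1)]

/-- The cube root of unity determines `j`, and `γ₁⁵` then determines the sign. Fifth roots in `γ₁`
and the powers of `ζ` move the line only within its `𝒢`-orbit, and the permutation matters only
modulo the three-cycle. -/
theorem vanGeemenLines_subset {ψ φ ω γ : ℂ} (hψ : ψ ≠ 0)
    (hφ : φ ^ 2 = 32 / ψ ^ 5 - 3 / 4) (hω : IsPrimitiveRoot ω 3) (hγ : γ ^ 5 = gamma5 ω φ)
    (hγ0 : γ ≠ 0) :
    vanGeemenLines ψ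
      ⊆ ⋃ i, gOrbit (permLine (limPerm i) (vgLine ω (coefB ψ γ) (coefC ω ψ γ))) := by
  rintro L ⟨ω', ζ, γ₁, k, l, π, hω', hζ, hγ₁, rfl⟩
  obtain ⟨j, rfl⟩ : ∃ j, ω' = cubeRoot ω j := by
    rcases primitive_cube_root_cases hω hω' with rfl | rfl
    exacts [⟨0, rfl⟩, ⟨1, rfl⟩]
  obtain ⟨s, hs⟩ : ∃ s, γ₁ ^ 5 = gamma5 (cubeRoot ω j) (signed φ s) := by
    rcases (gammaEq_iff hψ hφ (cube_root_sum hω')).1 hγ₁ with h | h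
    exacts [⟨0, h⟩, ⟨1, h⟩]
  obtain ⟨γ', hγ', hline⟩ := exists_vgLine_eq hψ hφ hω hγ hγ0 j s
  have hγ'0 : γ' ≠ 0 :=
    (isRowData hψ ((signed_sq φ s).trans hφ) hω' hγ').gamma_ne
  have hξ : (γ₁ / γ') ^ 5 = 1 := by
    rw [div_pow, hs, hγ', div_self]
    rw [← hγ']
    exact pow_ne_zero 5 hγ'0
  have h1 := mul_root_mem_gOrbit (ψ := ψ) (ω := cubeRoot ω j) (γ := γ') hξ
  rw [div_mul_cancel₀ _ hγ'0, hline] at h1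
  have hζ5 := hζ.pow_eq_one
  have hζ0 : ζ ≠ 0 := hζ.ne_zero (by norm_num)
  have hz : ∀ n : ℤ, (ζ ^ n) ^ 5 = 1 := fun n => by
    rw [← zpow_natCast, ← zpow_mul, mul_comm, zpow_mul, zpow_natCast, hζ5, one_zpow]
  have h2 : (vgLine (cubeRoot ω j) (coefB ψ γ₁) (coefC (cubeRoot ω j) ψ γ₁)).map
      (Matrix.toLin' (Matrix.diagonal ![1, 1, ζ ^ (-k - l), ζ ^ k, ζ ^ l]))
      ∈ gOrbit (vgLine (cubeRoot ω j) (coefB ψ γ₁) (coefC (cubeRoot ω j) ψ γ₁)) := by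
    refine ⟨_, fun i => ?_, ?_, rfl⟩
    · fin_cases i <;> simp [hz]
    · simp only [Fin.prod_univ_five, Matrix.cons_val, one_mul]
      rw [← zpow_add₀ hζ0, ← zpow_add₀ hζ0]
      convert zpow_zero ζ using 2
      ring
  have h3 : permLine π _ ∈ _ := Set.mem_image_of_mem (permLine π) (gOrbit_trans h1 h2)
  rw [← gOrbit_permLine, permLine_permLine] at h3
  obtain ⟨n, i, hi⟩ := exists_limPerm
    (Equiv.swap 0 2 ^ ((j + s : Fin 2) : ℕ) * Equiv.swap 3 4 ^ (j : ℕ) * π)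
  rw [hi, permLine_threeCycle_pow (cube_root_sum hω), ← span_vgPoint] at h3
  exact Set.mem_iUnion.2 ⟨i, h3⟩

theorem iUnion_gOrbit_limPerm {ψ φ ω γ : ℂ} (hψ : ψ ≠ 0)
    (hφ : φ ^ 2 = 32 / ψ ^ 5 - 3 / 4) (hω : IsPrimitiveRoot ω 3) (hγ : γ ^ 5 = gamma5 ω φ)
    (hγ0 : γ ≠ 0) :
    ⋃ i, gOrbit (permLine (limPerm i) (vgLine ω (coefB ψ γ) (coefC ω ψ γ)))
      = vanGeemenLines ψ :=
  Set.Subset.antisymm (Set.iUnion_subset fun _ =>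
    gOrbit_permLine_subset_vanGeemenLines hψ hφ hω hγ _) (vanGeemenLines_subset hψ hφ hω hγ hγ0)

/-- For the parameters at hand the number `b` is not a tenth root of unity. -/
theorem IsRowData.b_pow_ne {ψ μ ω γ b c : ℂ} (h : IsRowData ψ μ ω γ b c) (hμ : μ ≠ 0) :
    b ^ 10 ≠ 1 := by
  intro h0
  have h1 := h.b_pow
  apply hμ
  rw [h.mu_eq]
  -- As `b⁵ (1 - 9γ⁵) = 9γ⁵`, the assumption `b¹⁰ = 1` means `9γ⁵ = 1/2`, the value belonging to `μ
  -- = 0`.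
  have : (1 - 9 * γ ^ 5) ^ 2 = (9 * γ ^ 5) ^ 2 := by
    linear_combination (b ^ 5 * (1 - 9 * γ ^ 5) + 9 * γ ^ 5) * h1 - (1 - 9 * γ ^ 5) ^ 2 * h0
  linear_combination (-(ω - ω ^ 2) / 2) * this

end DworkLines

/-! ### Assembly of the main theorem. -/

theorem mainTheorem3 (ψ φ ω : ℂ) (hψ : ψ ≠ 0) (hφ : φ ^ 2 = 32 / ψ ^ 5 - 3 / 4) (hφ0 : φ ≠ 0)
    (hω : IsPrimitiveRoot ω 3) :
    -- the two curves in `P¹ × P¹` meet in seventeen points, three of which are nodes of both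
    (curve0 φ ∩ curve0 (-φ) = meetingPoints ω ∧ (meetingPoints ω).ncard = 17 ∧
      nodes ⊆ meetingPoints ω ∧ nodes.ncard = 3 ∧
      (∀ μ ∈ ({φ, -φ} : Set ℂ), (∀ p ∈ nodes, IsNodeAt μ p) ∧
        ∀ p ∈ meetingPoints ω \ nodes, IsSmoothAt μ p)) ∧
    -- the resolution: `dP₅` is mapped to `P¹ × P¹`, bijectively outside the nodes, over which
    -- there are the lines `E₂₄`, `E₁₄`, `E₁₂`; the image of `C_μ` is `C⁰_μ`
    ((∀ P ∈ dP5, ∃! p, BlowDown P p) ∧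
      (∀ p, p ∉ nodes → ∃! P, P ∈ dP5 ∧ BlowDown P p) ∧
      {P | P ∈ dP5 ∧ BlowDown P (aff 0, infty)} = excLine 5 ∧
      {P | P ∈ dP5 ∧ BlowDown P (infty, aff 0)} = excLine 2 ∧
      {P | P ∈ dP5 ∧ BlowDown P (aff 1, aff 1)} = excLine 0 ∧
      (∀ k, excLine k ⊆ dP5) ∧
      ∀ μ ∈ ({φ, -φ} : Set ℂ), {p | ∃ P ∈ curve μ, BlowDown P p} = curve0 μ) ∧
    -- the twenty base points of the Wiman pencil, two on each of the ten exceptional lines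
    (curve φ ∩ curve (-φ) = basePoints ∧ basePoints.ncard = 20 ∧
      {p | ∃ P ∈ basePoints, BlowDown P p} = meetingPoints ω ∧
      (∀ p ∈ nodes, {P | P ∈ basePoints ∧ BlowDown P p}.ncard = 2) ∧
      (∀ p ∈ meetingPoints ω \ nodes, {P | P ∈ basePoints ∧ BlowDown P p}.ncard = 1) ∧
      (∀ P ∈ basePoints, ∃! k, P ∈ excLine k) ∧
      ∀ k, (basePoints ∩ excLine k).ncard = 2 ∧
        ∀ μ ∈ ({φ, -φ} : Set ℂ), curve μ ∩ excLine k = basePoints ∩ excLine k) ∧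
    -- the two values of `γ⁵` correspond to the two curves
    (∀ γ : ℂ, GammaEq ψ γ ↔ γ ^ 5 = gamma5 ω φ ∨ γ ^ 5 = gamma5 ω (-φ)) ∧
    -- the table of limiting processes
    (∀ μ ∈ ({φ, -φ} : Set ℂ), ∀ γ : ℂ, γ ^ 5 = gamma5 ω μ →
      ∀ b c : ℂ, b = coefB ψ γ → c = coefC ω ψ γ →
      LimitingProcess ψ μ (psiVec 0 (-ω)) 0 (-ω) (9 * γ ^ 5) 0 2
        (fun e u v => (c * u / e ^ 5, -v))
        (fun u v => ![u, v, -ω ^ 2 * (c * u - v), c * u + ω * v, b * u]) ∧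
      LimitingProcess ψ μ (psiVec 1 (-ω)) 1 (-ω) (9 * ω * γ ^ 5) 0 2
        (fun e u v => (-ω ^ 2 * v / e, -(c * u + ω * v) / e))
        (fun u v => ![v, c * u + ω * v, -ω ^ 2 * (c * u - v), u, b * u]) ∧
      (∀ δ : ℂ, δ ^ 5 = ω ^ 2 / (9 * γ ^ 5) →
        LimitingProcess ψ μ (psiVec (-ω) (-ω ^ 2)) (-ω) (-ω ^ 2)
          (ω * (2 / (3 * ψ)) ^ 5 / γ ^ 10) 0 2
          (fun e u v => ((c * u + ω * v) / (δ * e), -ω ^ 2 * (c * u - v) / (δ * e)))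
          (fun u v => ![c * u + ω * v, -ω ^ 2 * (c * u - v), b * u, v, u])) ∧
      LimitingProcess ψ μ (excVec 0 1 (ω ^ 2)) 1 1 (ω ^ 2) (ω + 9 * γ ^ 5) 3
        (fun e u v => (ω * c * u / e ^ 6 - (ω * c * u - v) / (2 * e),
          -(ω * c * u) / e ^ 6 - (ω * c * u - v) / (2 * e)))
        (fun u v => ![b * u, u, v, -ω ^ 2 * (c * u - v), c * u + ω * v]) ∧
      LimitingProcess ψ μ (excVec 0 1 ω) 1 1 ω (-(ω + 9 * γ ^ 5)) 3
        (fun e u v => (-(ω * c * u) / e ^ 6 + (ω * c * u + v) / (2 * e),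
          ω * c * u / e ^ 6 + (ω * c * u + v) / (2 * e)))
        (fun u v => ![u, b * u, v, c * u + ω * v, -ω ^ 2 * (c * u - v)])) ∧
    -- at each base point, each of the two families has, up to the diagonal group, exactly one
    -- limit line, and this is a van Geemen line; this gives forty disjoint orbits of 125 lines
    -- each, which together are all the 5000 van Geemen lines
    ((∀ μ ∈ ({φ, -φ} : Set ℂ), ∀ P ∈ basePoints,
        ∃ L ∈ vanGeemenLines ψ, limitLines ψ μ P = gOrbit L ∧ (gOrbit L).ncard = 125) ∧
      (∀ μ ∈ ({φ, -φ} : Set ℂ), ∀ μ' ∈ ({φ, -φ} : Set ℂ), ∀ P ∈ basePoints, ∀ P' ∈ basePoints,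
        (μ, P) ≠ (μ', P') → Disjoint (limitLines ψ μ P) (limitLines ψ μ' P')) ∧
      {O | ∃ μ ∈ ({φ, -φ} : Set ℂ), ∃ P ∈ basePoints, O = limitLines ψ μ P}.ncard = 40 ∧
      (⋃ μ ∈ ({φ, -φ} : Set ℂ), ⋃ P ∈ basePoints, limitLines ψ μ P) = vanGeemenLines ψ ∧
      (vanGeemenLines ψ).ncard = 5000) := by
  have hμ : ∀ μ ∈ ({φ, -φ} : Set ℂ), μ ^ 2 = 32 / ψ ^ 5 - 3 / 4 := by
    rintro μ (rfl | rfl)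
    exacts [hφ, by rw [neg_sq, hφ]]
  -- A single `γ`, belonging to `φ`, serves throughout the count: all forty orbits are those of
  -- coordinate permutations of its line.
  obtain ⟨γ, hγ⟩ := IsAlgClosed.exists_pow_nat_eq (gamma5 ω φ) (n := 5) (by norm_num)
  have hdata := isRowData hψ hφ hω hγ
  have hlim := limitLines_bpt hψ hφ hω hγ hdata.gamma_ne
  have hcard := ncard_gOrbit_permLine hdata.b_ne hdata.c_ne (primitive_ne_zero hω)
  have hdisj := fun {i i'} => disjoint_gOrbit_limPerm (i := i) (i' := i') hω hdata.b_ne hdata.c_ne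
    (hdata.b_pow_ne hφ0)
  have hunion := iUnion_gOrbit_limPerm hψ hφ hω hγ hdata.gamma_ne
  -- Disjoint orbits are distinct because an orbit contains its own line and so is nonempty.
  have hinj : Function.Injective fun i =>
      gOrbit (permLine (limPerm i) (vgLine ω (coefB ψ γ) (coefC ω ψ γ))) := by
    intro i i' h
    by_contra hne
    have := hdisj hne
    simp only at h
    rw [h, disjoint_self] at this
    exact Set.notMem_empty _ ((show gOrbit _ = ∅ from this) ▸ mem_gOrbit_self _)
  have hbp : ∀ {μ}, μ ∈ ({φ, -φ} : Set ℂ) → ∀ {P}, P ∈ basePoints →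
      ∃ k j s, signed φ s = μ ∧ bpt hω (k, j) = P := by
    intro μ hμ P hP
    obtain ⟨s, hs⟩ := mem_pair_iff_signed.1 hμ
    rw [basePoints_eq_range hω] at hP
    obtain ⟨⟨k, j⟩, hP⟩ := hP
    exact ⟨k, j, s, hs, hP⟩
  have hbp' : ∀ i, bpt hω i ∈ basePoints := fun i => by
    rw [basePoints_eq_range hω]; exact ⟨i, rfl⟩
  have hsg : ∀ s, signed φ s ∈ ({φ, -φ} : Set ℂ) := fun s => mem_pair_iff_signed.2 ⟨s, rfl⟩
  refine ⟨⟨curve0_inter hφ0 hω, ncard_meetingPoints hω, nodes_subset ω, ncard_nodes hω,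
    fun μ _ => ⟨fun p hp => isNodeAt_nodes μ hp, fun p hp => isSmoothAt_meetingPoints hω μ hp⟩⟩,
    ⟨fun P hP => blowDown_existsUnique hP, fun p hp => fiber_unique hp, fiber_zero_infty,
      fiber_infty_zero, fiber_one_one, excLine_subset, fun μ _ => image_curve μ⟩,
    ⟨curve_inter hφ0, ncard_basePoints, blowDown_basePoints hω,
      fun p hp => ncard_basePoints_node hp, fun p hp => ncard_basePoints_regular hω hp,
      fun P hP => existsUnique_excLine hP, fun k => ⟨ncard_basePoints_inter_excLine k,
        fun μ _ => (curve_inter_excLine hω μ k).trans (basePoints_inter_excLine hω k).symm⟩⟩,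
    fun γ => gammaEq_iff hψ hφ (cube_root_sum hω), ?_, ?_, ?_, ?_, ?_, ?_⟩
  · rintro μ hμm γ hγ _ _ rfl rfl
    have h := isRowData hψ (hμ μ hμm) hω hγ
    exact ⟨limitingProcess_zero_root hψ (hμ μ hμm) hω h, limitingProcess_one_root hψ (hμ μ hμm) hω h,
      fun δ hδ => limitingProcess_root_root hψ (hμ μ hμm) hω h hδ,
      limitingProcess_node_sq hψ (hμ μ hμm) hω h, limitingProcess_node_one hψ (hμ μ hμm) hω h⟩
  · intro μ hμm P hP
    obtain ⟨k, j, s, rfl, rfl⟩ := hbp hμm hP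
    refine ⟨_, ?_, hlim k j s, hcard _⟩
    rw [← hunion]
    exact Set.mem_iUnion.2 ⟨_, mem_gOrbit_self _⟩
  · intro μ hμm μ' hμm' P hP P' hP' hne
    obtain ⟨k, j, s, rfl, rfl⟩ := hbp hμm hP
    obtain ⟨k', j', s', rfl, rfl⟩ := hbp hμm' hP'
    rw [hlim, hlim]
    refine hdisj fun h => hne ?_
    simp only [Prod.mk.injEq] at h
    obtain ⟨rfl, rfl, rfl⟩ := h
    rfl
  · have : {O | ∃ μ ∈ ({φ, -φ} : Set ℂ), ∃ P ∈ basePoints, O = limitLines ψ μ P}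
        = Set.range fun i =>
          gOrbit (permLine (limPerm i) (vgLine ω (coefB ψ γ) (coefC ω ψ γ))) := by
      ext O
      constructor
      · rintro ⟨μ, hμm, P, hP, rfl⟩
        obtain ⟨k, j, s, rfl, rfl⟩ := hbp hμm hP
        exact ⟨_, (hlim k j s).symm⟩
      · rintro ⟨⟨k, j, s⟩, rfl⟩
        exact ⟨_, hsg s, _, hbp' (k, j), (hlim k j s).symm⟩
    rw [this, Set.ncard_range_of_injective hinj]
    simp
  · rw [← hunion]
    ext L
    simp only [Set.mem_iUnion]
    constructor
    · rintro ⟨μ, hμm, P, hP, hL⟩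
      obtain ⟨k, j, s, rfl, rfl⟩ := hbp hμm hP
      exact ⟨_, hlim k j s ▸ hL⟩
    · rintro ⟨⟨k, j, s⟩, hL⟩
      exact ⟨_, hsg s, _, hbp' (k, j), hlim k j s ▸ hL⟩
  · rw [← hunion, Set.ncard_iUnion_of_finite
      (fun i => Set.finite_of_ncard_ne_zero (by rw [hcard]; norm_num)) (fun i i' h => hdisj h)]
    simp [hcard, finsum_eq_sum_of_fintype]
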